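/- **Setting.** Let $b_i,h_i,\sigma_{p,i},\sigma_{f,i}>0$ ($i\ge 1$) be known constants, $\tilde b_i=b_i/(b_i+h_i)$, and let $\theta=(\theta_i)_{i\ge1}$ be a real sequence. Write $N(\mu,\sigma)$ for the normal law with mean $\mu$ and variance $\sigma$, and $\phi,\Phi$ for the standard normal density and distribution function. For each $n$ let $X=(X_1,\dots,X_n)$ have independent coordinates $X_i\sim N(\theta_i,\sigma_{p,i})$. For $q\in\mathbb R^n$ put $$L_n(\theta,q)=\frac1n\sum_{i=1}^n \mathbb E_{Y_i\sim N(\theta_i,\sigma_{f,i})}\big[b_i(Y_i-q_i)^++h_i(q_i-Y_i)^+\big],$$ and for a predictor $\hat q=\hat q(X)$ put $R_n(\theta,\hat q)=\mathbb E_X[L_n(\theta,\hat q(X))]$. For $\tau\in[0,\infty]$ let $\alpha_i(\tau)=\tau/(\tau+\sigma_{p,i})$ (with $\alpha_i(\infty)=1$), and let $\mathcal S^0=\{\hat q(\tau):\tau\in[0,\infty]\}$ where $$\hat q_i(\tau)=\alpha_i(\tau)X_i+\sqrt{\sigma_{f,i}+\alpha_i(\tau)\sigma_{p,i}}\;\Phi^{-1}(\tilde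 b_i).$$ **Assumptions.** (A1) $0<\inf_i\tilde b_i\le\sup_i\tilde b_i<1$ and $\sup_i(b_i+h_i)<\infty$. (A2) $\limsup_{n}\frac1n\sum_{i=1}^n|\theta_i|<\infty$. (A3) $\sup_i\sigma_{p,i}/\sigma_{f,i}<1/(4e)$, $\sup_i\sigma_{f,i}<\infty$ and $\inf_i\sigma_{p,i}>0$. **The risk estimate.** Let $G(w,\beta)=\phi(w)+w\Phi(w)-\beta w$, with $G'$ its derivative in $w$, let $H_k$ be the probabilists' Hermite polynomials, and fix constants $\gamma(i)<1/\sqrt{4e}-\sqrt{\sigma_{p,i}/\sigma_{f,i}}$ with $\inf_i\gamma(i)>0$. Put $\lambda_n(i)=\gamma(i)\sqrt{2\log n}$, $K_n(i)=1+\big\lceil e^2\big(\gamma(i)+\sqrt{2\sigma_{p,i}/\sigma_{f,i}}\big)^2(2\log n)\big\rceil$, $$c_i(\tau)=\sqrt{\frac{\sigma_{f,i}+\alpha_i(\tau)\sigma_{p,i}}{\sigma_{f,i}+\alpha_i(\tau)^2\sigma_{p,i}}}\;\Phi^{-1}(\tilde b_i),\qquad d_i(\tau)=-\frac{1-\alpha_i(\tau)}{\sqrt{\sigma_{f,i}+\sigma_{p,i}\alpha_i(\tau)^2}},\qquad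 v_i(\tau)=2\sigma_{p,i}d_i(\tau)^2 .$$ Let $$S_i(u)=G(0,\tilde b_i)+G'(0,\tilde b_i)\,u+\phi(0)\sum_{k=0}^{K_n(i)-2}\frac{(-1)^kH_k(0)}{(k+2)!}\,v_i(\tau)^{(k+2)/2}H_{k+2}\big(u/\sqrt{v_i(\tau)}\big)$$ (where $v^{k/2}H_k(u/\sqrt v)$ means its limit $u^k$ if $v=0$), and let $\tilde S_i=\max\{-n,\min\{n,S_i\}\}$. For $z\in\mathbb R$ put $U_i=c_i(\tau)+d_i(\tau)(X_i+\sqrt{\sigma_{p,i}}\,z)$ and $V_i=c_i(\tau)+d_i(\tau)(X_i-\sqrt{\sigma_{p,i}}\,z)$; let $\hat T_i(X_i,z,\tau)$ be $-\tilde b_iU_i$ if $V_i<-\lambda_n(i)$, $\tilde S_i(U_i)$ if $|V_i|\le\lambda_n(i)$, and $(1-\tilde b_i)U_i$ if $V_i>\lambda_n(i)$. Finally let $\hat T_i(X_i,\tau)=\mathbb E_{Z\sim N(0,1)}\hat T_i(X_i,Z,\tau)$ and $$\widehat{\mathrm{ARE}}_n(\tau)=\frac1n\sum_{i=1}^n(b_i+h_i)\sqrt{\sigma_{f,i}+\sigma_{p,i}\alpha_i(\tau)^2}\;\hat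 T_i(X_i,\tau).$$ **The tuning parameters.** Fix constants $C_1,C_2>0$ and $C_3,C_4\ge0$, let $a_n=\log\log n$ and $\delta_n=\{2C_1C_2(2\phi(0)+C_3+\sqrt{a_n}\,C_4+a_n)\}^{-1}$, and let $\Lambda_n$ be the finite set of those $\tau\in[0,\infty)$ for which $\tau/(\tau+1)\in\{0,\delta_n,2\delta_n,\dots,(m_n-1)\delta_n\}$, $m_n=\lceil1/\delta_n\rceil$ (for the finitely many $n$ where $\log$ or $\sqrt{\cdot}$ is applied outside its domain, that value is read as $0$). Let $\hat\tau_n^{\mathrm{ARE}}=\hat\tau_n^{\mathrm{ARE}}(X)$ be any measurable choice of a minimizer of $\widehat{\mathrm{ARE}}_n$ over $\Lambda_n$, and let $\tau_n^{\mathsf{OR}}=\tau_n^{\mathsf{OR}}(X,\theta)$ be any minimizer of $\tau\mapsto L_n(\theta,\hat q(\tau))$ over $[0,\infty]$. **Theorem (Oracle Optimality in Predictive Risk).** Under A1 and A3, for every $\theta$ satisfying A2, the two expectations below are finite for every $n$ and $$\lim_{n\to\infty}\Big(R_n\big(\theta,\hat q(\hat\tau_n^{\mathrm{ARE}})\big)-\mathbb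 E\big[L_n(\theta,\hat q(\tau_n^{\mathsf{OR}}))\big]\Big)=0 .$$ -/

import Mathlib

open MeasureTheory ProbabilityTheory Filter Topology
open scoped ENNReal

noncomputable section

namespace CheckLoss

/-- Known constants of the Gaussian predictive model: coordinate `i` has under- and
overestimation weights `b i`, `h i`, past variance `sigmaP i` and future variance `sigmaF i`. -/
structure Model where
  b : ℕ → ℝ
  h : ℕ → ℝ
  sigmaP : ℕ → ℝ
  sigmaF : ℕ → ℝ

/-! ### The standard normal distribution -/

/-- Standard normal density. -/
def stdPdf (w : ℝ) : ℝ := gaussianPDFReal 0 1 w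

/-- Standard normal distribution function. -/
def stdCdf (w : ℝ) : ℝ := cdf (gaussianReal 0 1) w

/-- Standard normal quantile function (used on `(0, 1)` only). -/
def stdQuantile (p : ℝ) : ℝ := sInf {w : ℝ | p ≤ stdCdf w}

/-- `G(w, β) = φ(w) + w Φ(w) - β w`. -/
def G (w β : ℝ) : ℝ := stdPdf w + w * stdCdf w - β * w

/-- `v^{k/2} H_k(x / √v)` with `H_k` the probabilists' Hermite polynomial, written as a polynomial
in `x` and `√v`, so that `v = 0` gives the limiting value `x^k`. -/
def scaledHermite (k : ℕ) (v x : ℝ) : ℝ :=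
  ∑ j ∈ Finset.range (k + 1), ((Polynomial.hermite k).coeff j : ℝ) * x ^ j * Real.sqrt v ^ (k - j)

theorem scaledHermite_of_pos (k : ℕ) {v : ℝ} (hv : 0 < v) (x : ℝ) :
    scaledHermite k v x
      = Real.sqrt v ^ k * Polynomial.aeval (x / Real.sqrt v) (Polynomial.hermite k) := by
  have hs : Real.sqrt v ≠ 0 := (Real.sqrt_pos.mpr hv).ne'
  rw [Polynomial.aeval_eq_sum_range, Polynomial.natDegree_hermite, Finset.mul_sum]
  refine Finset.sum_congr rfl fun j hj => ?_
  have hjk : j ≤ k := Nat.lt_succ_iff.mp (Finset.mem_range.mp hj)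
  have hk : Real.sqrt v ^ k = Real.sqrt v ^ (k - j) * Real.sqrt v ^ j := by
    rw [← pow_add, Nat.sub_add_cancel hjk]
  rw [hk, zsmul_eq_mul, div_pow]
  field_simp

namespace Model

variable (M : Model)

/-! ### Loss, risk and the class of origin-centric shrinkage predictors -/

/-- The critical ratio `b_i / (b_i + h_i)`. -/
def ratio (i : ℕ) : ℝ := M.b i / (M.b i + M.h i)

/-- Law of the past `X ~ N(θ, Σ_p)` in dimension `n`. -/
def pastLaw (θ : ℕ → ℝ) (n : ℕ) : Measure (Fin n → ℝ) :=
  Measure.pi fun i => gaussianReal (θ i) (M.sigmaP i).toNNReal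

/-- Predictive loss of coordinate `i`:
`E_{Y ~ N(t, σ_{f,i})} [b_i (Y - q)^+ + h_i (q - Y)^+]`. -/
def coordLoss (i : ℕ) (t q : ℝ) : ℝ :=
  ∫ y, (M.b i * max (y - q) 0 + M.h i * max (q - y) 0)
    ∂(gaussianReal t (M.sigmaF i).toNNReal)

/-- Cumulative predictive loss `L_n(θ, q)`. -/
def loss (n : ℕ) (θ : ℕ → ℝ) (q : Fin n → ℝ) : ℝ :=
  (1 / (n : ℝ)) * ∑ i : Fin n, M.coordLoss i (θ i) (q i)

/-- Predictive risk `R_n(θ, q̂)` of a predictor `q̂ = q̂(X)`. -/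
def risk (n : ℕ) (θ : ℕ → ℝ) (qhat : (Fin n → ℝ) → Fin n → ℝ) : ℝ :=
  ∫ x, M.loss n θ (qhat x) ∂(M.pastLaw θ n)

/-- Shrinkage factor `α_i(τ) = τ / (τ + σ_{p,i})`, with `α_i(∞) = 1`. -/
def alpha (i : ℕ) (τ : ℝ≥0∞) : ℝ :=
  if τ = ⊤ then 1 else τ.toReal / (τ.toReal + M.sigmaP i)

/-- The predictor `q̂(τ)` at the observation `x`. -/
def predictor (n : ℕ) (τ : ℝ≥0∞) (x : Fin n → ℝ) : Fin n → ℝ := fun i =>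
  M.alpha i τ * x i
    + Real.sqrt (M.sigmaF i + M.alpha i τ * M.sigmaP i) * stdQuantile (M.ratio i)

/-! ### The asymptotic risk estimator -/

/-- `c_i(τ)`. -/
def c (i : ℕ) (τ : ℝ≥0∞) : ℝ :=
  Real.sqrt ((M.sigmaF i + M.alpha i τ * M.sigmaP i)
      / (M.sigmaF i + M.alpha i τ ^ 2 * M.sigmaP i))
    * stdQuantile (M.ratio i)

/-- `d_i(τ)`. -/
def d (i : ℕ) (τ : ℝ≥0∞) : ℝ :=
  -((1 - M.alpha i τ) / Real.sqrt (M.sigmaF i + M.sigmaP i * M.alpha i τ ^ 2))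

/-- Threshold `λ_n(i) = γ(i) √(2 log n)`. -/
def threshold (γ : ℕ → ℝ) (n i : ℕ) : ℝ := γ i * Real.sqrt (2 * Real.log n)

/-- `K_n(i) = 1 + ⌈e² (γ(i) + √(2 σ_{p,i}/σ_{f,i}))² (2 log n)⌉`. -/
def order (γ : ℕ → ℝ) (n i : ℕ) : ℕ :=
  1 + ⌈Real.exp 1 ^ 2 * (γ i + Real.sqrt (2 * M.sigmaP i / M.sigmaF i)) ^ 2
        * (2 * Real.log n)⌉₊

/-- `S_i(u)`: the unbiased Hermite estimate of the Taylor polynomial of order `K_n(i)` of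
`G(·, b_i/(b_i+h_i))` at `0`. The index `k` runs over `0, …, K_n(i) - 2`. -/
def hermiteEstimate (γ : ℕ → ℝ) (n i : ℕ) (τ : ℝ≥0∞) (u : ℝ) : ℝ :=
  G 0 (M.ratio i) + deriv (fun w => G w (M.ratio i)) 0 * u
    + stdPdf 0 * ∑ k ∈ Finset.range (M.order γ n i - 1),
        ((-1) ^ k * (Polynomial.aeval (0 : ℝ) (Polynomial.hermite k)) / ((k + 2).factorial : ℝ))
          * scaledHermite (k + 2) (2 * M.sigmaP i * M.d i τ ^ 2) u

/-- `S_i(u)` truncated to `[-n, n]`. -/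
def truncatedEstimate (γ : ℕ → ℝ) (n i : ℕ) (τ : ℝ≥0∞) (u : ℝ) : ℝ :=
  max (-(n : ℝ)) (min (n : ℝ) (M.hermiteEstimate γ n i τ u))

/-- The randomized threshold estimate `T̂_i(x, z, τ)`, with
`U_i(τ) = c_i + d_i (x + √σ_{p,i} z)` and `V_i(τ) = c_i + d_i (x - √σ_{p,i} z)`. -/
def randomizedT (γ : ℕ → ℝ) (n i : ℕ) (τ : ℝ≥0∞) (x z : ℝ) : ℝ :=
  let U := M.c i τ + M.d i τ * (x + Real.sqrt (M.sigmaP i) * z)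
  let V := M.c i τ + M.d i τ * (x - Real.sqrt (M.sigmaP i) * z)
  if V < -threshold γ n i then -(M.ratio i * U)
  else if V ≤ threshold γ n i then M.truncatedEstimate γ n i τ U
  else (1 - M.ratio i) * U

/-- Its Rao-Blackwellization `T̂_i(x, τ) = E_{Z ~ N(0,1)} T̂_i(x, Z, τ)`. -/
def coordT (γ : ℕ → ℝ) (n i : ℕ) (τ : ℝ≥0∞) (x : ℝ) : ℝ :=
  ∫ z, M.randomizedT γ n i τ x z ∂(gaussianReal 0 1)

/-- The asymptotic risk estimate at `τ`, for the observation `x`. -/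
def ARE (γ : ℕ → ℝ) (n : ℕ) (x : Fin n → ℝ) (τ : ℝ≥0∞) : ℝ :=
  (1 / (n : ℝ)) * ∑ i : Fin n, (M.b i + M.h i)
    * Real.sqrt (M.sigmaF i + M.sigmaP i * M.alpha i τ ^ 2) * M.coordT γ n i τ (x i)

end Model

/-! ### The grid -/

/-- `δ_n = {2 C₁ C₂ (2 φ(0) + C₃ + √a_n C₄ + a_n)}⁻¹` with `a_n = log log n`. -/
def gridStep (C₁ C₂ C₃ C₄ : ℝ) (n : ℕ) : ℝ :=
  (2 * C₁ * C₂ * (2 * stdPdf 0 + C₃ + Real.sqrt (Real.log (Real.log n)) * C₄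
    + Real.log (Real.log n)))⁻¹

/-- `Λ_n`: the `τ` for which `τ / (τ + 1)` is one of `0, δ_n, 2 δ_n, …, (m - 1) δ_n`, where
`m = ⌈1/δ_n⌉`. -/
def grid (C₁ C₂ C₃ C₄ : ℝ) (n : ℕ) : Set ℝ≥0∞ :=
  {τ | ∃ j : ℕ, j < ⌈1 / gridStep C₁ C₂ C₃ C₄ n⌉₊ ∧
    τ = ENNReal.ofReal (j * gridStep C₁ C₂ C₃ C₄ n / (1 - j * gridStep C₁ C₂ C₃ C₄ n))}

/-! ### Assumptions -/

/-- Nondegenerate loss weights. -/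
structure Model.BoundedWeights (M : Model) : Prop where
  ratio_lower : ∃ ε > 0, ∀ i, ε ≤ M.b i / (M.b i + M.h i)
  ratio_upper : ∃ r < 1, ∀ i, M.b i / (M.b i + M.h i) ≤ r
  sum_upper : ∃ B, ∀ i, M.b i + M.h i ≤ B

/-- Bounded average magnitude of `θ`. -/
def BoundedParameter (θ : ℕ → ℝ) : Prop :=
  limsup (fun n : ℕ => (((1 / (n : ℝ)) * ∑ i ∈ Finset.range n, |θ i| : ℝ) : EReal)) atTop < ⊤

/-- Sufficient historical data, and nondegenerate variances. -/
structure Model.SufficientHistory (M : Model) : Prop where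
  var_ratio : ∃ r < 1 / (4 * Real.exp 1), ∀ i, M.sigmaP i / M.sigmaF i ≤ r
  future_upper : ∃ B, ∀ i, M.sigmaF i ≤ B
  past_lower : ∃ ε > 0, ∀ i, ε ≤ M.sigmaP i

end CheckLoss

end

noncomputable section

namespace CheckLoss

/-! The regret is nonnegative pointwise, because the oracle minimizes the loss. For the upper bound
let `τ'` be a grid point near the oracle in the scale `τ/(τ+1)`. Then `L(τA) - L(τO)` is at most
`|ARE(τA) - L(τA)| + |ARE(τ') - L(τ')| + (L(τ') - L(τO))`, since `ARE(τA) ≤ ARE(τ')`. The first two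
terms are bounded by the sum of `|ARE - L|` over the grid, which has only `O(log n)` points. The
last is at most a constant times the mesh times `1 + n⁻¹ ∑ |X_i|`, by Lipschitz dependence on
`τ/(τ+1)` (`exists_abs_loss_sub_le`), and A2 bounds the mean of that factor. `integral_regret_le`
carries this out.

It remains to bound `E |ARE(τ) - L(τ)|` at a fixed `τ`, uniformly in `τ`, by a negative power of `n`
up to logarithms (`integral_abs_ARE_sub_loss_le`). The expected loss of a coordinate is an explicit
weight times `G(w, β)`, with `w = c + d θ`, so the risk estimate has to estimate `G(w, β)` with
small bias and with variance `o(n)`. The auxiliary noise splits one observation into two independent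
Gaussians `U` and `V` of mean `w`: `V` chooses a regime and `U` estimates `G` in it.

For large `|w|` the function `G` is almost linear, with Gaussian error, and a linear function of `U`
estimates it. For moderate `w` it is close to its Taylor polynomial, and Hermite polynomials in `U`
estimate the powers of `w` without bias; their second moment grows like `exp(w²/(1-e²))`, where `e²`
is the variance of `U`. The upper bound on `γ` gives `(γ + √(2σ_p/σ_f))² ≤ 1/(2 exp 1)`. This keeps
the second moment below `n^(3/4)` up to logarithms in the central region, and makes the wrong regime
so unlikely outside it that even the truncation level `n` is harmless. The constants are settled in
`thresholdT_bounds`. -/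

/-! ### Standard normal law -/

/-- The standard normal law. -/
abbrev stdGauss : Measure ℝ := gaussianReal 0 1

lemma stdPdf_eq (w : ℝ) : stdPdf w = (Real.sqrt (2 * Real.pi))⁻¹ * Real.exp (-w ^ 2 / 2) := by
  simp [stdPdf, gaussianPDFReal_def]

lemma stdPdf_nonneg (w : ℝ) : 0 ≤ stdPdf w := gaussianPDFReal_nonneg _ _ _

lemma stdPdf_eq_mul_exp (w : ℝ) : stdPdf w = stdPdf 0 * Real.exp (-w ^ 2 / 2) := by
  simp [stdPdf_eq]

lemma stdPdf_zero_le_half : stdPdf 0 ≤ 1 / 2 := by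
  rw [stdPdf_eq]
  have h : (2 : ℝ) ≤ Real.sqrt (2 * Real.pi) := by
    apply Real.le_sqrt_of_sq_le
    nlinarith [Real.pi_gt_three]
  simp only [ne_eq, OfNat.ofNat_ne_zero, not_false_eq_true, zero_pow, neg_zero, zero_div,
    Real.exp_zero, mul_one]
  rw [one_div]
  exact inv_anti₀ (by norm_num) h

lemma stdPdf_zero_gt : 0.39 < stdPdf 0 := by
  rw [stdPdf_eq]
  have h : Real.sqrt (2 * Real.pi) < 2.51 := by
    rw [Real.sqrt_lt' (by norm_num)]
    nlinarith [Real.pi_lt_d2]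
  have h0 : 0 < Real.sqrt (2 * Real.pi) := Real.sqrt_pos.mpr (by positivity)
  simp only [ne_eq, OfNat.ofNat_ne_zero, not_false_eq_true, zero_pow, neg_zero, zero_div,
    Real.exp_zero, mul_one]
  rw [lt_inv_comm₀ (by norm_num) h0]
  refine h.trans (by norm_num)

lemma stdPdf_le_exp (w : ℝ) : stdPdf w ≤ Real.exp (-w ^ 2 / 2) := by
  rw [stdPdf_eq_mul_exp]
  have := stdPdf_zero_le_half
  have h2 := Real.exp_pos (-w ^ 2 / 2)
  nlinarith [stdPdf_nonneg 0]

lemma hasDerivAt_stdPdf (w : ℝ) : HasDerivAt stdPdf (-w * stdPdf w) w := by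
  have h : HasDerivAt (fun w : ℝ => stdPdf 0 * Real.exp (-w ^ 2 / 2))
      (stdPdf 0 * (Real.exp (-w ^ 2 / 2) * (-(2 * w) / 2))) w := by
    have h1 : HasDerivAt (fun w : ℝ => -w ^ 2 / 2) (-(2 * w) / 2) w := by
      simpa using ((hasDerivAt_pow 2 w).neg.div_const 2)
    exact (h1.exp).const_mul _
  have e : stdPdf = fun w : ℝ => stdPdf 0 * Real.exp (-w ^ 2 / 2) := funext stdPdf_eq_mul_exp
  have e2 : -w * stdPdf w = stdPdf 0 * (Real.exp (-w ^ 2 / 2) * (-(2 * w) / 2)) := by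
    rw [stdPdf_eq_mul_exp]; ring
  rw [e2, e]
  simpa using h

lemma continuous_stdPdf : Continuous stdPdf :=
  continuous_iff_continuousAt.mpr fun w => (hasDerivAt_stdPdf w).continuousAt

lemma integral_stdGauss (f : ℝ → ℝ) : ∫ x, f x ∂stdGauss = ∫ x, stdPdf x * f x := by
  rw [integral_gaussianReal_eq_integral_smul (by norm_num)]
  rfl

lemma integrable_stdGauss_iff (f : ℝ → ℝ) :
    Integrable f stdGauss ↔ Integrable (fun x => stdPdf x * f x) := by
  rw [stdGauss, gaussianReal_of_var_ne_zero _ (by norm_num),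
    integrable_withDensity_iff_integrable_smul' (measurable_gaussianPDF _ _)
      (ae_of_all _ fun _ => gaussianPDF_lt_top)]
  simp [toReal_gaussianPDF, stdPdf]

lemma integrable_pow_stdGauss (k : ℕ) : Integrable (fun x : ℝ => x ^ k) stdGauss := by
  have h := memLp_id_gaussianReal' (μ := 0) (v := 1) (k : ℝ≥0∞) (by simp)
  have := h.integrable_norm_pow' 
  refine (this.mono' (by fun_prop) (ae_of_all _ fun x => ?_))
  simp

lemma integrable_eval_stdGauss (p : Polynomial ℝ) : Integrable (fun x => p.eval x) stdGauss := by
  simp_rw [Polynomial.eval_eq_sum_range]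
  exact integrable_finsetSum _ fun i _ => (integrable_pow_stdGauss i).const_mul _

/-- Gaussian integration by parts for polynomials. -/
lemma integral_mul_eval_stdGauss (p : Polynomial ℝ) :
    ∫ x, x * p.eval x ∂stdGauss = ∫ x, p.derivative.eval x ∂stdGauss := by
  rw [integral_stdGauss, integral_stdGauss]
  have h := integral_mul_deriv_eq_deriv_mul_of_integrable (u := stdPdf) (v := fun x => p.eval x)
    (u' := fun w => -w * stdPdf w) (v' := fun x => p.derivative.eval x)
    (fun x _ => hasDerivAt_stdPdf x) (fun x _ => p.hasDerivAt x)
    ((integrable_stdGauss_iff _).1 (integrable_eval_stdGauss _))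
    ((((integrable_stdGauss_iff _).1 (integrable_eval_stdGauss (-Polynomial.X * p)))).congr
      (ae_of_all _ fun x => by simp; ring))
    ((integrable_stdGauss_iff _).1 (integrable_eval_stdGauss _))
  rw [h, ← integral_neg]
  congr 1; ext x; ring

/-! ### Gaussian tail bounds. -/

lemma hasSubgaussianMGF_id_stdGauss : HasSubgaussianMGF id 1 stdGauss where
  integrable_exp_mul t := integrable_exp_mul_gaussianReal t
  mgf_le t := by rw [mgf_id_gaussianReal]; simp

lemma stdGauss_ge_le {x : ℝ} (hx : 0 ≤ x) :
    stdGauss.real {z | x ≤ z} ≤ Real.exp (-x ^ 2 / 2) := by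
  have := hasSubgaussianMGF_id_stdGauss.measure_ge_le hx
  simpa using this

lemma stdGauss_le_neg_le {x : ℝ} (hx : 0 ≤ x) :
    stdGauss.real {z | z ≤ -x} ≤ Real.exp (-x ^ 2 / 2) := by
  have := hasSubgaussianMGF_id_stdGauss.neg.measure_ge_le hx
  simpa [le_neg] using this

/-- Tail of `w + e N` below a level at distance `x`. -/
lemma stdGauss_lower_tail {w e t x β : ℝ} (hβ : 0 < β) (he : |e| ≤ β) (hx : 0 ≤ x)
    (hxt : x ≤ w - t) :
    stdGauss.real {z | w + e * z ≤ t} ≤ Real.exp (-x ^ 2 / (2 * β ^ 2)) := by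
  have hs : ∀ z : ℝ, w + e * z ≤ t → x ≤ β * |z| := fun z hz => by
    have : x ≤ -(e * z) := by linarith
    calc x ≤ |e * z| := this.trans (neg_le_abs _)
      _ = |e| * |z| := abs_mul _ _
      _ ≤ β * |z| := by gcongr
  have e1 : -x ^ 2 / (2 * β ^ 2) = -(x / β) ^ 2 / 2 := by field_simp
  rw [e1]
  -- At `x = 0` the bound is `1`. For `x > 0` the event forces `e * z < 0`, so the sign of `e`
  -- decides which tail of `z` is meant.
  rcases hx.eq_or_lt with rfl | hx0
  · simp
  rcases le_or_gt 0 e with he0 | he0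
  · refine le_trans (measureReal_mono ?_) (stdGauss_le_neg_le (x := x / β) (by positivity))
    intro z hz
    simp only [Set.mem_ofPred_eq] at hz ⊢
    have h1 := hs z hz
    have hz0 : z < 0 := by
      by_contra hcon
      have : 0 ≤ e * z := mul_nonneg he0 (not_lt.mp hcon)
      linarith
    rw [abs_of_neg hz0] at h1
    rw [le_neg, div_le_iff₀ hβ]; linarith
  · refine le_trans (measureReal_mono ?_) (stdGauss_ge_le (x := x / β) (by positivity))
    intro z hz
    simp only [Set.mem_ofPred_eq] at hz ⊢
    have h1 := hs z hz
    have hz0 : 0 < z := by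
      by_contra hcon
      have : 0 ≤ e * z := mul_nonneg_of_nonpos_of_nonpos he0.le (not_lt.mp hcon)
      linarith
    rw [abs_of_pos hz0] at h1
    rw [div_le_iff₀ hβ]; linarith

lemma stdGauss_upper_tail {w e t x β : ℝ} (hβ : 0 < β) (he : |e| ≤ β) (hx : 0 ≤ x)
    (hxt : x ≤ t - w) :
    stdGauss.real {z | t ≤ w + e * z} ≤ Real.exp (-x ^ 2 / (2 * β ^ 2)) := by
  have := stdGauss_lower_tail (w := -w) (e := -e) (t := -t) hβ (by simpa using he) hx (by linarith)
  refine le_trans (measureReal_mono ?_) this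
  intro z hz
  simp only [Set.mem_ofPred_eq] at hz ⊢
  linarith

/-! ### Hermite polynomials in a Gaussian variable -/

-- The Appell property. It turns the defining recursion with a derivative into the three-term
-- recurrence, which also makes sense for the rescaled polynomials at variance `0`.
open Polynomial in
lemma derivative_hermite_succ (n : ℕ) :
    derivative (hermite (n + 1)) = ((n + 1 : ℕ) : ℤ[X]) * hermite n := by
  induction n with
  | zero => simp
  | succ n ih =>
    rw [hermite_succ (n + 1), derivative_sub, derivative_mul, derivative_X, ih, derivative_mul,
      hermite_succ n, derivative_natCast]
    push_cast
    ring

open Polynomial in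
lemma hermite_add_two (n : ℕ) :
    hermite (n + 2) = X * hermite (n + 1) - ((n + 1 : ℕ) : ℤ[X]) * hermite n := by
  rw [hermite_succ (n + 1), derivative_hermite_succ]

lemma scaledHermite_var_zero (k : ℕ) (x : ℝ) : scaledHermite k 0 x = x ^ k := by
  rw [scaledHermite, Finset.sum_eq_single k]
  · simp
  · intro j hj hjk
    have : k - j ≠ 0 := by
      have := Finset.mem_range.mp hj
      omega
    simp [this]
  · simp

lemma scaledHermite_zero (v x : ℝ) : scaledHermite 0 v x = 1 := by simp [scaledHermite]

lemma scaledHermite_one (v x : ℝ) : scaledHermite 1 v x = x := by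
  simp [scaledHermite, Finset.sum_range_succ]

lemma scaledHermite_add_two (k : ℕ) {v : ℝ} (hv : 0 ≤ v) (x : ℝ) :
    scaledHermite (k + 2) v x
      = x * scaledHermite (k + 1) v x - (k + 1) * v * scaledHermite k v x := by
  rcases hv.eq_or_lt with rfl | hv
  · simp only [scaledHermite_var_zero]; ring
  · rw [scaledHermite_of_pos _ hv, scaledHermite_of_pos _ hv, scaledHermite_of_pos _ hv,
      hermite_add_two]
    have hs : Real.sqrt v ≠ 0 := (Real.sqrt_pos.mpr hv).ne'
    have hs2 : v = Real.sqrt v ^ 2 := (Real.sq_sqrt hv.le).symm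
    generalize Real.sqrt v = s at *
    subst hs2
    simp only [map_sub, map_mul, Polynomial.aeval_X, map_natCast]
    push_cast
    field_simp
    ring

open Polynomial in
/-- `scaledHermite k (e ^ 2) (w + e X)` as a polynomial in `X`. -/
def shiftedHermite (w e : ℝ) : ℕ → ℝ[X]
  | 0 => 1
  | 1 => C w + C e * X
  | k + 2 => (C w + C e * X) * shiftedHermite w e (k + 1)
      - C (e ^ 2 * (k + 1)) * shiftedHermite w e k

lemma eval_shiftedHermite (w e : ℝ) (k : ℕ) (x : ℝ) :
    (shiftedHermite w e k).eval x = scaledHermite k (e ^ 2) (w + e * x) := by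
  induction k using Nat.twoStepInduction with
  | zero => simp [shiftedHermite, scaledHermite_zero]
  | one => simp [shiftedHermite, scaledHermite_one]
  | more k h0 h1 =>
    rw [scaledHermite_add_two _ (sq_nonneg e), ← h0, ← h1, shiftedHermite]
    simp only [Polynomial.eval_sub, Polynomial.eval_mul, Polynomial.eval_add, Polynomial.eval_C,
      Polynomial.eval_X]
    ring

open Polynomial in
lemma derivative_shiftedHermite_succ (w e : ℝ) (k : ℕ) :
    derivative (shiftedHermite w e (k + 1)) = C ((k + 1) * e) * shiftedHermite w e k := by
  induction k using Nat.twoStepInduction with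
  | zero => simp [shiftedHermite]
  | one =>
    simp only [shiftedHermite, derivative_sub, derivative_mul, derivative_add, derivative_C,
      derivative_X, derivative_one]
    simp only [map_mul, map_add, map_pow, map_one, Nat.cast_one, Nat.cast_zero, map_zero]
    ring
  | more k h0 h1 =>
    rw [shiftedHermite, derivative_sub, derivative_mul, h1, derivative_mul, h0, derivative_add,
      derivative_mul, derivative_C, derivative_C, derivative_C, derivative_X,
      show shiftedHermite w e (k + 2) = (C w + C e * X) * shiftedHermite w e (k + 1)
      - C (e ^ 2 * (k + 1)) * shiftedHermite w e k from rfl]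
    push_cast
    simp only [map_mul, map_add, map_pow, map_one, map_ofNat, map_natCast]
    ring

/-- Integration of a polynomial against the standard normal law. -/
def gaussInt : Polynomial ℝ →ₗ[ℝ] ℝ where
  toFun p := ∫ x, p.eval x ∂stdGauss
  map_add' p q := by
    simp only [Polynomial.eval_add]
    exact integral_add (integrable_eval_stdGauss p) (integrable_eval_stdGauss q)
  map_smul' c p := by
    simp only [Polynomial.eval_smul, smul_eq_mul, RingHom.id_apply]
    exact integral_const_mul _ _

open Polynomial in
lemma gaussInt_X_mul (p : ℝ[X]) : gaussInt (X * p) = gaussInt (derivative p) := by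
  simpa [gaussInt] using integral_mul_eval_stdGauss p

lemma gaussInt_one : gaussInt 1 = 1 := by simp [gaussInt]

-- Three-term recurrence plus Gaussian integration by parts: the derivative falling on the Hermite
-- factor cancels the `e² (k + 1)` term of the recurrence. Under the integral, raising the degree by
-- one therefore acts on `f` as the operator `w + e D`.
open Polynomial in
lemma gaussInt_shiftedHermite_succ_mul (w e : ℝ) (k : ℕ) (f : ℝ[X]) :
    gaussInt (shiftedHermite w e (k + 1) * f)
      = w * gaussInt (shiftedHermite w e k * f)
        + e * gaussInt (shiftedHermite w e k * derivative f) := by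
  rcases k with _ | k
  · have : shiftedHermite w e (0 + 1) * f = w • f + e • (X * f) := by
      simp only [shiftedHermite, smul_eq_C_mul]; ring
    rw [this, map_add, map_smul, map_smul, gaussInt_X_mul]
    simp [shiftedHermite]
  · have : shiftedHermite w e (k + 1 + 1) * f = w • (shiftedHermite w e (k + 1) * f)
        + e • (X * (shiftedHermite w e (k + 1) * f))
        - (e ^ 2 * (k + 1)) • (shiftedHermite w e k * f) := by
      simp only [shiftedHermite, smul_eq_C_mul]; ring
    rw [this, map_sub, map_add, map_smul, map_smul, map_smul, gaussInt_X_mul, derivative_mul,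
      derivative_shiftedHermite_succ, map_add, mul_assoc, ← smul_eq_C_mul, map_smul]
    simp only [smul_eq_mul]
    ring

-- The Hermite factor of degree `k` acts as `(w + e D)^k`; the two summands commute, so the binomial
-- theorem applies.
open Polynomial in
lemma gaussInt_shiftedHermite_mul (w e : ℝ) (k : ℕ) (f : ℝ[X]) :
    gaussInt (shiftedHermite w e k * f)
      = ∑ j ∈ Finset.range (k + 1),
          (k.choose j : ℝ) * (e ^ j * w ^ (k - j)) * gaussInt (derivative^[j] f) := by
  have key : ∀ f : ℝ[X], gaussInt (shiftedHermite w e k * f)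
      = gaussInt (((e • (derivative : Module.End ℝ ℝ[X]) + w • (1 : Module.End ℝ ℝ[X])) ^ k) f) := by
    induction k with
    | zero => intro f; simp [shiftedHermite]
    | succ k ih =>
      intro f
      rw [gaussInt_shiftedHermite_succ_mul, ih, ih, pow_succ, Module.End.mul_apply]
      simp only [LinearMap.add_apply, LinearMap.smul_apply, Module.End.one_apply, map_add,
        map_smul, smul_eq_mul]
      ring
  rw [key, Commute.add_pow (by
    refine Commute.smul_right (Commute.smul_left (Commute.one_right _) _) _), LinearMap.sum_apply,
    map_sum]
  refine Finset.sum_congr rfl fun j _ => ?_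
  rw [_root_.smul_pow, _root_.smul_pow, one_pow]
  simp only [Module.End.mul_apply, Module.End.natCast_apply, LinearMap.smul_apply,
    Module.End.one_apply, map_smul, smul_eq_mul, Module.End.pow_apply]
  rw [Polynomial.iterate_derivative_smul, map_nsmul, nsmul_eq_mul]
  ring

open Polynomial in
lemma iterate_derivative_shiftedHermite (w e : ℝ) (j m : ℕ) :
    derivative^[j] (shiftedHermite w e (m + j))
      = C (((m + j).descFactorial j : ℝ) * e ^ j) * shiftedHermite w e m := by
  induction j generalizing m with
  | zero => simp
  | succ j ih =>
    rw [Function.iterate_succ_apply, ← add_assoc, derivative_shiftedHermite_succ,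
      iterate_derivative_C_mul, ih, ← mul_assoc, ← map_mul, Nat.succ_descFactorial_succ]
    congr 2
    push_cast
    ring

-- Unbiasedness: with `f = 1` only the term without derivatives survives.
open Polynomial in
lemma gaussInt_shiftedHermite (w e : ℝ) (k : ℕ) : gaussInt (shiftedHermite w e k) = w ^ k := by
  have := gaussInt_shiftedHermite_mul w e k 1
  rw [mul_one, Finset.sum_eq_single 0] at this
  · simpa [gaussInt_one] using this
  · intro j _ hj
    obtain ⟨m, rfl⟩ := Nat.exists_eq_succ_of_ne_zero hj
    simp [Function.iterate_succ_apply]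
  · simp

-- The same expansion with `f` the Hermite factor itself: its `j`-th derivative is a multiple of the
-- factor of degree `k - j`, whose mean is `w^(k-j)`.
open Polynomial in
lemma gaussInt_shiftedHermite_sq (w e : ℝ) (k : ℕ) :
    gaussInt (shiftedHermite w e k ^ 2)
      = k.factorial * ∑ j ∈ Finset.range (k + 1), (k.choose j : ℝ) * (e ^ 2) ^ j
          * ((w ^ 2) ^ (k - j) / ((k - j).factorial : ℝ)) := by
  rw [sq, gaussInt_shiftedHermite_mul, Finset.mul_sum]
  refine Finset.sum_congr rfl fun j hj => ?_
  obtain ⟨m, rfl⟩ := Nat.exists_eq_add_of_le' (Nat.lt_succ_iff.mp (Finset.mem_range.mp hj))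
  rw [iterate_derivative_shiftedHermite, ← smul_eq_C_mul, map_smul, gaussInt_shiftedHermite,
    Nat.add_sub_cancel, ← Nat.factorial_mul_descFactorial (Nat.le_add_left j m),
    Nat.add_sub_cancel]
  have : (m.factorial : ℝ) ≠ 0 := by positivity
  simp only [smul_eq_mul]
  push_cast
  field_simp
  ring

/-- Each `t^j / j!` is at most `exp t` at `t = w²/(1-e²)`. The powers of `1 - e²` so released
complete the binomial sum to `(e² + (1 - e²))^k = 1`. -/
lemma gaussInt_shiftedHermite_sq_le (w e : ℝ) (he : e ^ 2 < 1) (k : ℕ) :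
    gaussInt (shiftedHermite w e k ^ 2) ≤ k.factorial * Real.exp (w ^ 2 / (1 - e ^ 2)) := by
  rw [gaussInt_shiftedHermite_sq]
  have h1 : 0 < 1 - e ^ 2 := by linarith
  gcongr
  calc ∑ j ∈ Finset.range (k + 1), (k.choose j : ℝ) * (e ^ 2) ^ j
          * ((w ^ 2) ^ (k - j) / ((k - j).factorial : ℝ))
      ≤ ∑ j ∈ Finset.range (k + 1), (k.choose j : ℝ) * (e ^ 2) ^ j
          * ((1 - e ^ 2) ^ (k - j) * Real.exp (w ^ 2 / (1 - e ^ 2))) := by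
        gcongr with j hj
        have := Real.pow_div_factorial_le_exp (w ^ 2 / (1 - e ^ 2)) (by positivity) (k - j)
        rw [div_pow, div_div, mul_comm ((1 - e ^ 2) ^ (k - j)), ← div_div,
          div_le_iff₀ (by positivity)] at this
        linarith
    _ = (e ^ 2 + (1 - e ^ 2)) ^ k * Real.exp (w ^ 2 / (1 - e ^ 2)) := by
        rw [add_pow, Finset.sum_mul]
        refine Finset.sum_congr rfl fun j _ => by ring
    _ = Real.exp (w ^ 2 / (1 - e ^ 2)) := by simp

/-- A combination `∑ a_k h_k` with `a_k² k! ≤ 1` has second moment at most `m² exp(w²/(1-e²))`. -/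
lemma integral_sum_scaledHermite_sq_le (w e : ℝ) (he : e ^ 2 < 1) (m : ℕ) (a : ℕ → ℝ)
    (ha : ∀ k, a k ^ 2 * k.factorial ≤ 1) :
    Integrable (fun x => (∑ k ∈ Finset.range m, a k * scaledHermite k (e ^ 2) (w + e * x)) ^ 2)
      stdGauss ∧
    ∫ x, (∑ k ∈ Finset.range m, a k * scaledHermite k (e ^ 2) (w + e * x)) ^ 2 ∂stdGauss
      ≤ m ^ 2 * Real.exp (w ^ 2 / (1 - e ^ 2)) := by
  set p : Polynomial ℝ := ∑ k ∈ Finset.range m, Polynomial.C (a k) * shiftedHermite w e k with hp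
  have hpe : ∀ x, (∑ k ∈ Finset.range m, a k * scaledHermite k (e ^ 2) (w + e * x)) ^ 2
      = (p ^ 2).eval x := by
    intro x
    simp [hp, Polynomial.eval_finsetSum, eval_shiftedHermite]
  simp_rw [hpe]
  refine ⟨integrable_eval_stdGauss _, ?_⟩
  -- Cauchy–Schwarz over the `m` terms. It costs a factor `m`, which is only logarithmic in `n`, and
  -- avoids mixed moments, which need not vanish when `w ≠ 0`.
  have hle : ∀ x, (p ^ 2).eval x
      ≤ (∑ k ∈ Finset.range m,
          ((m : ℝ) * a k ^ 2) • shiftedHermite w e k ^ 2 : Polynomial ℝ).eval x := by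
    intro x
    have := sq_sum_le_card_mul_sum_sq (s := Finset.range m)
      (f := fun k => a k * (shiftedHermite w e k).eval x)
    rw [Finset.card_range, Finset.mul_sum] at this
    simp only [hp, Polynomial.eval_pow, Polynomial.eval_finsetSum, Polynomial.eval_mul,
      Polynomial.eval_C, Polynomial.eval_smul, smul_eq_mul]
    refine this.trans (le_of_eq (Finset.sum_congr rfl fun k _ => by ring))
  calc ∫ x, (p ^ 2).eval x ∂stdGauss
      ≤ gaussInt (∑ k ∈ Finset.range m, ((m : ℝ) * a k ^ 2) • shiftedHermite w e k ^ 2) :=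
        integral_mono (integrable_eval_stdGauss _) (integrable_eval_stdGauss _) hle
    _ = ∑ k ∈ Finset.range m, ((m : ℝ) * a k ^ 2) * gaussInt (shiftedHermite w e k ^ 2) := by
        simp [map_sum]
    _ ≤ ∑ k ∈ Finset.range m, (m : ℝ) * Real.exp (w ^ 2 / (1 - e ^ 2)) := by
        refine Finset.sum_le_sum fun k _ => ?_
        have h1 := gaussInt_shiftedHermite_sq_le w e he k
        have h2 := Real.exp_pos (w ^ 2 / (1 - e ^ 2))
        rw [mul_assoc]
        gcongr
        calc a k ^ 2 * gaussInt (shiftedHermite w e k ^ 2)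
            ≤ a k ^ 2 * (k.factorial * Real.exp (w ^ 2 / (1 - e ^ 2))) := by gcongr
          _ = (a k ^ 2 * k.factorial) * Real.exp (w ^ 2 / (1 - e ^ 2)) := by ring
          _ ≤ 1 * Real.exp (w ^ 2 / (1 - e ^ 2)) := by gcongr; exact ha k
          _ = _ := one_mul _
    _ = m ^ 2 * Real.exp (w ^ 2 / (1 - e ^ 2)) := by simp; ring

lemma integral_sum_scaledHermite (w e : ℝ) (m : ℕ) (a : ℕ → ℝ) :
    ∫ x, ∑ k ∈ Finset.range m, a k * scaledHermite k (e ^ 2) (w + e * x) ∂stdGauss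
      = ∑ k ∈ Finset.range m, a k * w ^ k := by
  have : ∀ x, ∑ k ∈ Finset.range m, a k * scaledHermite k (e ^ 2) (w + e * x)
      = (∑ k ∈ Finset.range m, a k • shiftedHermite w e k : Polynomial ℝ).eval x := by
    intro x
    simp [Polynomial.eval_finsetSum, eval_shiftedHermite]
  simp_rw [this]
  change gaussInt _ = _
  simp [map_sum, gaussInt_shiftedHermite]

/-! ### The distribution function and the function `G` -/

lemma stdCdf_nonneg (w : ℝ) : 0 ≤ stdCdf w := cdf_nonneg _ _

lemma stdCdf_le_one (w : ℝ) : stdCdf w ≤ 1 := cdf_le_one _ _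

lemma integrable_stdPdf : Integrable stdPdf := integrable_gaussianPDFReal 0 1

lemma stdCdf_eq_integral (w : ℝ) : stdCdf w = ∫ x in Set.Iic w, stdPdf x := by
  rw [stdCdf, cdf_eq_real, Measure.real, gaussianReal_apply_eq_integral _ (by norm_num),
    ENNReal.toReal_ofReal]
  · rfl
  · exact setIntegral_nonneg measurableSet_Iic fun x _ => stdPdf_nonneg x

lemma hasDerivAt_stdCdf (w : ℝ) : HasDerivAt stdCdf (stdPdf w) w := by
  have h : stdCdf = fun x => stdCdf 0 + ∫ y in (0 : ℝ)..x, stdPdf y := by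
    ext x
    rw [← intervalIntegral.integral_Iic_sub_Iic integrable_stdPdf.integrableOn
      integrable_stdPdf.integrableOn, ← stdCdf_eq_integral, ← stdCdf_eq_integral]
    ring
  rw [h]
  exact (intervalIntegral.integral_hasDerivAt_right
    (continuous_stdPdf.intervalIntegrable _ _)
    (continuous_stdPdf.stronglyMeasurableAtFilter _ _) continuous_stdPdf.continuousAt).const_add _

lemma tendsto_stdPdf_atBot : Tendsto stdPdf atBot (𝓝 0) := by
  have h : Tendsto (fun w : ℝ => Real.exp (-w ^ 2 / 2)) atBot (𝓝 0) := by
    refine Real.tendsto_exp_atBot.comp ?_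
    have : Tendsto (fun w : ℝ => w ^ 2) atBot atTop :=
      ((tendsto_pow_atTop two_ne_zero).comp tendsto_abs_atBot_atTop).congr fun w => by simp
    have h2 := (this.atTop_div_const (show (0 : ℝ) < 2 by norm_num))
    exact (tendsto_neg_atTop_atBot.comp h2).congr fun w => by simp [neg_div]
  exact squeeze_zero stdPdf_nonneg stdPdf_le_exp h

lemma tendsto_stdCdf_atBot : Tendsto stdCdf atBot (𝓝 0) := tendsto_cdf_atBot _

lemma tendsto_stdCdf_atTop : Tendsto stdCdf atTop (𝓝 1) := tendsto_cdf_atTop _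

/-- `φ(w) + w Φ(w)`, the mean of the positive part of `w - Z`. -/
def meanPosPart (w : ℝ) : ℝ := stdPdf w + w * stdCdf w

lemma G_eq (w β : ℝ) : G w β = meanPosPart w - β * w := rfl

lemma integrable_id_stdGauss : Integrable (fun z : ℝ => z) stdGauss := by
  simpa using integrable_pow_stdGauss 1

lemma integrable_const_sub_stdGauss (w : ℝ) : Integrable (fun z : ℝ => w - z) stdGauss :=
  (integrable_const w).sub integrable_id_stdGauss

lemma integrable_posPart_stdGauss (w : ℝ) : Integrable (fun z => max (w - z) 0) stdGauss :=
  (integrable_const_sub_stdGauss w).pos_part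

lemma integral_posPart_stdGauss (w : ℝ) : ∫ z, max (w - z) 0 ∂stdGauss = meanPosPart w := by
  rw [integral_stdGauss]
  have h1 : ∀ z, stdPdf z * max (w - z) 0
      = (Set.Iic w).indicator (fun z => stdPdf z * (w - z)) z := by
    intro z
    by_cases hz : z ≤ w
    · rw [Set.indicator_of_mem (Set.mem_Iic.mpr hz), max_eq_left (by linarith)]
    · rw [Set.indicator_of_notMem (by simpa using hz), max_eq_right (by linarith), mul_zero]
  simp_rw [h1]
  rw [integral_indicator measurableSet_Iic]
  -- Since `φ' = -z φ`, an antiderivative of `φ(z) (w - z)` is explicit and vanishes at `-∞`.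
  have hd : ∀ x, HasDerivAt (fun z => w * stdCdf z + stdPdf z) (stdPdf x * (w - x)) x := by
    intro x
    have := ((hasDerivAt_stdCdf x).const_mul w).add (hasDerivAt_stdPdf x)
    exact this.congr_deriv (by ring)
  have := integral_Iic_of_hasDerivAt_of_tendsto' (a := w) (fun x _ => hd x)
    (((integrable_stdGauss_iff _).1
      (integrable_const_sub_stdGauss w)).integrableOn)
    (by simpa using (tendsto_stdCdf_atBot.const_mul w).add tendsto_stdPdf_atBot)
  rw [this, meanPosPart]
  ring

lemma integral_negPart_stdGauss (w : ℝ) :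
    ∫ z, max (z - w) 0 ∂stdGauss = meanPosPart w - w := by
  have h : ∀ z : ℝ, max (z - w) 0 = max (w - z) 0 - (w - z) := by
    intro z
    rcases le_total z w with h | h
    · rw [max_eq_right (by linarith), max_eq_left (by linarith)]; ring
    · rw [max_eq_left (by linarith), max_eq_right (by linarith)]; ring
  simp_rw [h]
  rw [integral_sub (integrable_posPart_stdGauss w)
    (integrable_const_sub_stdGauss w), integral_posPart_stdGauss,
    integral_sub (integrable_const w) integrable_id_stdGauss, integral_id_gaussianReal]
  simp

lemma meanPosPart_nonneg (w : ℝ) : 0 ≤ meanPosPart w := by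
  rw [← integral_posPart_stdGauss]
  exact integral_nonneg fun z => le_max_right _ _

lemma le_meanPosPart (w : ℝ) : w ≤ meanPosPart w := by
  have h : 0 ≤ ∫ z, max (z - w) 0 ∂stdGauss := integral_nonneg fun z => le_max_right _ _
  rw [integral_negPart_stdGauss] at h
  linarith

lemma meanPosPart_le_stdPdf {w : ℝ} (hw : w ≤ 0) : meanPosPart w ≤ stdPdf w := by
  have := mul_nonpos_of_nonpos_of_nonneg hw (stdCdf_nonneg w)
  rw [meanPosPart]; linarith

lemma meanPosPart_sub_le_stdPdf {w : ℝ} (hw : 0 ≤ w) : meanPosPart w - w ≤ stdPdf w := by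
  have := mul_le_mul_of_nonneg_left (stdCdf_le_one w) hw
  rw [meanPosPart]; linarith

lemma stdPdf_le_one (w : ℝ) : stdPdf w ≤ 1 := by
  refine (stdPdf_le_exp w).trans (Real.exp_le_one_iff.mpr ?_)
  have := sq_nonneg w
  linarith

lemma meanPosPart_le (w : ℝ) : meanPosPart w ≤ |w| + 1 := by
  have h1 := stdPdf_le_one w
  have h2 : w * stdCdf w ≤ |w| := by
    calc w * stdCdf w ≤ |w| * stdCdf w :=
          mul_le_mul_of_nonneg_right (le_abs_self w) (stdCdf_nonneg w)
      _ ≤ |w| * 1 := mul_le_mul_of_nonneg_left (stdCdf_le_one w) (abs_nonneg w)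
      _ = |w| := mul_one _
  rw [meanPosPart]; linarith

lemma meanPosPart_sub_le (w : ℝ) : meanPosPart w - w ≤ |w| + 1 := by
  rcases le_total 0 w with h | h
  · have := meanPosPart_sub_le_stdPdf h
    have := stdPdf_le_one w
    have := abs_nonneg w
    linarith
  · have := meanPosPart_le_stdPdf h
    have := stdPdf_le_one w
    rw [abs_of_nonpos h]
    linarith

lemma abs_G_le {β : ℝ} (h0 : 0 ≤ β) (h1 : β ≤ 1) (w : ℝ) : |G w β| ≤ |w| + 1 := by
  have e : G w β = (1 - β) * meanPosPart w + β * (meanPosPart w - w) := by rw [G_eq]; ring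
  have h2 := meanPosPart_le w
  have h3 := meanPosPart_sub_le w
  have h4 := meanPosPart_nonneg w
  have h5 := le_meanPosPart w
  have h6 : 0 ≤ (1 - β) * meanPosPart w := mul_nonneg (by linarith) h4
  have h7 : 0 ≤ β * (meanPosPart w - w) := mul_nonneg h0 (by linarith)
  rw [e, abs_of_nonneg (add_nonneg h6 h7)]
  nlinarith

lemma hasDerivAt_G (w β : ℝ) : HasDerivAt (fun w => G w β) (stdCdf w - β) w := by
  have h := ((hasDerivAt_stdPdf w).add ((hasDerivAt_id w).mul (hasDerivAt_stdCdf w))).sub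
    ((hasDerivAt_id w).const_mul β)
  exact h.congr_deriv (by simp only [id_eq]; ring)

/-! ### Hermite numbers and the Taylor polynomial of `G` -/

/-- `|H_k(0)| = k! / (2^{k/2} (k/2)!)` for even `k`. -/
lemma aeval_hermite_even (j : ℕ) :
    (Polynomial.aeval (0 : ℝ) (Polynomial.hermite (2 * j)))
      = (-1) ^ j * ((2 * j).factorial / (2 ^ j * j.factorial)) := by
  rw [← Polynomial.coeff_zero_eq_aeval_zero']
  have h := Polynomial.coeff_hermite_explicit j 0
  rw [add_zero] at h
  rw [h]
  simp only [Nat.choose_zero_right, Nat.cast_one, mul_one, map_mul, map_pow, map_neg, map_one,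
    map_natCast]
  congr 1
  rcases j with _ | j
  · simp
  · have h1 := Nat.factorial_eq_mul_doubleFactorial (2 * j + 1)
    rw [show 2 * j + 1 + 1 = 2 * (j + 1) by ring, Nat.doubleFactorial_two_mul] at h1
    rw [h1, show 2 * (j + 1) - 1 = 2 * j + 1 by omega]
    push_cast
    field_simp

lemma aeval_hermite_odd (j : ℕ) :
    (Polynomial.aeval (0 : ℝ) (Polynomial.hermite (2 * j + 1))) = 0 := by
  rw [← Polynomial.coeff_zero_eq_aeval_zero', Polynomial.coeff_hermite_of_odd_add (by simp)]
  simp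

/-- For even `k = 2j` this is the bound `2^(2j)` on the central binomial coefficient; odd terms
vanish. It normalizes the Taylor coefficients in the second moment estimate. -/
lemma aeval_hermite_sq_le (k : ℕ) :
    (Polynomial.aeval (0 : ℝ) (Polynomial.hermite k)) ^ 2 ≤ k.factorial := by
  obtain ⟨j, rfl | rfl⟩ := Nat.even_or_odd' k
  · rw [aeval_hermite_even, mul_pow, ← pow_mul, mul_comm j 2, pow_mul, neg_one_sq, one_pow, one_mul]
    have h : ((2 * j).factorial : ℝ) ≤ (2 ^ j * j.factorial) ^ 2 := by
      have h1 : (2 * j).choose j ≤ 2 ^ (2 * j) := Nat.choose_le_two_pow _ _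
      have h2 := Nat.choose_mul_factorial_mul_factorial (show j ≤ 2 * j by omega)
      rw [show 2 * j - j = j by omega] at h2
      have h3 : (2 * j).factorial ≤ (2 ^ j * j.factorial) ^ 2 := by
        rw [← h2]
        calc (2 * j).choose j * j.factorial * j.factorial
            ≤ 2 ^ (2 * j) * j.factorial * j.factorial := by gcongr
          _ = (2 ^ j * j.factorial) ^ 2 := by ring
      exact_mod_cast h3
    rw [div_pow, sq ((2 * j).factorial : ℝ), mul_div_assoc]
    refine mul_le_of_le_one_right (by positivity) ?_
    exact div_le_one_of_le₀ h (by positivity)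
  · rw [aeval_hermite_odd, zero_pow two_ne_zero]
    positivity

/-- One computation for two series: `s = -1` gives the expansion of the Gaussian, `s = 1` the series
of absolute values that dominates its tail. -/
lemma hasSum_hermite_even_terms (s x : ℝ) (a : ℕ → ℝ)
    (he : ∀ j, a (2 * j) = s ^ j * ((2 * j).factorial / (2 ^ j * j.factorial)))
    (ho : ∀ j, a (2 * j + 1) = 0) :
    HasSum (fun k => a k * x ^ k / k.factorial) (Real.exp (s * x ^ 2 / 2)) := by
  have h1 : HasSum (fun j : ℕ => a (2 * j) * x ^ (2 * j) / (2 * j).factorial)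
      (Real.exp (s * x ^ 2 / 2)) := by
    have := NormedSpace.expSeries_div_hasSum_exp (s * x ^ 2 / 2)
    rw [← congr_fun Real.exp_eq_exp_ℝ] at this
    have e : (fun j : ℕ => a (2 * j) * x ^ (2 * j) / ((2 * j).factorial : ℝ))
        = fun j : ℕ => (s * x ^ 2 / 2) ^ j / (j.factorial : ℝ) := by
      ext j
      have hne : ((2 * j).factorial : ℝ) ≠ 0 := by positivity
      rw [he, div_pow, mul_pow, ← pow_mul]
      generalize ((2 * j).factorial : ℝ) = F at *
      field_simp
    rw [e]
    exact this
  have h2 : HasSum (fun j : ℕ => a (2 * j + 1) * x ^ (2 * j + 1) / (2 * j + 1).factorial) 0 := by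
    simp_rw [ho]
    simp
  have h3 := HasSum.even_add_odd (f := fun k => a k * x ^ k / (k.factorial : ℝ)) h1 h2
  rwa [add_zero] at h3

lemma hasSum_gaussian_taylor (x : ℝ) :
    HasSum (fun k : ℕ => ((-1) ^ k * Polynomial.aeval (0 : ℝ) (Polynomial.hermite k)) * x ^ k
      / k.factorial) (Real.exp (-x ^ 2 / 2)) := by
  have := hasSum_hermite_even_terms (-1) x
    (fun k => (-1) ^ k * Polynomial.aeval (0 : ℝ) (Polynomial.hermite k))
    (fun j => by rw [aeval_hermite_even, pow_mul]; simp)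
    (fun j => by rw [aeval_hermite_odd]; simp)
  simpa [neg_mul, one_mul] using this

lemma hasSum_abs_hermite (x : ℝ) :
    HasSum (fun k : ℕ => |Polynomial.aeval (0 : ℝ) (Polynomial.hermite k)| * x ^ k
      / k.factorial) (Real.exp (x ^ 2 / 2)) := by
  have := hasSum_hermite_even_terms 1 x
    (fun k => |Polynomial.aeval (0 : ℝ) (Polynomial.hermite k)|)
    (fun j => by
      rw [aeval_hermite_even, abs_mul, abs_pow, abs_neg, abs_one]
      rw [abs_of_nonneg (by positivity)])
    (fun j => by rw [aeval_hermite_odd]; simp)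
  simpa using this

/-- An exponential tilt: for indices at least `m`, multiplying the term by `exp(-m/2) exp(1/2)^k ≥
1` can only enlarge it. The tilted series of absolute values sums to `exp(exp 1 * x² / 2)`, and the
factor `exp(-m/2)` stays in front. -/
lemma gaussian_taylor_remainder (m : ℕ) (x : ℝ) :
    |∑ k ∈ Finset.range m, ((-1) ^ k * Polynomial.aeval (0 : ℝ) (Polynomial.hermite k)) * x ^ k
      / k.factorial - Real.exp (-x ^ 2 / 2)|
      ≤ Real.exp (-(m : ℝ) / 2 + Real.exp 1 * x ^ 2 / 2) := by
  have h1 := hasSum_gaussian_taylor x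
  have h2 := hasSum_abs_hermite (Real.exp (1 / 2) * |x|)
  have hs1 := h1.summable.sum_add_tsum_nat_add m
  rw [h1.tsum_eq] at hs1
  set t : ℕ → ℝ := fun k : ℕ => ((-1) ^ k * Polynomial.aeval (0 : ℝ) (Polynomial.hermite k)) * x ^ k
      / k.factorial with ht
  set u : ℕ → ℝ := fun k : ℕ => |Polynomial.aeval (0 : ℝ) (Polynomial.hermite k)|
    * (Real.exp (1 / 2) * |x|) ^ k / k.factorial with hu
  have hu0 : ∀ k, 0 ≤ u k := fun k => by simp only [hu]; positivity
  have htu : ∀ k, |t (k + m)| ≤ Real.exp (-(m : ℝ) / 2) * u (k + m) := by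
    intro k
    simp only [ht, hu, abs_div, abs_mul, abs_pow, abs_neg, abs_one, one_pow, one_mul, Nat.abs_cast,
      mul_pow]
    have hexp : 1 ≤ Real.exp (-(m : ℝ) / 2) * Real.exp (1 / 2) ^ (k + m) := by
      rw [← Real.exp_nat_mul, ← Real.exp_add]
      apply Real.one_le_exp
      push_cast
      have : (0 : ℝ) ≤ k := Nat.cast_nonneg k
      linarith
    have h0 : 0 ≤ |Polynomial.aeval (0 : ℝ) (Polynomial.hermite (k + m))| * |x| ^ (k + m)
        / (k + m).factorial := by positivity
    calc _ ≤ (Real.exp (-(m : ℝ) / 2) * Real.exp (1 / 2) ^ (k + m)) *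
          (|Polynomial.aeval (0 : ℝ) (Polynomial.hermite (k + m))| * |x| ^ (k + m)
        / (k + m).factorial) := le_mul_of_one_le_left h0 hexp
      _ = _ := by ring
  have hsu : Summable fun k => Real.exp (-(m : ℝ) / 2) * u (k + m) :=
    ((summable_nat_add_iff m).mpr h2.summable).mul_left _
  calc |∑ k ∈ Finset.range m, t k - Real.exp (-x ^ 2 / 2)| = ‖∑' k, t (k + m)‖ := by
        rw [← hs1, Real.norm_eq_abs, ← abs_neg]; congr 1; ring
    _ ≤ ∑' k, Real.exp (-(m : ℝ) / 2) * u (k + m) :=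
        tsum_of_norm_bounded hsu.hasSum (fun k => by simpa using htu k)
    _ = Real.exp (-(m : ℝ) / 2) * ∑' k, u (k + m) := tsum_mul_left
    _ ≤ Real.exp (-(m : ℝ) / 2) * Real.exp ((Real.exp (1 / 2) * |x|) ^ 2 / 2) := by
        gcongr
        rw [← h2.tsum_eq]
        rw [← h2.summable.sum_add_tsum_nat_add m]
        exact le_add_of_nonneg_left (Finset.sum_nonneg fun k _ => hu0 k)
    _ = _ := by
        rw [← Real.exp_add, mul_pow, sq_abs, ← Real.exp_nat_mul]
        congr 3
        norm_num

/-- Taylor coefficients of `G(·, β)` at `0`. -/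
def taylorCoeff (β : ℝ) : ℕ → ℝ
  | 0 => G 0 β
  | 1 => deriv (fun w => G w β) 0
  | k + 2 => stdPdf 0 * ((-1) ^ k * (Polynomial.aeval (0 : ℝ) (Polynomial.hermite k))
      / ((k + 2).factorial : ℝ))

/-- The hypothesis of `integral_sum_scaledHermite_sq_le`: the decay of the coefficients compensates
the factor `k!` in the Hermite second moments. -/
lemma taylorCoeff_sq_mul_factorial_le {β : ℝ} (h0 : 0 ≤ β) (h1 : β ≤ 1) (k : ℕ) :
    taylorCoeff β k ^ 2 * k.factorial ≤ 1 := by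
  have hp0 := stdPdf_nonneg 0
  have hp1 := stdPdf_le_one 0
  rcases k with _ | _ | k
  · simp only [taylorCoeff, G, zero_mul, mul_zero, add_zero, sub_zero, Nat.factorial_zero,
      Nat.cast_one, mul_one]
    nlinarith
  · simp only [taylorCoeff, (hasDerivAt_G 0 β).deriv, zero_add, Nat.factorial_one, Nat.cast_one,
      mul_one]
    have := stdCdf_nonneg 0
    have := stdCdf_le_one 0
    nlinarith
  · simp only [taylorCoeff]
    have hH := aeval_hermite_sq_le k
    have hf : (k.factorial : ℝ) ≤ (k + 2).factorial := by
      exact_mod_cast Nat.factorial_le (by omega)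
    have hpos : (0 : ℝ) < (k + 2).factorial := by positivity
    rw [mul_pow, div_pow, mul_pow, ← pow_mul, mul_comm k 2, pow_mul, neg_one_sq, one_pow, one_mul]
    calc stdPdf 0 ^ 2 * (Polynomial.aeval (0 : ℝ) (Polynomial.hermite k) ^ 2
          / ((k + 2).factorial : ℝ) ^ 2) * (k + 2).factorial
        ≤ 1 * ((k + 2).factorial / ((k + 2).factorial : ℝ) ^ 2) * (k + 2).factorial := by
          gcongr
          · exact pow_le_one₀ hp0 hp1
          · exact hH.trans hf
      _ = 1 := by field_simp

/-- Taylor approximation of `G` by its Taylor polynomial of order `m + 1`. -/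
lemma abs_taylor_sub_G_le (β : ℝ) (m : ℕ) {R w : ℝ} (hw : |w| ≤ R) :
    |∑ k ∈ Finset.range (m + 2), taylorCoeff β k * w ^ k - G w β|
      ≤ R ^ 2 * Real.exp (-(m : ℝ) / 2 + Real.exp 1 * R ^ 2 / 2) := by
  have hR : 0 ≤ R := (abs_nonneg w).trans hw
  set A : ℕ → ℝ := fun k => (-1) ^ k * (Polynomial.aeval (0 : ℝ) (Polynomial.hermite k)) with hA
  set f : ℝ → ℝ := fun x => ∑ k ∈ Finset.range (m + 2), taylorCoeff β k * x ^ k - G x β with hf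
  set f1 : ℝ → ℝ := fun x => stdPdf 0 * ∑ k ∈ Finset.range m, A k / (k + 1).factorial * x ^ (k + 1)
    + (stdCdf 0 - β) - (stdCdf x - β) with hf1
  set f2 : ℝ → ℝ := fun x => stdPdf 0 * ∑ k ∈ Finset.range m, A k * x ^ k / k.factorial - stdPdf x
    with hf2
  set B := Real.exp (-(m : ℝ) / 2 + Real.exp 1 * R ^ 2 / 2) with hB
  have hfe : f = fun x => stdPdf 0 * ∑ k ∈ Finset.range m, A k / (k + 2).factorial * x ^ (k + 2)
      + (stdCdf 0 - β) * x + G 0 β - G x β := by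
    ext x
    simp only [hf]
    rw [Finset.sum_range_succ', Finset.sum_range_succ', Finset.mul_sum]
    simp only [taylorCoeff, (hasDerivAt_G 0 β).deriv, pow_one, pow_zero, mul_one, zero_add, hA,
      mul_assoc]
  have hd1 : ∀ x, HasDerivAt f (f1 x) x := by
    intro x
    rw [hfe]
    refine HasDerivAt.sub (HasDerivAt.add_const _ (HasDerivAt.add (HasDerivAt.const_mul _
      (HasDerivAt.fun_sum fun k _ => ?_)) ?_)) (hasDerivAt_G x β)
    · have := (hasDerivAt_pow (k + 2) x).const_mul (A k / (k + 2).factorial)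
      refine this.congr_deriv ?_
      rw [Nat.factorial_succ (k + 1)]
      push_cast
      field_simp
      ring
    · simpa using (hasDerivAt_id x).const_mul (stdCdf 0 - β)
  have hd2 : ∀ x, HasDerivAt f1 (f2 x) x := by
    intro x
    simp only [hf1, hf2]
    refine HasDerivAt.sub (HasDerivAt.add_const _ (HasDerivAt.const_mul _
      (HasDerivAt.fun_sum fun k _ => ?_))) ((hasDerivAt_stdCdf x).sub_const β)
    have := (hasDerivAt_pow (k + 1) x).const_mul (A k / (k + 1).factorial)
    refine this.congr_deriv ?_
    rw [Nat.factorial_succ k]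
    push_cast
    field_simp
  have hb2 : ∀ x ∈ Set.Icc (-R) R, ‖f2 x‖ ≤ B := by
    intro x hx
    have hx2 : x ^ 2 ≤ R ^ 2 := sq_le_sq' hx.1 hx.2
    have h := gaussian_taylor_remainder m x
    simp only [hf2]
    rw [stdPdf_eq_mul_exp x, ← mul_sub, Real.norm_eq_abs, abs_mul, abs_of_nonneg (stdPdf_nonneg 0)]
    calc _ ≤ 1 * Real.exp (-(m : ℝ) / 2 + Real.exp 1 * x ^ 2 / 2) := by
          gcongr
          exact stdPdf_le_one 0
      _ ≤ B := by
          rw [one_mul, hB]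
          gcongr
  -- Since `G'' = φ`, the remainder of the Gaussian series bounds the second derivative of the
  -- error. The error and its derivative vanish at `0`, so two mean value estimates contribute the
  -- factor `R²`.
  have hz : (0 : ℝ) ∈ Set.Icc (-R) R := ⟨by linarith, hR⟩
  have hf10 : f1 0 = 0 := by simp [hf1]
  have hf0 : f 0 = 0 := by rw [hfe]; simp
  have hb1 : ∀ x ∈ Set.Icc (-R) R, ‖f1 x‖ ≤ B * R := by
    intro x hx
    have := (convex_Icc (-R) R).norm_image_sub_le_of_norm_hasDerivWithin_le
      (fun y _ => (hd2 y).hasDerivWithinAt) hb2 hz hx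
    rw [hf10, sub_zero, sub_zero] at this
    refine this.trans ?_
    gcongr
    exact abs_le.mpr hx
  have hwm : w ∈ Set.Icc (-R) R := abs_le.mp hw
  have := (convex_Icc (-R) R).norm_image_sub_le_of_norm_hasDerivWithin_le
      (fun y _ => (hd1 y).hasDerivWithinAt) hb1 hz hwm
  rw [hf0, sub_zero, sub_zero, Real.norm_eq_abs, Real.norm_eq_abs] at this
  refine this.trans ?_
  calc B * R * |w| ≤ B * R * R := by gcongr
    _ = R ^ 2 * B := by ring

lemma Model.hermiteEstimate_eq (M : Model) (γ : ℕ → ℝ) (n i : ℕ) (τ : ℝ≥0∞) (u : ℝ) :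
    M.hermiteEstimate γ n i τ u = ∑ k ∈ Finset.range (M.order γ n i - 1 + 2),
      taylorCoeff (M.ratio i) k * scaledHermite k (2 * M.sigmaP i * M.d i τ ^ 2) u := by
  rw [Finset.sum_range_succ', Finset.sum_range_succ']
  simp only [hermiteEstimate, taylorCoeff, scaledHermite_zero, scaledHermite_one, zero_add,
    Finset.mul_sum, mul_one, mul_assoc]
  ring

/-! ### The threshold estimator in a pair of independent Gaussian variables -/

/-- The map is a rotation by `-π/4` followed by a swap, hence preserves the standard Gaussian law of
the plane. This is why the sum and the difference of observation and noise are independent. -/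
lemma integral_rotate_stdGauss {f : ℝ × ℝ → ℝ}
    (hf : Integrable f (stdGauss.prod stdGauss)) :
    Integrable (fun p : ℝ × ℝ => f ((p.1 + p.2) / √2, (p.1 - p.2) / √2))
      (stdGauss.prod stdGauss) ∧
    ∫ p, f ((p.1 + p.2) / √2, (p.1 - p.2) / √2) ∂(stdGauss.prod stdGauss)
      = ∫ p, f p ∂(stdGauss.prod stdGauss) := by
  have hrot := IsGaussian.map_rotation_eq_self (μ := stdGauss)
    (by simp [integral_id_gaussianReal]) (-(Real.pi / 4))
  have hmp : MeasurePreserving (fun p : ℝ × ℝ => ((p.1 + p.2) / √2, (p.1 - p.2) / √2))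
      (stdGauss.prod stdGauss) (stdGauss.prod stdGauss) := by
    have h1 : MeasurePreserving (ContinuousLinearMap.rotation (E := ℝ) (-(Real.pi / 4)))
      (stdGauss.prod stdGauss) (stdGauss.prod stdGauss) :=
      ⟨(ContinuousLinearMap.continuous _).measurable, hrot⟩
    have h2 := (Measure.measurePreserving_swap (μ := stdGauss) (ν := stdGauss)).comp h1
    convert h2 using 1
    ext p
    · simp only [Function.comp_apply, ContinuousLinearMap.rotation_apply, Prod.fst_swap]
      simp only [Real.sin_neg, Real.cos_neg, Real.sin_pi_div_four, Real.cos_pi_div_four,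
        smul_eq_mul, neg_neg]
      rw [← mul_add, div_eq_inv_mul, Real.sqrt_div_self', one_div]
    · simp only [Function.comp_apply, ContinuousLinearMap.rotation_apply, Prod.snd_swap]
      simp only [Real.sin_neg, Real.cos_neg, Real.sin_pi_div_four, Real.cos_pi_div_four,
        smul_eq_mul, neg_mul]
      rw [← sub_eq_add_neg, ← mul_sub, div_eq_inv_mul, Real.sqrt_div_self', one_div]
  refine ⟨hmp.integrable_comp_of_integrable hf, ?_⟩
  have hfm : AEStronglyMeasurable f (Measure.map
      (fun p : ℝ × ℝ => ((p.1 + p.2) / √2, (p.1 - p.2) / √2)) (stdGauss.prod stdGauss)) := by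
    rw [hmp.map_eq]; exact hf.aestronglyMeasurable
  rw [← integral_map hmp.measurable.aemeasurable hfm, hmp.map_eq]

/-- A function selected by the position of `v` relative to `[-l, l]`. -/
def threeWay (l : ℝ) (a b c : ℝ) (v : ℝ) : ℝ := if v < -l then a else if v ≤ l then b else c

lemma threeWay_comp (l : ℝ) (g : ℝ → ℝ) (a b c v : ℝ) :
    g (threeWay l a b c v) = threeWay l (g a) (g b) (g c) v := by
  unfold threeWay; split_ifs <;> rfl

section Mixture

variable (l w e : ℝ)

/-- Probability of the three regions for `w + e Z`. -/
def probBelow : ℝ := stdGauss.real {z | w + e * z < -l}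
def probMid : ℝ := stdGauss.real {z | -l ≤ w + e * z ∧ w + e * z ≤ l}
def probAbove : ℝ := stdGauss.real {z | ¬ w + e * z < -l ∧ ¬ w + e * z ≤ l}

lemma probBelow_nonneg : 0 ≤ probBelow l w e := measureReal_nonneg
lemma probMid_nonneg : 0 ≤ probMid l w e := measureReal_nonneg
lemma probAbove_nonneg : 0 ≤ probAbove l w e := measureReal_nonneg
lemma probBelow_le_one : probBelow l w e ≤ 1 := measureReal_le_one
lemma probMid_le_one : probMid l w e ≤ 1 := measureReal_le_one
lemma probAbove_le_one : probAbove l w e ≤ 1 := measureReal_le_one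

/-- The selector depends on the second variable only and the three values on the first, so by
independence each region contributes its probability times a mean. -/
lemma integrable_threeWay {a b c : ℝ → ℝ} (ha : Integrable a stdGauss) (hb : Integrable b stdGauss)
    (hc : Integrable c stdGauss) :
    Integrable (fun p : ℝ × ℝ => threeWay l (a p.1) (b p.1) (c p.1) (w + e * p.2))
      (stdGauss.prod stdGauss) ∧
    ∫ p : ℝ × ℝ, threeWay l (a p.1) (b p.1) (c p.1) (w + e * p.2) ∂(stdGauss.prod stdGauss)
      = probBelow l w e * ∫ z, a z ∂stdGauss + probMid l w e * ∫ z, b z ∂stdGauss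
        + probAbove l w e * ∫ z, c z ∂stdGauss := by
  have hm : Measurable fun z : ℝ => w + e * z := by fun_prop
  have hA : MeasurableSet {z : ℝ | w + e * z < -l} := measurableSet_lt hm measurable_const
  have hD : MeasurableSet {z : ℝ | w + e * z ≤ l} := measurableSet_le hm measurable_const
  have hB : MeasurableSet {z : ℝ | -l ≤ w + e * z ∧ w + e * z ≤ l} :=
    (measurableSet_le measurable_const hm).inter hD
  have hC : MeasurableSet {z : ℝ | ¬ w + e * z < -l ∧ ¬ w + e * z ≤ l} := hA.compl.inter hD.compl
  have hint : ∀ s : Set ℝ, MeasurableSet s → Integrable (s.indicator fun _ => (1 : ℝ)) stdGauss :=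
    fun s hs => (integrable_const (1 : ℝ)).indicator hs
  have hval : ∀ s : Set ℝ, MeasurableSet s →
      ∫ z, s.indicator (fun _ => (1 : ℝ)) z ∂stdGauss = stdGauss.real s := by
    intro s hs
    rw [integral_indicator hs]; simp
  have heq : (fun p : ℝ × ℝ => threeWay l (a p.1) (b p.1) (c p.1) (w + e * p.2))
      = fun p : ℝ × ℝ =>
        (a p.1 * {z : ℝ | w + e * z < -l}.indicator (fun _ => (1 : ℝ)) p.2
        + b p.1 * {z : ℝ | -l ≤ w + e * z ∧ w + e * z ≤ l}.indicator (fun _ => (1 : ℝ)) p.2)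
        + c p.1 * {z : ℝ | ¬ w + e * z < -l ∧ ¬ w + e * z ≤ l}.indicator (fun _ => (1 : ℝ)) p.2 := by
    ext p
    simp only [threeWay, Set.indicator_apply, Set.mem_ofPred_eq]
    by_cases h1 : w + e * p.2 < -l
    · simp [h1]
    · by_cases h2 : w + e * p.2 ≤ l
      · simp [h1, h2, not_lt.mp h1]
      · simp [h1, h2]
  rw [heq]
  have h1 := ha.mul_prod (hint _ hA)
  have h2 := hb.mul_prod (hint _ hB)
  have h3 := hc.mul_prod (hint _ hC)
  have h12 : Integrable (fun p : ℝ × ℝ =>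
      a p.1 * {z : ℝ | w + e * z < -l}.indicator (fun _ => (1 : ℝ)) p.2
      + b p.1 * {z : ℝ | -l ≤ w + e * z ∧ w + e * z ≤ l}.indicator (fun _ => (1 : ℝ)) p.2)
      (stdGauss.prod stdGauss) := h1.add h2
  refine ⟨h12.add h3, ?_⟩
  rw [integral_add h12 h3, integral_add h1 h2, integral_prod_mul, integral_prod_mul,
    integral_prod_mul, hval _ hA, hval _ hB, hval _ hC, probBelow, probMid, probAbove]
  ring

lemma prob_sum : probBelow l w e + probMid l w e + probAbove l w e = 1 := by
  have := (integrable_threeWay l w e (integrable_const (1 : ℝ)) (integrable_const (1 : ℝ))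
    (integrable_const (1 : ℝ))).2
  simp [threeWay] at this
  linarith

end Mixture

/-! ### Tail bounds for the probabilities of the three regions. -/

lemma probBelow_le {l w e x β : ℝ} (hβ : 0 < β) (he : |e| ≤ β) (hx : 0 ≤ x)
    (hxt : x ≤ w + l) : probBelow l w e ≤ Real.exp (-x ^ 2 / (2 * β ^ 2)) :=
  le_trans (measureReal_mono fun z (hz : w + e * z < -l) => hz.le)
    (stdGauss_lower_tail (w := w) (t := -l) hβ he hx (by linarith))

lemma probBelow_add_probMid_le {l w e x β : ℝ} (hl : 0 ≤ l) (hβ : 0 < β) (he : |e| ≤ β)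
    (hx : 0 ≤ x) (hxt : x ≤ w - l) :
    probBelow l w e ≤ Real.exp (-x ^ 2 / (2 * β ^ 2)) ∧
      probMid l w e ≤ Real.exp (-x ^ 2 / (2 * β ^ 2)) :=
  ⟨probBelow_le hβ he hx (by linarith), le_trans (measureReal_mono fun _ hz => hz.2)
    (stdGauss_lower_tail (w := w) (t := l) hβ he hx hxt)⟩

lemma probAbove_le {l w e x β : ℝ} (hβ : 0 < β) (he : |e| ≤ β) (hx : 0 ≤ x)
    (hxt : x ≤ l - w) : probAbove l w e ≤ Real.exp (-x ^ 2 / (2 * β ^ 2)) :=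
  le_trans (measureReal_mono fun _ hz => (not_le.mp hz.2).le)
    (stdGauss_upper_tail (w := w) (t := l) hβ he hx hxt)

lemma probAbove_probMid_le {l w e x β : ℝ} (hl : 0 ≤ l) (hβ : 0 < β) (he : |e| ≤ β)
    (hx : 0 ≤ x) (hxt : x ≤ -w - l) :
    probAbove l w e ≤ Real.exp (-x ^ 2 / (2 * β ^ 2)) ∧
      probMid l w e ≤ Real.exp (-x ^ 2 / (2 * β ^ 2)) :=
  ⟨probAbove_le hβ he hx (by linarith), le_trans (measureReal_mono fun _ hz => hz.1)
    (stdGauss_upper_tail (w := w) (t := -l) hβ he hx (by linarith))⟩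

/-! ### Bias and second moment of the threshold estimator for a general central estimate. -/

/-- Truncation to `[-N, N]`. -/
def clip (N s : ℝ) : ℝ := max (-N) (min N s)

lemma abs_clip_le {N : ℝ} (hN : 0 ≤ N) (s : ℝ) : |clip N s| ≤ N := by
  rw [clip, abs_le]
  exact ⟨le_max_left _ _, max_le (by linarith) (min_le_left _ _)⟩

lemma abs_clip_le_abs {N : ℝ} (hN : 0 ≤ N) (s : ℝ) : |clip N s| ≤ |s| := by
  rw [clip, abs_le]
  constructor
  · refine le_max_of_le_right (le_min ?_ (neg_abs_le s))
    have := abs_nonneg s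
    linarith
  · refine max_le ?_ ((min_le_right _ _).trans (le_abs_self s))
    have := abs_nonneg s
    linarith

/-- Nothing is lost for `|s| ≤ N`; otherwise the loss is at most `|s| ≤ s²/N`. So the bias due to
truncation costs only a second moment divided by `N`. -/
lemma abs_clip_sub_le {N : ℝ} (hN : 0 < N) (s : ℝ) : |clip N s - s| ≤ s ^ 2 / N := by
  rw [le_div_iff₀ hN, clip]
  rcases le_total N s with h | h
  · rw [min_eq_left h, max_eq_right (by linarith), abs_of_nonpos (by linarith)]
    nlinarith
  · rw [min_eq_right h]
    rcases le_total (-N) s with h2 | h2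
    · rw [max_eq_right h2]; simp; positivity
    · rw [max_eq_left h2, abs_of_nonneg (by linarith)]
      nlinarith

/-- The threshold estimator as a function of `(u, v)`. -/
def thresholdT (l β N : ℝ) (S : ℝ → ℝ) (u v : ℝ) : ℝ :=
  threeWay l (-(β * u)) (clip N (S u)) ((1 - β) * u) v

lemma integrable_affine_stdGauss (w e : ℝ) : Integrable (fun z : ℝ => w + e * z) stdGauss :=
  (integrable_const w).add (integrable_id_stdGauss.const_mul e)

lemma integral_affine_stdGauss (w e : ℝ) : ∫ z : ℝ, (w + e * z) ∂stdGauss = w := by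
  rw [integral_add (integrable_const w) (integrable_id_stdGauss.const_mul e), integral_const_mul,
    integral_id_gaussianReal]
  simp

lemma integral_sq_stdGauss : ∫ z : ℝ, z ^ 2 ∂stdGauss = 1 := by
  have h := integral_mul_eval_stdGauss Polynomial.X
  simp only [Polynomial.eval_X, Polynomial.derivative_X, Polynomial.eval_one] at h
  simp_rw [sq]
  rw [h]; simp

lemma integrable_affine_sq_stdGauss (w e : ℝ) :
    Integrable (fun z : ℝ => (w + e * z) ^ 2) stdGauss := by
  have := integrable_eval_stdGauss ((Polynomial.C w + Polynomial.C e * Polynomial.X) ^ 2)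
  simpa using this

lemma integral_affine_sq_stdGauss (w e : ℝ) : ∫ z : ℝ, (w + e * z) ^ 2 ∂stdGauss = w ^ 2 + e ^ 2 := by
  have : ∀ z : ℝ, (w + e * z) ^ 2 = (w ^ 2 + (2 * w * e) * z) + e ^ 2 * z ^ 2 := fun z => by ring
  simp_rw [this]
  rw [integral_add (integrable_affine_stdGauss _ _) ((integrable_pow_stdGauss 2).const_mul _),
    integral_affine_stdGauss, integral_const_mul, integral_sq_stdGauss, mul_one]

section Core

variable {l β N w e : ℝ} {S : ℝ → ℝ}

lemma integrable_clip (hN : 0 ≤ N) (hS : Continuous S) :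
    Integrable (fun z => clip N (S (w + e * z))) stdGauss := by
  refine (integrable_const N).mono' ?_ (ae_of_all _ fun z => abs_clip_le hN _)
  unfold clip
  exact Continuous.aestronglyMeasurable (by fun_prop)

lemma integrable_thresholdT (hN : 0 ≤ N) (hS : Continuous S) :
    Integrable (fun p : ℝ × ℝ => thresholdT l β N S (w + e * p.1) (w + e * p.2))
      (stdGauss.prod stdGauss) ∧
    ∫ p : ℝ × ℝ, thresholdT l β N S (w + e * p.1) (w + e * p.2) ∂(stdGauss.prod stdGauss)
      = probBelow l w e * (-(β * w)) + probMid l w e * ∫ z, clip N (S (w + e * z)) ∂stdGauss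
        + probAbove l w e * ((1 - β) * w) := by
  have hu := integrable_affine_stdGauss w e
  have h := integrable_threeWay l w e (hu.const_mul β).neg (integrable_clip (w := w) (e := e) hN hS)
    (hu.const_mul (1 - β))
  refine ⟨h.1, h.2.trans ?_⟩
  simp only [Pi.neg_apply]
  rw [integral_neg, integral_const_mul, integral_const_mul, integral_affine_stdGauss]

/-- Second moment of the threshold estimator about `m`. -/
lemma integral_thresholdT_sub_sq (hN : 0 ≤ N) (hS : Continuous S) (m : ℝ) :
    Integrable (fun p : ℝ × ℝ => (thresholdT l β N S (w + e * p.1) (w + e * p.2) - m) ^ 2)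
      (stdGauss.prod stdGauss) ∧
    ∫ p : ℝ × ℝ, (thresholdT l β N S (w + e * p.1) (w + e * p.2) - m) ^ 2
        ∂(stdGauss.prod stdGauss)
      = probBelow l w e * ((-(β * w) - m) ^ 2 + (β * e) ^ 2)
        + probMid l w e * ∫ z, (clip N (S (w + e * z)) - m) ^ 2 ∂stdGauss
        + probAbove l w e * (((1 - β) * w - m) ^ 2 + ((1 - β) * e) ^ 2) := by
  have ha : (fun z => (-(β * (w + e * z)) - m) ^ 2)
      = fun z : ℝ => ((-(β * w) - m) + (-(β * e)) * z) ^ 2 := by ext z; ring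
  have hc : (fun z => ((1 - β) * (w + e * z) - m) ^ 2)
      = fun z : ℝ => (((1 - β) * w - m) + ((1 - β) * e) * z) ^ 2 := by ext z; ring
  have hb : Integrable (fun z => (clip N (S (w + e * z)) - m) ^ 2) stdGauss := by
    refine (integrable_const ((N + |m|) ^ 2)).mono' ?_ (ae_of_all _ fun z => ?_)
    · unfold clip
      exact Continuous.aestronglyMeasurable (by fun_prop)
    · rw [Real.norm_eq_abs, abs_pow]
      gcongr
      exact (abs_sub _ _).trans (by gcongr; exact abs_clip_le hN _)
  have h := integrable_threeWay l w e (a := fun z => (-(β * (w + e * z)) - m) ^ 2)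
    (c := fun z => ((1 - β) * (w + e * z) - m) ^ 2)
    (by rw [ha]; exact integrable_affine_sq_stdGauss _ _) hb
    (by rw [hc]; exact integrable_affine_sq_stdGauss _ _)
  have he : (fun p : ℝ × ℝ => (thresholdT l β N S (w + e * p.1) (w + e * p.2) - m) ^ 2)
      = fun p : ℝ × ℝ => threeWay l ((-(β * (w + e * p.1)) - m) ^ 2)
        ((clip N (S (w + e * p.1)) - m) ^ 2) (((1 - β) * (w + e * p.1) - m) ^ 2) (w + e * p.2) := by
    ext p
    exact threeWay_comp l (fun x => (x - m) ^ 2) _ _ _ _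
  rw [he]
  refine ⟨h.1, h.2.trans ?_⟩
  rw [ha, hc, integral_affine_sq_stdGauss, integral_affine_sq_stdGauss, neg_sq (β * e)]

/-- As the three probabilities add up to `1`, `G` can be subtracted region by region. The linear
pieces miss `G` by `meanPosPart w` and `meanPosPart w - w`, independently of `β`. -/
lemma abs_bias_le (hN : 0 ≤ N) (hS : Continuous S) :
    |∫ p : ℝ × ℝ, thresholdT l β N S (w + e * p.1) (w + e * p.2) ∂(stdGauss.prod stdGauss) - G w β|
      ≤ probBelow l w e * meanPosPart w
        + probMid l w e * |∫ z, clip N (S (w + e * z)) ∂stdGauss - G w β|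
        + probAbove l w e * (meanPosPart w - w) := by
  rw [(integrable_thresholdT hN hS).2]
  have hsum := prob_sum l w e
  have e1 : probBelow l w e * (-(β * w)) + probMid l w e * ∫ z, clip N (S (w + e * z)) ∂stdGauss
        + probAbove l w e * ((1 - β) * w) - G w β
      = probBelow l w e * (-meanPosPart w)
        + probMid l w e * (∫ z, clip N (S (w + e * z)) ∂stdGauss - G w β)
        + probAbove l w e * (-(meanPosPart w - w)) := by
    have : G w β = (probBelow l w e + probMid l w e + probAbove l w e) * G w β := by
      rw [hsum, one_mul]
    rw [this, G_eq]
    have h2 : probMid l w e = 1 - probBelow l w e - probAbove l w e := by linarith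
    rw [h2]; ring
  rw [e1]
  refine (abs_add_three _ _ _).trans ?_
  rw [abs_mul, abs_mul, abs_mul, abs_neg, abs_neg, abs_of_nonneg (probBelow_nonneg l w e),
    abs_of_nonneg (probMid_nonneg l w e), abs_of_nonneg (probAbove_nonneg l w e),
    abs_of_nonneg (meanPosPart_nonneg w), abs_of_nonneg (sub_nonneg.mpr (le_meanPosPart w))]

/-- Choosing the upper linear piece is harmless either way: for `w ≥ l/2` that piece approximates
`G` up to `exp(-w²/2)`, and for `w ≤ l/2` exceeding `l` is a deviation of at least `l/2`. The lemma
for the lower piece is its mirror image. -/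
lemma probAbove_mul_le (he : |e| ≤ 1) (hl : 0 ≤ l) :
    probAbove l w e * (meanPosPart w - w) ≤ (1 + |w|) * Real.exp (-l ^ 2 / 8) := by
  have hx := Real.exp_pos (-l ^ 2 / 8)
  have hm : 0 ≤ meanPosPart w - w := sub_nonneg.mpr (le_meanPosPart w)
  rcases le_total (l / 2) w with h | h
  · have hw : 0 ≤ w := by linarith
    calc probAbove l w e * (meanPosPart w - w) ≤ 1 * Real.exp (-w ^ 2 / 2) := by
          gcongr
          · exact probAbove_le_one _ _ _
          · exact (meanPosPart_sub_le_stdPdf hw).trans (stdPdf_le_exp w)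
      _ ≤ (1 + |w|) * Real.exp (-l ^ 2 / 8) := by
          refine mul_le_mul (by linarith [abs_nonneg w]) (Real.exp_le_exp.mpr (by nlinarith))
            (Real.exp_pos _).le (by positivity)
  · have := probAbove_le (l := l) (w := w) (x := l / 2) one_pos he (by linarith) (by linarith)
    calc probAbove l w e * (meanPosPart w - w)
        ≤ Real.exp (-(l / 2) ^ 2 / (2 * 1 ^ 2)) * (|w| + 1) := by
          gcongr
          exact meanPosPart_sub_le w
      _ = (1 + |w|) * Real.exp (-l ^ 2 / 8) := by
          rw [mul_comm, add_comm]; congr 2; ring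

lemma probBelow_mul_le (he : |e| ≤ 1) (hl : 0 ≤ l) :
    probBelow l w e * meanPosPart w ≤ (1 + |w|) * Real.exp (-l ^ 2 / 8) := by
  have hx := Real.exp_pos (-l ^ 2 / 8)
  have hm := meanPosPart_nonneg w
  rcases le_total w (-(l / 2)) with h | h
  · have hw : w ≤ 0 := by linarith
    calc probBelow l w e * meanPosPart w ≤ 1 * Real.exp (-w ^ 2 / 2) := by
          gcongr
          · exact probBelow_le_one _ _ _
          · exact (meanPosPart_le_stdPdf hw).trans (stdPdf_le_exp w)
      _ ≤ (1 + |w|) * Real.exp (-l ^ 2 / 8) := by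
          refine mul_le_mul (by linarith [abs_nonneg w]) (Real.exp_le_exp.mpr (by nlinarith))
            (Real.exp_pos _).le (by positivity)
  · have := probBelow_le (l := l) (w := w) (x := l / 2) one_pos he (by linarith) (by linarith)
    calc probBelow l w e * meanPosPart w
        ≤ Real.exp (-(l / 2) ^ 2 / (2 * 1 ^ 2)) * (|w| + 1) := by
          gcongr
          exact meanPosPart_le w
      _ = (1 + |w|) * Real.exp (-l ^ 2 / 8) := by
          rw [mul_comm, add_comm]; congr 2; ring

lemma abs_integral_clip_sub_le (hN : 0 < N) (hS : Continuous S)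
    (hS1 : Integrable (fun z => S (w + e * z)) stdGauss)
    (hS2 : Integrable (fun z => S (w + e * z) ^ 2) stdGauss) :
    |∫ z, clip N (S (w + e * z)) ∂stdGauss - ∫ z, S (w + e * z) ∂stdGauss|
      ≤ (∫ z, S (w + e * z) ^ 2 ∂stdGauss) / N := by
  rw [← integral_sub (integrable_clip hN.le hS) hS1, ← integral_div]
  refine (abs_integral_le_integral_abs).trans ?_
  refine integral_mono ((integrable_clip hN.le hS).sub hS1).abs (hS2.div_const _) fun z => ?_
  exact abs_clip_sub_le hN _

/-- Far from the threshold region, the estimator is nearly linear. -/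
lemma far_bounds (h0 : 0 ≤ β) (h1 : β ≤ 1) (hN : 0 ≤ N) (hS : Continuous S) (he : e ^ 2 ≤ 1)
    {q : ℝ} (hq : probMid l w e ≤ q)
    (hq2 : (0 ≤ w ∧ probBelow l w e ≤ q) ∨ (w ≤ 0 ∧ probAbove l w e ≤ q)) :
    |∫ p : ℝ × ℝ, thresholdT l β N S (w + e * p.1) (w + e * p.2) ∂(stdGauss.prod stdGauss) - G w β|
      ≤ q * (N + 2 * (|w| + 1)) + Real.exp (-w ^ 2 / 2) ∧
    ∃ m, ∫ p : ℝ × ℝ, (thresholdT l β N S (w + e * p.1) (w + e * p.2) - m) ^ 2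
        ∂(stdGauss.prod stdGauss) ≤ 2 + q * (w ^ 2 + (N + |w|) ^ 2) := by
  have hq0 : 0 ≤ q := (probMid_nonneg l w e).trans hq
  have hb : |∫ z, clip N (S (w + e * z)) ∂stdGauss - G w β| ≤ N + (|w| + 1) := by
    refine (abs_sub _ _).trans (add_le_add ?_ (abs_G_le h0 h1 w))
    refine abs_integral_le_integral_abs.trans ?_
    calc ∫ z, |clip N (S (w + e * z))| ∂stdGauss ≤ ∫ _, N ∂stdGauss :=
          integral_mono (integrable_clip hN hS).abs (integrable_const _) fun z => abs_clip_le hN _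
      _ = N := by simp
  have hc : ∀ m, |m| ≤ |w| → ∫ z, (clip N (S (w + e * z)) - m) ^ 2 ∂stdGauss ≤ (N + |w|) ^ 2 := by
    intro m hm
    have hle : ∀ z, (clip N (S (w + e * z)) - m) ^ 2 ≤ (N + |w|) ^ 2 := by
      intro z
      rw [← sq_abs]
      gcongr
      exact (abs_sub _ _).trans (add_le_add (abs_clip_le hN _) hm)
    calc _ ≤ ∫ _, (N + |w|) ^ 2 ∂stdGauss := by
          refine integral_mono_of_nonneg (ae_of_all _ fun z => sq_nonneg _) (integrable_const _)
            (ae_of_all _ hle)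
      _ = _ := by simp
  have hA0 := probBelow_nonneg l w e
  have hB0 := probMid_nonneg l w e
  have hC0 := probAbove_nonneg l w e
  have hbe : (β * e) ^ 2 ≤ 1 := by
    rw [mul_pow]; exact mul_le_one₀ (pow_le_one₀ h0 h1) (sq_nonneg e) he
  have hbe' : ((1 - β) * e) ^ 2 ≤ 1 := by
    rw [mul_pow]
    exact mul_le_one₀ (pow_le_one₀ (by linarith) (by linarith)) (sq_nonneg e) he
  have hbias := abs_bias_le (β := β) (l := l) (w := w) (e := e) hN hS
  have hM : probMid l w e * |∫ z, clip N (S (w + e * z)) ∂stdGauss - G w β|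
      ≤ q * (N + (|w| + 1)) := mul_le_mul hq hb (abs_nonneg _) hq0
  rcases hq2 with ⟨hw, hq2⟩ | ⟨hw, hq2⟩
  · constructor
    · refine hbias.trans ?_
      have h2 : probBelow l w e * meanPosPart w ≤ q * (|w| + 1) :=
        mul_le_mul hq2 (meanPosPart_le w) (meanPosPart_nonneg w) hq0
      have h3 : probAbove l w e * (meanPosPart w - w) ≤ 1 * Real.exp (-w ^ 2 / 2) :=
        mul_le_mul (probAbove_le_one l w e)
          ((meanPosPart_sub_le_stdPdf hw).trans (stdPdf_le_exp w))
          (sub_nonneg.mpr (le_meanPosPart w)) zero_le_one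
      linarith
    -- The centre is the mean of the correct linear piece. This removes `w²` from the dominant term;
    -- it survives only multiplied by the small probability `q`, which matters because `w` is
    -- unbounded here.
    · refine ⟨(1 - β) * w, ?_⟩
      rw [(integral_thresholdT_sub_sq hN hS _).2]
      have hm : |(1 - β) * w| ≤ |w| := by
        rw [abs_mul]
        exact mul_le_of_le_one_left (abs_nonneg w) (abs_le.mpr ⟨by linarith, by linarith⟩)
      have h2 : probMid l w e * ∫ z, (clip N (S (w + e * z)) - (1 - β) * w) ^ 2 ∂stdGauss
          ≤ q * (N + |w|) ^ 2 :=
        mul_le_mul hq (hc _ hm) (integral_nonneg fun _ => sq_nonneg _) hq0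
      have h3 : probBelow l w e * ((-(β * w) - (1 - β) * w) ^ 2 + (β * e) ^ 2)
          ≤ q * w ^ 2 + 1 := by
        have e1 : (-(β * w) - (1 - β) * w) ^ 2 = w ^ 2 := by ring
        rw [e1, mul_add]
        refine add_le_add (mul_le_mul_of_nonneg_right hq2 (sq_nonneg w)) ?_
        exact mul_le_one₀ (probBelow_le_one l w e) (sq_nonneg _) hbe
      have h4 : probAbove l w e * (((1 - β) * w - (1 - β) * w) ^ 2 + ((1 - β) * e) ^ 2) ≤ 1 := by
        rw [sub_self, zero_pow two_ne_zero, zero_add]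
        exact mul_le_one₀ (probAbove_le_one l w e) (sq_nonneg _) hbe'
      linarith
  · constructor
    · refine hbias.trans ?_
      have h2 : probAbove l w e * (meanPosPart w - w) ≤ q * (|w| + 1) :=
        mul_le_mul hq2 (meanPosPart_sub_le w) (sub_nonneg.mpr (le_meanPosPart w)) hq0
      have h3 : probBelow l w e * meanPosPart w ≤ 1 * Real.exp (-w ^ 2 / 2) :=
        mul_le_mul (probBelow_le_one l w e)
          ((meanPosPart_le_stdPdf hw).trans (stdPdf_le_exp w))
          (meanPosPart_nonneg w) zero_le_one
      linarith
    · refine ⟨-(β * w), ?_⟩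
      rw [(integral_thresholdT_sub_sq hN hS _).2]
      have hm : |(-(β * w))| ≤ |w| := by
        rw [abs_neg, abs_mul]
        exact mul_le_of_le_one_left (abs_nonneg w) (abs_le.mpr ⟨by linarith, by linarith⟩)
      have h2 : probMid l w e * ∫ z, (clip N (S (w + e * z)) - (-(β * w))) ^ 2 ∂stdGauss
          ≤ q * (N + |w|) ^ 2 :=
        mul_le_mul hq (hc _ hm) (integral_nonneg fun _ => sq_nonneg _) hq0
      have h3 : probAbove l w e * (((1 - β) * w - (-(β * w))) ^ 2 + ((1 - β) * e) ^ 2)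
          ≤ q * w ^ 2 + 1 := by
        have e1 : ((1 - β) * w - (-(β * w))) ^ 2 = w ^ 2 := by ring
        rw [e1, mul_add]
        refine add_le_add (mul_le_mul_of_nonneg_right hq2 (sq_nonneg w)) ?_
        exact mul_le_one₀ (probAbove_le_one l w e) (sq_nonneg _) hbe'
      have h4 : probBelow l w e * ((-(β * w) - (-(β * w))) ^ 2 + (β * e) ^ 2) ≤ 1 := by
        rw [sub_self, zero_pow two_ne_zero, zero_add]
        exact mul_le_one₀ (probBelow_le_one l w e) (sq_nonneg _) hbe
      linarith

/-- In the central region, the bias and the second moment are controlled by those of `S`. -/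
lemma central_bounds (h0 : 0 ≤ β) (h1 : β ≤ 1) (hN : 0 < N) (hS : Continuous S) (he : |e| ≤ 1)
    (hl : 0 ≤ l) {T Q : ℝ} (hS1 : Integrable (fun z => S (w + e * z)) stdGauss)
    (hS2 : Integrable (fun z => S (w + e * z) ^ 2) stdGauss)
    (hT : |∫ z, S (w + e * z) ∂stdGauss - G w β| ≤ T)
    (hQ : ∫ z, S (w + e * z) ^ 2 ∂stdGauss ≤ Q) :
    |∫ p : ℝ × ℝ, thresholdT l β N S (w + e * p.1) (w + e * p.2) ∂(stdGauss.prod stdGauss) - G w β|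
      ≤ 2 * ((1 + |w|) * Real.exp (-l ^ 2 / 8)) + (Q / N + T) ∧
    ∃ m, ∫ p : ℝ × ℝ, (thresholdT l β N S (w + e * p.1) (w + e * p.2) - m) ^ 2
        ∂(stdGauss.prod stdGauss) ≤ 2 * (w ^ 2 + 1) + Q := by
  have hsq : e ^ 2 ≤ 1 := by rw [← sq_abs]; exact pow_le_one₀ (abs_nonneg e) he
  constructor
  · refine (abs_bias_le (l := l) (w := w) (e := e) hN.le hS).trans ?_
    have h2 := probBelow_mul_le (w := w) he hl
    have h3 := probAbove_mul_le (w := w) he hl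
    have h4 := abs_integral_clip_sub_le hN hS hS1 hS2
    have h5 : |∫ z, clip N (S (w + e * z)) ∂stdGauss - G w β| ≤ Q / N + T := by
      refine (abs_sub_le _ (∫ z, S (w + e * z) ∂stdGauss) _).trans (add_le_add ?_ hT)
      exact h4.trans (by gcongr)
    have h6 : probMid l w e * |∫ z, clip N (S (w + e * z)) ∂stdGauss - G w β| ≤ Q / N + T :=
      (mul_le_of_le_one_left (abs_nonneg _) (probMid_le_one l w e)).trans h5
    linarith
  -- Centring at `0` is enough here: in the application `w²` is at most of order `log n`.
  · refine ⟨0, ?_⟩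
    rw [(integral_thresholdT_sub_sq hN.le hS _).2]
    have hb2 : β ^ 2 ≤ 1 := pow_le_one₀ h0 h1
    have hb3 : (1 - β) ^ 2 ≤ 1 := pow_le_one₀ (by linarith) (by linarith)
    have h2 : probBelow l w e * ((-(β * w) - 0) ^ 2 + (β * e) ^ 2) ≤ w ^ 2 + 1 := by
      refine (mul_le_of_le_one_left (by positivity) (probBelow_le_one l w e)).trans ?_
      nlinarith [sq_nonneg w, sq_nonneg e, mul_nonneg h0 h0]
    have h3 : probAbove l w e * (((1 - β) * w - 0) ^ 2 + ((1 - β) * e) ^ 2) ≤ w ^ 2 + 1 := by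
      refine (mul_le_of_le_one_left (by positivity) (probAbove_le_one l w e)).trans ?_
      have := mul_le_mul hb3 hsq (sq_nonneg e) zero_le_one
      nlinarith [sq_nonneg w, sq_nonneg e]
    have h4 : probMid l w e * ∫ z, (clip N (S (w + e * z)) - 0) ^ 2 ∂stdGauss ≤ Q := by
      refine (mul_le_of_le_one_left (integral_nonneg fun _ => sq_nonneg _)
        (probMid_le_one l w e)).trans (le_trans ?_ hQ)
      refine integral_mono_of_nonneg (ae_of_all _ fun _ => sq_nonneg _) hS2 (ae_of_all _ fun z => ?_)
      simp only [sub_zero]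
      exact sq_le_sq.mpr (abs_clip_le_abs hN.le _)
    linarith

end Core

/-! ### Explicit rates for the Hermite threshold estimator. -/

lemma continuous_sum_scaledHermite (m : ℕ) (a : ℕ → ℝ) (v : ℝ) :
    Continuous fun u => ∑ k ∈ Finset.range m, a k * scaledHermite k v u := by
  unfold scaledHermite
  fun_prop

lemma mul_exp_neg_le_one (t : ℝ) : t * Real.exp (-t) ≤ 1 := by
  rw [Real.exp_neg, ← div_eq_mul_inv, div_le_one (Real.exp_pos t)]
  linarith [Real.add_one_le_exp t]

set_option maxHeartbeats 1000000 in
/-- Bias and second moment of the threshold estimator with `N = exp ℓ`. -/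
lemma thresholdT_bounds {ε g b e ℓ β w : ℝ} {m : ℕ} (h0 : 0 ≤ β) (h1 : β ≤ 1)
    (hε : 0 < ε) (hg : ε ≤ g) (hb : 0 < b) (hgb : (g + b) ^ 2 ≤ 1 / (2 * Real.exp 1))
    (he : |e| ≤ b) (hℓ : 1 ≤ ℓ)
    (hm : m = ⌈Real.exp 1 ^ 2 * (g + b) ^ 2 * (2 * ℓ)⌉₊) :
    |∫ p : ℝ × ℝ, thresholdT (g * √(2 * ℓ)) β (Real.exp ℓ)
        (fun u => ∑ k ∈ Finset.range (m + 2), taylorCoeff β k * scaledHermite k (e ^ 2) u)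
        (w + e * p.1) (w + e * p.2) ∂(stdGauss.prod stdGauss) - G w β|
      ≤ 20 * (1 + ℓ) ^ 2 * Real.exp (-(ε ^ 2 / 4 * ℓ)) ∧
    ∃ c, ∫ p : ℝ × ℝ, (thresholdT (g * √(2 * ℓ)) β (Real.exp ℓ)
        (fun u => ∑ k ∈ Finset.range (m + 2), taylorCoeff β k * scaledHermite k (e ^ 2) u)
        (w + e * p.1) (w + e * p.2) - c) ^ 2 ∂(stdGauss.prod stdGauss)
      ≤ 20 * (1 + ℓ) ^ 2 * Real.exp (3 / 4 * ℓ) := by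
  have hE1 : 2.7 < Real.exp 1 := lt_trans (by norm_num) Real.exp_one_gt_d9
  have hE2 : Real.exp 1 < 2.72 := lt_trans Real.exp_one_lt_d9 (by norm_num)
  have hg0 : 0 < g := hε.trans_le hg
  have hℓ0 : 0 < ℓ := by linarith
  set s := √(2 * ℓ) with hs
  have hs0 : 0 < s := Real.sqrt_pos.mpr (by linarith)
  have hs2 : s ^ 2 = 2 * ℓ := Real.sq_sqrt (by linarith)
  have hgb2 : (g + b) ^ 2 ≤ 1 / 5 := hgb.trans (by
    rw [div_le_div_iff₀ (by positivity) (by norm_num)]; linarith)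
  have hg2 : g ^ 2 ≤ (g + b) ^ 2 := pow_le_pow_left₀ hg0.le (by linarith) 2
  have hb2 : b ^ 2 ≤ (g + b) ^ 2 := pow_le_pow_left₀ hb.le (by linarith) 2
  have hε2 : ε ^ 2 ≤ g ^ 2 := pow_le_pow_left₀ hε.le hg 2
  have he2 : e ^ 2 ≤ b ^ 2 := by rw [← sq_abs]; gcongr
  have he1 : |e| ≤ 1 := by
    rw [← abs_one, ← sq_le_sq]; linarith
  set S : ℝ → ℝ := fun u => ∑ k ∈ Finset.range (m + 2), taylorCoeff β k * scaledHermite k (e ^ 2) u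
    with hS
  have hScont : Continuous S := continuous_sum_scaledHermite _ _ _
  set l := g * s with hl
  have hl0 : 0 < l := mul_pos hg0 hs0
  have hl2 : l ^ 2 = g ^ 2 * (2 * ℓ) := by rw [hl, mul_pow, hs2]
  -- The cut between the two regimes of `w`. The factor `5/4` serves both sides: outside, `|w| - l ≥
  -- (5/4) b s` makes the wrong region have probability at most `exp(-25/16 ℓ)`, well below
  -- `exp(-ℓ)`; inside, `w²/(1-e²)` still stays below `3/4 ℓ`.
  set R := 5 / 4 * (g + b) * s with hR
  have hR0 : 0 < R := by positivity
  have hR2 : R ^ 2 = 25 / 16 * ((g + b) ^ 2 * (2 * ℓ)) := by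
    rw [hR, mul_pow, mul_pow, hs2]; ring
  have hPl : (g + b) ^ 2 * (2 * ℓ) ≤ 1 / 5 * (2 * ℓ) := by gcongr
  have hR2le : R ^ 2 ≤ ℓ := by rw [hR2]; linarith only [hPl, hℓ0]
  have hRle : R ≤ 1 + ℓ := by linarith only [sq_nonneg (R - 1), hR2le, hℓ0]
  have hlR : l ≤ R := mul_le_mul_of_nonneg_right (by linarith only [hg0, hb]) hs0.le
  have hsq1 : 1 + ℓ ≤ (1 + ℓ) ^ 2 := by linarith only [mul_pos hℓ0 hℓ0, hℓ0]
  have hsmall : ε ^ 2 / 4 * ℓ ≤ 1 / 20 * ℓ :=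
    mul_le_mul_of_nonneg_right (by linarith only [hε2, hg2, hgb2]) hℓ0.le
  have hεℓ : ε ^ 2 * ℓ ≤ g ^ 2 * ℓ := mul_le_mul_of_nonneg_right hε2 hℓ0.le
  set X := Real.exp (-(ε ^ 2 / 4 * ℓ)) with hX
  have hX0 : 0 < X := Real.exp_pos _
  have hexpX : ∀ t, t ≤ -(1 / 20 * ℓ) → Real.exp t ≤ X := fun t ht =>
    Real.exp_le_exp.mpr (by linarith)
  rcases le_or_gt |w| R with hw | hw
  · -- central region
    have hw2 : w ^ 2 ≤ R ^ 2 := by rw [← sq_abs]; gcongr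
    have hesq : e ^ 2 < 1 := by linarith
    obtain ⟨hS2, hSQ⟩ := integral_sum_scaledHermite_sq_le w e hesq (m + 2) (taylorCoeff β)
      (taylorCoeff_sq_mul_factorial_le h0 h1)
    have hS1 : Integrable (fun z => S (w + e * z)) stdGauss := by
      have hmeas : AEStronglyMeasurable (fun z => S (w + e * z)) stdGauss :=
        Continuous.aestronglyMeasurable (by fun_prop)
      exact ((memLp_two_iff_integrable_sq hmeas).mpr hS2).integrable one_le_two
    have hmean : ∫ z, S (w + e * z) ∂stdGauss
        = ∑ k ∈ Finset.range (m + 2), taylorCoeff β k * w ^ k :=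
      integral_sum_scaledHermite w e (m + 2) (taylorCoeff β)
    have hm1 : Real.exp 1 ^ 2 * (g + b) ^ 2 * (2 * ℓ) ≤ m := by rw [hm]; exact Nat.le_ceil _
    -- The number of Hermite terms is only of order `ℓ`, so its square is absorbed in `(1 + ℓ)²`.
    have hm2 : (m : ℝ) ≤ Real.exp 1 * ℓ + 1 := by
      rw [hm]
      refine (Nat.ceil_lt_add_one (by positivity)).le.trans ?_
      have : Real.exp 1 ^ 2 * (g + b) ^ 2 * (2 * ℓ)
          ≤ Real.exp 1 ^ 2 * (1 / (2 * Real.exp 1)) * (2 * ℓ) := by gcongr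
      have e1 : Real.exp 1 ^ 2 * (1 / (2 * Real.exp 1)) * (2 * ℓ) = Real.exp 1 * ℓ := by
        field_simp
      linarith
    have hT : |∫ z, S (w + e * z) ∂stdGauss - G w β| ≤ (1 + ℓ) * X := by
      rw [hmean]
      refine (abs_taylor_sub_G_le β m hw).trans ?_
      refine mul_le_mul (by linarith) (Real.exp_le_exp.mpr ?_) (Real.exp_pos _).le (by linarith)
      rw [hR2]
      have h3 : ε ^ 2 * (2 * ℓ) ≤ (g + b) ^ 2 * (2 * ℓ) := by
        have := hε2.trans hg2
        gcongr
      -- With `E = exp 1` and `P = (g+b)² * 2ℓ`, the Taylor exponent is at most `-(E/2) (E - 25/16)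
      -- P`. The factor `E²` in the order of the polynomial is what makes it negative.
      have h4 : 1 ≤ Real.exp 1 * (Real.exp 1 - 25 / 16) := by nlinarith only [hE1]
      have h5 : 0 ≤ (g + b) ^ 2 * (2 * ℓ) := by positivity
      have h6 := mul_le_mul_of_nonneg_right h4 h5
      have h7 : 0 ≤ ε ^ 2 * ℓ := by positivity
      linarith only [hm1, h3, h6, h7]
    have hQ : ∫ z, S (w + e * z) ^ 2 ∂stdGauss ≤ 9 * (1 + ℓ) ^ 2 * Real.exp (3 / 4 * ℓ) := by
      refine hSQ.trans ?_
      have h3 : w ^ 2 / (1 - e ^ 2) ≤ 3 / 4 * ℓ := by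
        rw [div_le_iff₀ (by linarith)]
        have hgb3 : (g + b) ^ 2 * (2 * Real.exp 1) ≤ 1 := by
          rwa [le_div_iff₀ (by positivity)] at hgb
        -- The earlier bound `1/5` is too weak here: what is needed is `(25/16) * 2 * 0.186 ≤ (3/4)
        -- * (1 - 0.186)`.
        have h4 : (g + b) ^ 2 ≤ 0.186 := by
          have : (g + b) ^ 2 * (2 * 2.7) ≤ (g + b) ^ 2 * (2 * Real.exp 1) := by gcongr
          linarith only [this, hgb3]
        have h5 : w ^ 2 ≤ 25 / 16 * (0.186 * (2 * ℓ)) := by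
          refine hw2.trans ?_
          rw [hR2]; gcongr
        have h6 : ℓ * e ^ 2 ≤ ℓ * 0.186 := by gcongr; linarith only [h4, he2, hb2]
        linarith only [h5, h6, hℓ0]
      have h4 : ((m + 2 : ℕ) : ℝ) ^ 2 ≤ 9 * (1 + ℓ) ^ 2 := by
        have : ((m + 2 : ℕ) : ℝ) ≤ 3 * (1 + ℓ) := by
          have h5 : Real.exp 1 * ℓ ≤ 2.72 * ℓ := by gcongr
          push_cast; linarith only [h5, hm2, hℓ0]
        calc ((m + 2 : ℕ) : ℝ) ^ 2 ≤ (3 * (1 + ℓ)) ^ 2 := by gcongr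
          _ = 9 * (1 + ℓ) ^ 2 := by ring
      gcongr
    obtain ⟨hA, c, hB⟩ := central_bounds (l := l) h0 h1 (Real.exp_pos ℓ) hScont he1 hl0.le hS1 hS2
      hT hQ
    refine ⟨hA.trans ?_, c, hB.trans ?_⟩
    · have h3 : Real.exp (-l ^ 2 / 8) ≤ X := by
        refine Real.exp_le_exp.mpr ?_
        rw [hl2]; linarith only [hεℓ]
      have h4 : 9 * (1 + ℓ) ^ 2 * Real.exp (3 / 4 * ℓ) / Real.exp ℓ ≤ 9 * (1 + ℓ) ^ 2 * X := by
        rw [mul_div_assoc, ← Real.exp_sub]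
        gcongr
        exact hexpX _ (by linarith)
      have h5 : (1 + |w|) * Real.exp (-l ^ 2 / 8) ≤ (2 * (1 + ℓ)) * X :=
        mul_le_mul (by linarith) h3 (Real.exp_pos _).le (by linarith)
      have h6 : (1 + ℓ) * X ≤ (1 + ℓ) ^ 2 * X := by gcongr
      have h7 : 0 < (1 + ℓ) ^ 2 * X := by positivity
      linarith only [h4, h5, h6, h7]
    · have h3 : 1 ≤ Real.exp (3 / 4 * ℓ) := Real.one_le_exp (by linarith)
      have h4 : (1 + ℓ) ^ 2 * 1 ≤ (1 + ℓ) ^ 2 * Real.exp (3 / 4 * ℓ) := by gcongr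
      linarith only [h4, hw2, hR2le, hsq1, hℓ0]
  · -- outer region
    set x := |w| - l with hx
    have hxR : 5 / 4 * b * s ≤ x := by
      have : 5 / 4 * (g + b) * s ≤ |w| := hw.le
      have h2 : 0 < g * s := hl0
      simp only [hx, hl]; linarith only [this, h2]
    have hx0 : 0 < x := lt_of_lt_of_le (by positivity) hxR
    set y2 := x ^ 2 / (2 * b ^ 2) with hy2
    have hy1 : 25 / 16 * ℓ ≤ y2 := by
      rw [hy2, le_div_iff₀ (by positivity)]
      have : (5 / 4 * b * s) ^ 2 ≤ x ^ 2 := by gcongr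
      rw [mul_pow, mul_pow, hs2] at this
      linarith
    have hy0 : 0 ≤ y2 := by linarith
    have hxy : x ^ 2 ≤ y2 := by
      rw [hy2, le_div_iff₀ (by positivity)]
      exact mul_le_of_le_one_right (sq_nonneg x) (by linarith only [hb2, hgb2])
    set q := Real.exp (-x ^ 2 / (2 * b ^ 2)) with hq
    have hqy : q = Real.exp (-y2) := by rw [hq, hy2, neg_div]
    have hq0 : 0 < q := Real.exp_pos _
    have hprob : probMid l w e ≤ q ∧
        ((0 ≤ w ∧ probBelow l w e ≤ q) ∨ (w ≤ 0 ∧ probAbove l w e ≤ q)) := by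
      rcases le_total 0 w with hw0 | hw0
      · have := probBelow_add_probMid_le (w := w) hl0.le hb he hx0.le
          (by rw [hx, abs_of_nonneg hw0])
        exact ⟨this.2, Or.inl ⟨hw0, this.1⟩⟩
      · have := probAbove_probMid_le (w := w) hl0.le hb he hx0.le
          (by rw [hx, abs_of_nonpos hw0])
        exact ⟨this.2, Or.inr ⟨hw0, this.1⟩⟩
    obtain ⟨hA, c, hB⟩ := far_bounds (l := l) h0 h1 (Real.exp_pos ℓ).le hScont
      (by linarith : e ^ 2 ≤ 1) hprob.1 hprob.2
    -- One half of the exponent absorbs the growth of `w²`, which is unbounded in this region; the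
    -- other half remains as decay.
    have hhalf : q = Real.exp (-(y2 / 2)) * Real.exp (-(y2 / 2)) := by
      rw [hqy, ← Real.exp_add]; congr 1; ring
    have hyq : y2 * q ≤ 2 * Real.exp (-(y2 / 2)) := by
      have := mul_exp_neg_le_one (y2 / 2)
      have h3 := Real.exp_pos (-(y2 / 2))
      have h4 := mul_le_mul_of_nonneg_right this h3.le
      rw [hhalf]; linarith only [h4]
    have hqN : q * Real.exp ℓ ≤ Real.exp (-(9 / 16 * ℓ)) := by
      rw [hqy, ← Real.exp_add]
      exact Real.exp_le_exp.mpr (by linarith)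
    have hqh : q ≤ Real.exp (-(y2 / 2)) := by
      rw [hqy]; exact Real.exp_le_exp.mpr (by linarith)
    have hhX : Real.exp (-(y2 / 2)) ≤ X := hexpX _ (by linarith)
    have hwx : |w| = x + l := by rw [hx]; ring
    have hqw2 : q * w ^ 2 ≤ 4 * Real.exp (-(y2 / 2)) + 2 * ℓ * q := by
      have h3 : w ^ 2 ≤ 2 * y2 + 2 * ℓ := by
        rw [← sq_abs, hwx]
        have hl3 : l ^ 2 ≤ ℓ := (pow_le_pow_left₀ hl0.le hlR 2).trans hR2le
        linarith only [sq_nonneg (x - l), hl3, hxy]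
      have h4 : q * w ^ 2 ≤ q * (2 * y2 + 2 * ℓ) := by gcongr
      linarith only [h4, hyq]
    have hqw : q * |w| ≤ 4 * Real.exp (-(y2 / 2)) + 2 * ℓ * q + q := by
      have h3 : |w| ≤ w ^ 2 + 1 := by
        rw [← sq_abs]; linarith only [sq_nonneg (|w| - 1), sq_nonneg (|w|)]
      have h4 : q * |w| ≤ q * (w ^ 2 + 1) := by gcongr
      linarith only [h4, hqw2]
    have hqX : q ≤ X := hqh.trans hhX
    refine ⟨hA.trans ?_, c, hB.trans ?_⟩
    · have h3 : Real.exp (-w ^ 2 / 2) ≤ X := by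
        refine Real.exp_le_exp.mpr ?_
        have : l ^ 2 ≤ w ^ 2 := by rw [← sq_abs w]; gcongr; linarith
        rw [hl2] at this
        have h7 : 0 ≤ ε ^ 2 * ℓ := by positivity
        linarith only [this, hεℓ, h7]
      have h4 : q * Real.exp ℓ ≤ X := hqN.trans (hexpX _ (by linarith))
      have h5 : 2 * ℓ * q ≤ 2 * ℓ * X := by gcongr
      have h6 : (1 + ℓ) * X ≤ (1 + ℓ) ^ 2 * X := by gcongr
      have h7 : 0 ≤ ℓ * X := by positivity
      linarith only [h3, h4, h5, h6, h7, hqw, hqX, hhX, hX0]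
    · have h3 : q * Real.exp ℓ ^ 2 ≤ Real.exp (3 / 4 * ℓ) := by
        rw [hqy, ← Real.exp_nat_mul, ← Real.exp_add]
        refine Real.exp_le_exp.mpr ?_
        push_cast; linarith
      have h4 : (Real.exp ℓ + |w|) ^ 2 ≤ 2 * Real.exp ℓ ^ 2 + 2 * w ^ 2 := by
        rw [← sq_abs w]
        linarith only [sq_nonneg (Real.exp ℓ - |w|)]
      have h5 : q * (Real.exp ℓ + |w|) ^ 2 ≤ q * (2 * Real.exp ℓ ^ 2 + 2 * w ^ 2) := by gcongr
      have h6 : 1 ≤ Real.exp (3 / 4 * ℓ) := Real.one_le_exp (by linarith)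
      have h7 : Real.exp (-(y2 / 2)) ≤ 1 := Real.exp_le_one_iff.mpr (by linarith)
      have h8 : 2 * ℓ * q ≤ 2 * ℓ * 1 := by
        gcongr
        exact hqh.trans h7
      have h9 : (1 + ℓ) ^ 2 * 1 ≤ (1 + ℓ) ^ 2 * Real.exp (3 / 4 * ℓ) := by gcongr
      have h10 : 1 * Real.exp (3 / 4 * ℓ) ≤ (1 + ℓ) ^ 2 * Real.exp (3 / 4 * ℓ) := by
        gcongr; linarith only [hsq1, hℓ]
      linarith only [h3, h5, h7, h8, h9, h10, hqw2, hsq1, hℓ0]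

/-! ### Averaging out a coordinate -/

section Average

variable {μ ν : Measure ℝ} [IsProbabilityMeasure μ] [IsProbabilityMeasure ν]

lemma sq_integral_le {g : ℝ → ℝ} (hg : MemLp g 2 ν) : (∫ z, g z ∂ν) ^ 2 ≤ ∫ z, g z ^ 2 ∂ν := by
  have h := variance_eq_sub hg
  have h0 := variance_nonneg g ν
  simp only [Pi.pow_apply] at h
  linarith

/-- Rao–Blackwell: integrating out the auxiliary variable keeps the mean and, by Jensen on each
fibre, does not increase the second moment about any constant. -/
lemma memLp_integral_right {f : ℝ × ℝ → ℝ} (hf : Measurable f) (h : MemLp f 2 (μ.prod ν)) :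
    MemLp (fun x => ∫ z, f (x, z) ∂ν) 2 μ ∧
    ∫ x, (∫ z, f (x, z) ∂ν) ∂μ = ∫ p, f p ∂(μ.prod ν) ∧
    ∀ c : ℝ, ∫ x, ((∫ z, f (x, z) ∂ν) - c) ^ 2 ∂μ ≤ ∫ p, (f p - c) ^ 2 ∂(μ.prod ν) := by
  have hsm : StronglyMeasurable fun x => ∫ z, f (x, z) ∂ν :=
    StronglyMeasurable.integral_prod_right (f := fun x z => f (x, z)) hf.stronglyMeasurable
  have hsub : ∀ c : ℝ, Integrable (fun p => (f p - c) ^ 2) (μ.prod ν) := fun c =>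
    (h.sub (memLp_const c)).integrable_sq
  have hae : ∀ c : ℝ, ∀ᵐ x ∂μ, ((∫ z, f (x, z) ∂ν) - c) ^ 2 ≤ ∫ z, (f (x, z) - c) ^ 2 ∂ν := by
    intro c
    filter_upwards [(hsub c).prod_right_ae] with x hx
    have hm : Measurable fun z => f (x, z) - c :=
      (hf.comp measurable_prodMk_left).sub_const c
    have hL : MemLp (fun z => f (x, z) - c) 2 ν :=
      (memLp_two_iff_integrable_sq hm.aestronglyMeasurable).mpr hx
    have hi : Integrable (fun z => f (x, z)) ν := by
      have := (hL.integrable one_le_two).add (integrable_const c)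
      refine this.congr (ae_of_all _ fun z => by simp)
    have := sq_integral_le hL
    rw [integral_sub hi (integrable_const c)] at this
    simpa using this
  have hmem : MemLp (fun x => ∫ z, f (x, z) ∂ν) 2 μ := by
    rw [memLp_two_iff_integrable_sq hsm.aestronglyMeasurable]
    refine ((hsub 0).integral_prod_left).mono' (hsm.pow 2).aestronglyMeasurable ?_
    filter_upwards [hae 0] with x hx
    rw [sub_zero] at hx
    rwa [Real.norm_eq_abs, abs_of_nonneg (sq_nonneg _)]
  refine ⟨hmem, (integral_prod f (h.integrable one_le_two)).symm, fun c => ?_⟩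
  rw [integral_prod _ (hsub c)]
  exact integral_mono_ae (hmem.sub (memLp_const c)).integrable_sq (hsub c).integral_prod_left
    (hae c)

end Average

/-- `E |n⁻¹ ∑ D_i|` for independent `D_i` with small means and bounded second moments. -/
lemma integral_abs_mean_le {n : ℕ} (hn : 0 < n) (μ : Fin n → Measure ℝ)
    [∀ i, IsProbabilityMeasure (μ i)] (D : Fin n → ℝ → ℝ) (hD : ∀ i, MemLp (D i) 2 (μ i))
    {B W : ℝ} (hB : ∀ i, |∫ x, D i x ∂(μ i)| ≤ B) (hW : ∀ i, Var[D i; μ i] ≤ W) :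
    Integrable (fun x : Fin n → ℝ => |1 / (n : ℝ) * ∑ i, D i (x i)|) (Measure.pi μ) ∧
    ∫ x, |1 / (n : ℝ) * ∑ i, D i (x i)| ∂(Measure.pi μ) ≤ √(W / n) + B := by
  have hn0 : (0 : ℝ) < n := by exact_mod_cast hn
  have hmem : ∀ i, MemLp (fun x : Fin n → ℝ => D i (x i)) 2 (Measure.pi μ) := fun i =>
    (hD i).comp_measurePreserving (measurePreserving_eval μ i)
  have hY : MemLp (fun x : Fin n → ℝ => 1 / (n : ℝ) * ∑ i, D i (x i)) 2 (Measure.pi μ) :=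
    (memLp_finsetSum _ fun i _ => hmem i).const_mul _
  set Y : (Fin n → ℝ) → ℝ := fun x => 1 / (n : ℝ) * ∑ i, D i (x i) with hYdef
  have hvar : Var[Y; Measure.pi μ] ≤ W / n := by
    have h1 : Var[Y; Measure.pi μ] = (1 / (n : ℝ)) ^ 2 * ∑ i, Var[D i; μ i] := by
      rw [hYdef, variance_const_mul, ← variance_sum_pi hD]
      congr 2
      ext x; simp
    rw [h1]
    calc (1 / (n : ℝ)) ^ 2 * ∑ i, Var[D i; μ i] ≤ (1 / (n : ℝ)) ^ 2 * ∑ _i : Fin n, W := by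
          gcongr with i; exact hW i
      _ = W / n := by simp; field_simp
  have hmean : |∫ x, Y x ∂(Measure.pi μ)| ≤ B := by
    have hint : ∀ i, Integrable (fun x : Fin n → ℝ => D i (x i)) (Measure.pi μ) := fun i =>
      (hmem i).integrable one_le_two
    rw [hYdef, integral_const_mul, integral_finsetSum _ fun i _ => hint i]
    have : ∀ i, ∫ x : Fin n → ℝ, D i (x i) ∂(Measure.pi μ) = ∫ x, D i x ∂(μ i) := fun i =>
      integral_comp_eval (hD i).1
    simp_rw [this]
    rw [abs_mul, abs_of_pos (by positivity)]
    calc 1 / (n : ℝ) * |∑ i, ∫ x, D i x ∂(μ i)| ≤ 1 / (n : ℝ) * ∑ _i : Fin n, B := by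
          gcongr
          exact (Finset.abs_sum_le_sum_abs _ _).trans (Finset.sum_le_sum fun i _ => hB i)
      _ = B := by simp; field_simp
  have hYi : Integrable Y (Measure.pi μ) := hY.integrable one_le_two
  refine ⟨hYi.abs, ?_⟩
  set m := ∫ x, Y x ∂(Measure.pi μ) with hm
  -- Cauchy–Schwarz, in the form that `|Y - m|` has nonnegative variance.
  have h2 : (∫ x, |Y x - m| ∂(Measure.pi μ)) ^ 2 ≤ W / n := by
    have hL : MemLp (fun x => |Y x - m|) 2 (Measure.pi μ) := (hY.sub (memLp_const m)).abs
    have h := variance_eq_sub hL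
    have h0 := variance_nonneg (fun x => |Y x - m|) (Measure.pi μ)
    simp only [Pi.pow_apply, sq_abs] at h
    rw [← variance_eq_integral hY.1.aemeasurable] at h
    linarith
  have h3 : ∫ x, |Y x - m| ∂(Measure.pi μ) ≤ √(W / n) := Real.le_sqrt_of_sq_le h2
  calc ∫ x, |Y x| ∂(Measure.pi μ) ≤ ∫ x, (|Y x - m| + |m|) ∂(Measure.pi μ) := by
        refine integral_mono hYi.abs ((hYi.sub (integrable_const m)).abs.add (integrable_const _))
          fun x => ?_
        simpa using abs_add_le (Y x - m) m
    _ = ∫ x, |Y x - m| ∂(Measure.pi μ) + |m| := by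
        have : Integrable (fun x => |Y x - m|) (Measure.pi μ) :=
          (hYi.sub (integrable_const m)).abs
        rw [integral_add this (integrable_const _)]
        simp
    _ ≤ √(W / n) + B := add_le_add h3 hmean

lemma measurePreserving_gaussianReal (t : ℝ) {v : ℝ} (hv : 0 ≤ v) :
    MeasurePreserving (fun x => t + √v * x) stdGauss (gaussianReal t v.toNNReal) := by
  refine ⟨by fun_prop, ?_⟩
  have h1 : (fun x => t + √v * x) = (fun x => t + x) ∘ (fun x => √v * x) := rfl
  rw [h1, ← Measure.map_map (by fun_prop) (by fun_prop), gaussianReal_map_const_mul,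
    gaussianReal_map_const_add]
  congr 1
  · simp
  · ext
    simp [Real.sq_sqrt hv, Real.coe_toNNReal _ hv]

/-! ### The check loss -/

/-- The check loss with weights `b`, `h`. -/
def checkFun (b h u : ℝ) : ℝ := b * max u 0 + h * max (-u) 0

lemma continuous_checkFun (b h : ℝ) : Continuous (checkFun b h) := by
  unfold checkFun; fun_prop

lemma checkFun_nonneg {b h : ℝ} (hb : 0 ≤ b) (hh : 0 ≤ h) (u : ℝ) : 0 ≤ checkFun b h u :=
  add_nonneg (mul_nonneg hb (le_max_right _ _)) (mul_nonneg hh (le_max_right _ _))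

lemma abs_checkFun_sub_le {b h : ℝ} (hb : 0 ≤ b) (hh : 0 ≤ h) (u v : ℝ) :
    |checkFun b h u - checkFun b h v| ≤ (b + h) * |u - v| := by
  have h1 : |max u 0 - max v 0| ≤ |u - v| := abs_max_sub_max_le_abs u v 0
  have h2 : |max (-u) 0 - max (-v) 0| ≤ |u - v| := by
    have := abs_max_sub_max_le_abs (-u) (-v) 0
    rwa [neg_sub_neg, abs_sub_comm v u] at this
  calc |checkFun b h u - checkFun b h v|
      = |b * (max u 0 - max v 0) + h * (max (-u) 0 - max (-v) 0)| := by
        unfold checkFun; congr 1; ring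
    _ ≤ b * |max u 0 - max v 0| + h * |max (-u) 0 - max (-v) 0| := by
        refine (abs_add_le _ _).trans ?_
        rw [abs_mul, abs_mul, abs_of_nonneg hb, abs_of_nonneg hh]
    _ ≤ (b + h) * |u - v| := by rw [add_mul]; gcongr

lemma integrable_checkFun {μ : Measure ℝ} [IsFiniteMeasure μ] (hμ : Integrable (fun x => x) μ)
    (b h : ℝ) (q : ℝ) : Integrable (fun y => checkFun b h (y - q)) μ := by
  have h1 : Integrable (fun y => y - q) μ := hμ.sub (integrable_const q)
  exact (h1.pos_part.const_mul b).add (h1.neg_part.const_mul h)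

lemma integrable_id_gaussianReal (t : ℝ) (v : NNReal) : Integrable (fun x => x) (gaussianReal t v) :=
  (memLp_id_gaussianReal 1).integrable le_rfl

/-- Expected check loss under a normal law. -/
lemma integral_checkFun_gaussianReal {b h t v : ℝ} (hbh : b + h ≠ 0) (hv : 0 < v) (q : ℝ) :
    ∫ y, checkFun b h (y - q) ∂(gaussianReal t v.toNNReal)
      = (b + h) * √v * G ((q - t) / √v) (b / (b + h)) := by
  have hs : 0 < √v := Real.sqrt_pos.mpr hv
  have hmp := measurePreserving_gaussianReal t hv.le
  have hc : Continuous fun y => checkFun b h (y - q) :=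
    (continuous_checkFun b h).comp (continuous_id.sub continuous_const)
  rw [← hmp.map_eq, integral_map hmp.measurable.aemeasurable hc.aestronglyMeasurable]
  set w := (q - t) / √v with hw
  have hq : q = t + √v * w := by rw [hw]; field_simp; ring
  have h1 : ∀ x, checkFun b h (t + √v * x - q)
      = √v * (b * max (x - w) 0 + h * max (w - x) 0) := by
    intro x
    have e1 : t + √v * x - q = √v * (x - w) := by rw [hq]; ring
    have e2 : -(t + √v * x - q) = √v * (w - x) := by rw [hq]; ring
    rw [checkFun, e2, e1]
    have e3 : ∀ y : ℝ, max (√v * y) 0 = √v * max y 0 := fun y => by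
      rw [mul_max_of_nonneg _ _ hs.le, mul_zero]
    rw [e3, e3]; ring
  simp_rw [h1]
  have i1 : Integrable (fun x : ℝ => max (x - w) 0) stdGauss :=
    (integrable_id_stdGauss.sub (integrable_const w)).pos_part
  rw [integral_const_mul, integral_add (i1.const_mul b)
    ((integrable_posPart_stdGauss w).const_mul h), integral_const_mul, integral_const_mul,
    integral_posPart_stdGauss, integral_negPart_stdGauss, G_eq]
  field_simp
  ring

namespace Model

variable {M : Model}

/-- All constants of the model are positive. -/
structure Positive (M : Model) : Prop where
  b : ∀ i, 0 < M.b i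
  h : ∀ i, 0 < M.h i
  sigmaP : ∀ i, 0 < M.sigmaP i
  sigmaF : ∀ i, 0 < M.sigmaF i

lemma coordLoss_eq (i : ℕ) (t q : ℝ) : M.coordLoss i t q
    = ∫ y, checkFun (M.b i) (M.h i) (y - q) ∂(gaussianReal t (M.sigmaF i).toNNReal) := by
  simp [coordLoss, checkFun]

lemma coordLoss_nonneg (hM : M.Positive) (i : ℕ) (t q : ℝ) : 0 ≤ M.coordLoss i t q := by
  rw [coordLoss_eq]
  exact integral_nonneg fun y => checkFun_nonneg (hM.b i).le (hM.h i).le _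

lemma abs_coordLoss_sub_le (hM : M.Positive) (i : ℕ) (t q q' : ℝ) :
    |M.coordLoss i t q - M.coordLoss i t q'| ≤ (M.b i + M.h i) * |q - q'| := by
  have hi := integrable_id_gaussianReal t (M.sigmaF i).toNNReal
  rw [coordLoss_eq, coordLoss_eq, ← integral_sub (integrable_checkFun hi _ _ _)
    (integrable_checkFun hi _ _ _)]
  refine abs_integral_le_integral_abs.trans ?_
  calc _ ≤ ∫ _, (M.b i + M.h i) * |q - q'| ∂(gaussianReal t (M.sigmaF i).toNNReal) := by
        refine integral_mono ((integrable_checkFun hi _ _ _).sub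
          (integrable_checkFun hi _ _ _)).abs (integrable_const _) fun y => ?_
        refine (abs_checkFun_sub_le (hM.b i).le (hM.h i).le _ _).trans (le_of_eq ?_)
        rw [sub_sub_sub_cancel_left, abs_sub_comm]
    _ = _ := by simp

lemma continuous_coordLoss (hM : M.Positive) (i : ℕ) (t : ℝ) : Continuous (M.coordLoss i t) := by
  have h : LipschitzWith (M.b i + M.h i).toNNReal (M.coordLoss i t) := by
    refine LipschitzWith.of_dist_le_mul fun x y => ?_
    rw [Real.dist_eq, Real.dist_eq, Real.coe_toNNReal _ (add_pos (hM.b i) (hM.h i)).le]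
    exact abs_coordLoss_sub_le hM i t x y
  exact h.continuous

lemma alpha_nonneg (hM : M.Positive) (i : ℕ) (τ : ℝ≥0∞) : 0 ≤ M.alpha i τ := by
  unfold alpha
  split_ifs
  · exact zero_le_one
  · have := (hM.sigmaP i).le
    positivity

lemma alpha_le_one (hM : M.Positive) (i : ℕ) (τ : ℝ≥0∞) : M.alpha i τ ≤ 1 := by
  unfold alpha
  split_ifs
  · exact le_rfl
  · have := hM.sigmaP i
    have h0 : 0 ≤ τ.toReal := ENNReal.toReal_nonneg
    rw [div_le_one (by positivity)]
    linarith

/-- The law of the past observation of coordinate `i`. -/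
abbrev coordLaw (M : Model) (θ : ℕ → ℝ) (i : ℕ) : Measure ℝ :=
  gaussianReal (θ i) (M.sigmaP i).toNNReal

/-- Expected loss of an affine predictor. -/
lemma integral_coordLoss_affine (hM : M.Positive) (θ : ℕ → ℝ) (i : ℕ) (a k : ℝ) :
    ∫ x, M.coordLoss i (θ i) (a * x + k) ∂(M.coordLaw θ i)
      = (M.b i + M.h i) * √(M.sigmaF i + M.sigmaP i * a ^ 2)
        * G ((a * θ i + k - θ i) / √(M.sigmaF i + M.sigmaP i * a ^ 2)) (M.ratio i) := by
  have hP := (hM.sigmaP i).le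
  have hF := (hM.sigmaF i).le
  -- The loss of `a X + k` depends only on `Y - a X`, a Gaussian of variance `σ_f + a² σ_p`. So past
  -- and future noise merge into one check loss at the level `k`.
  have hlaw : (M.coordLaw θ i).map (fun x => -a * x) ∗ gaussianReal (θ i) (M.sigmaF i).toNNReal
      = gaussianReal (θ i - a * θ i) (M.sigmaF i + M.sigmaP i * a ^ 2).toNNReal := by
    rw [gaussianReal_map_const_mul, gaussianReal_conv_gaussianReal]
    congr 1
    · ring
    · ext
      rw [Real.coe_toNNReal _ (by positivity)]
      simp [Real.coe_toNNReal _ hP, Real.coe_toNNReal _ hF]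
      ring
  have hpos : 0 < M.sigmaF i + M.sigmaP i * a ^ 2 := by
    have := hM.sigmaF i
    positivity
  have h := integral_checkFun_gaussianReal (b := M.b i) (h := M.h i) (t := θ i - a * θ i)
    (add_pos (hM.b i) (hM.h i)).ne' hpos k
  rw [← hlaw, integral_conv (by
    rw [hlaw]; exact integrable_checkFun (integrable_id_gaussianReal _ _) _ _ _),
    integral_map (by fun_prop)] at h
  · rw [show (k - (θ i - a * θ i)) = a * θ i + k - θ i by ring] at h
    rw [ratio, ← h]
    congr 1
    ext x
    rw [coordLoss_eq]
    congr 1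
    ext y
    congr 1
    ring
  · have hc : Continuous fun z : ℝ × ℝ => checkFun (M.b i) (M.h i) (z.1 + z.2 - k) :=
      (continuous_checkFun _ _).comp (by fun_prop)
    exact (StronglyMeasurable.integral_prod_right
      (f := fun x y => checkFun (M.b i) (M.h i) (x + y - k)) hc.stronglyMeasurable).aestronglyMeasurable

/-- The location parameter `c_i(τ) + d_i(τ) θ_i`. -/
def center (M : Model) (θ : ℕ → ℝ) (i : ℕ) (τ : ℝ≥0∞) : ℝ := M.c i τ + M.d i τ * θ i

/-- This explains `c`, `d` and the weights of `ARE`: standardizing the predictor's error gives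
exactly `c + d θ`, so only `G` at that point has to be estimated. -/
lemma integral_coordLoss_predictor (hM : M.Positive) (θ : ℕ → ℝ) (i : ℕ) (τ : ℝ≥0∞) :
    ∫ x, M.coordLoss i (θ i) (M.alpha i τ * x
        + √(M.sigmaF i + M.alpha i τ * M.sigmaP i) * stdQuantile (M.ratio i)) ∂(M.coordLaw θ i)
      = (M.b i + M.h i) * √(M.sigmaF i + M.sigmaP i * M.alpha i τ ^ 2)
        * G (M.center θ i τ) (M.ratio i) := by
  rw [integral_coordLoss_affine hM]
  congr 2
  have hF := hM.sigmaF i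
  have hP := hM.sigmaP i
  have ha := alpha_nonneg hM i τ
  rw [center, c, d, Real.sqrt_div (by positivity), mul_comm (M.alpha i τ ^ 2)]
  have hs : √(M.sigmaF i + M.sigmaP i * M.alpha i τ ^ 2) ≠ 0 :=
    (Real.sqrt_pos.mpr (by positivity)).ne'
  field_simp
  ring

lemma integrable_id_sub_sq_coordLaw (hM : M.Positive) (θ : ℕ → ℝ) (i : ℕ) :
    Integrable (fun x => (x - θ i) ^ 2) (M.coordLaw θ i) ∧
    ∫ x, (x - θ i) ^ 2 ∂(M.coordLaw θ i) = M.sigmaP i := by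
  have hL : MemLp (fun x : ℝ => x - θ i) 2 (M.coordLaw θ i) :=
    (memLp_id_gaussianReal' 2 (by simp)).sub (memLp_const (θ i))
  refine ⟨hL.integrable_sq, ?_⟩
  have h := variance_fun_id_gaussianReal (μ := θ i) (v := (M.sigmaP i).toNNReal)
  rw [variance_eq_integral (by fun_prop), integral_id_gaussianReal,
    Real.coe_toNNReal _ (hM.sigmaP i).le] at h
  exact h

/-- Comparison with the loss at `X = θ` through the Lipschitz bound makes the second moment
independent of `θ`, although the loss itself is not bounded in `θ`. -/
lemma coordLoss_predictor_moment (hM : M.Positive) (θ : ℕ → ℝ) (i : ℕ) {a : ℝ} (h0 : 0 ≤ a)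
    (h1 : a ≤ 1) (k : ℝ) :
    MemLp (fun x => M.coordLoss i (θ i) (a * x + k)) 2 (M.coordLaw θ i) ∧
    ∫ x, (M.coordLoss i (θ i) (a * x + k) - M.coordLoss i (θ i) (a * θ i + k)) ^ 2
      ∂(M.coordLaw θ i) ≤ (M.b i + M.h i) ^ 2 * M.sigmaP i := by
  have hc : Continuous fun x => M.coordLoss i (θ i) (a * x + k) :=
    (continuous_coordLoss hM i (θ i)).comp (by fun_prop)
  have hbh := add_pos (hM.b i) (hM.h i)
  have hle : ∀ x, (M.coordLoss i (θ i) (a * x + k) - M.coordLoss i (θ i) (a * θ i + k)) ^ 2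
      ≤ (M.b i + M.h i) ^ 2 * (x - θ i) ^ 2 := by
    intro x
    have := abs_coordLoss_sub_le hM i (θ i) (a * x + k) (a * θ i + k)
    rw [← sq_abs, ← sq_abs (x - θ i), ← mul_pow]
    gcongr
    refine this.trans (mul_le_mul_of_nonneg_left ?_ hbh.le)
    rw [show a * x + k - (a * θ i + k) = a * (x - θ i) by ring, abs_mul, abs_of_nonneg h0]
    exact mul_le_of_le_one_left (abs_nonneg _) h1
  obtain ⟨hi, hv⟩ := integrable_id_sub_sq_coordLaw hM θ i
  have hint : Integrable (fun x => (M.coordLoss i (θ i) (a * x + k)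
      - M.coordLoss i (θ i) (a * θ i + k)) ^ 2) (M.coordLaw θ i) := by
    refine (hi.const_mul ((M.b i + M.h i) ^ 2)).mono'
      ((hc.sub continuous_const).pow 2).aestronglyMeasurable (ae_of_all _ fun x => ?_)
    rw [Real.norm_eq_abs, abs_of_nonneg (sq_nonneg _)]
    exact hle x
  constructor
  · have h2 : MemLp (fun x => M.coordLoss i (θ i) (a * x + k)
        - M.coordLoss i (θ i) (a * θ i + k)) 2 (M.coordLaw θ i) :=
      (memLp_two_iff_integrable_sq (hc.sub continuous_const).aestronglyMeasurable).mpr hint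
    have := h2.add (memLp_const (M.coordLoss i (θ i) (a * θ i + k)))
    refine this.ae_eq (ae_of_all _ fun x => by simp)
  · refine (integral_mono hint (hi.const_mul _) hle).trans ?_
    rw [integral_const_mul, hv]

end Model

/-! ### Bias and variance of the risk estimate in the model. -/

namespace Model

variable {M : Model}

lemma measurable_thresholdT {l β N : ℝ} {S : ℝ → ℝ} (hS : Continuous S) :
    Measurable fun p : ℝ × ℝ => thresholdT l β N S p.1 p.2 := by
  unfold thresholdT threeWay clip
  refine Measurable.ite (measurableSet_lt (by fun_prop) (by fun_prop)) (by fun_prop)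
    (Measurable.ite (measurableSet_le (by fun_prop) (by fun_prop)) ?_ (by fun_prop))
  have := hS.measurable
  fun_prop

/-- The slope of `U` in the standardized variable. -/
def slope (M : Model) (i : ℕ) (τ : ℝ≥0∞) : ℝ := M.d i τ * √(2 * M.sigmaP i)

lemma slope_sq (hM : M.Positive) (i : ℕ) (τ : ℝ≥0∞) :
    M.slope i τ ^ 2 = 2 * M.sigmaP i * M.d i τ ^ 2 := by
  rw [slope, mul_pow, Real.sq_sqrt (by have := hM.sigmaP i; positivity)]
  ring

lemma randomizedT_eq (hM : M.Positive) (γ : ℕ → ℝ) (n i : ℕ) (τ : ℝ≥0∞) (x z : ℝ) :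
    M.randomizedT γ n i τ x z
      = thresholdT (threshold γ n i) (M.ratio i) n
        (fun u => ∑ k ∈ Finset.range (M.order γ n i - 1 + 2),
          taylorCoeff (M.ratio i) k * scaledHermite k (M.slope i τ ^ 2) u)
        (M.c i τ + M.d i τ * (x + √(M.sigmaP i) * z))
        (M.c i τ + M.d i τ * (x - √(M.sigmaP i) * z)) := by
  simp only [randomizedT, thresholdT, threeWay, truncatedEstimate, hermiteEstimate_eq, clip,
    slope_sq hM]

lemma measurable_randomizedT (hM : M.Positive) (γ : ℕ → ℝ) (n i : ℕ) (τ : ℝ≥0∞) :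
    Measurable fun p : ℝ × ℝ => M.randomizedT γ n i τ p.1 p.2 := by
  simp_rw [randomizedT_eq hM]
  exact (measurable_thresholdT (continuous_sum_scaledHermite _ _ _)).comp
    (f := fun p : ℝ × ℝ => (M.c i τ + M.d i τ * (p.1 + √(M.sigmaP i) * p.2),
      M.c i τ + M.d i τ * (p.1 - √(M.sigmaP i) * p.2))) (by fun_prop)

/-- The randomized estimate, in rotated standard coordinates. -/
lemma randomizedT_standardized (hM : M.Positive) (γ : ℕ → ℝ) (n i : ℕ) (τ : ℝ≥0∞) (θ : ℕ → ℝ)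
    (p : ℝ × ℝ) :
    M.randomizedT γ n i τ (θ i + √(M.sigmaP i) * p.1) p.2
      = thresholdT (threshold γ n i) (M.ratio i) n
        (fun u => ∑ k ∈ Finset.range (M.order γ n i - 1 + 2),
          taylorCoeff (M.ratio i) k * scaledHermite k (M.slope i τ ^ 2) u)
        (M.center θ i τ + M.slope i τ * ((p.1 + p.2) / √2))
        (M.center θ i τ + M.slope i τ * ((p.1 - p.2) / √2)) := by
  have h2 : √2 ≠ 0 := (Real.sqrt_pos.mpr two_pos).ne'
  -- Adding the noise doubles the variance of the observation; `slope` carries the `√2` that the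
  -- normalized rotation divides out.
  have hs : ∀ y : ℝ, M.slope i τ * (y / √2) = M.d i τ * (√(M.sigmaP i) * y) := by
    intro y
    rw [slope, Real.sqrt_mul zero_le_two]
    field_simp
  rw [randomizedT_eq hM, hs, hs, center]
  congr 1 <;> ring

/-- Standardizing the observation and rotating the pair makes `U` and `V` independent with common
mean `center` and standard deviation `|slope|`; averaging over the noise is then the Rao–Blackwell
step. -/
lemma coordT_moments (hM : M.Positive) (γ : ℕ → ℝ) (n i : ℕ) (τ : ℝ≥0∞) (θ : ℕ → ℝ) :
    let F : ℝ × ℝ → ℝ := fun p => thresholdT (threshold γ n i) (M.ratio i) n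
        (fun u => ∑ k ∈ Finset.range (M.order γ n i - 1 + 2),
          taylorCoeff (M.ratio i) k * scaledHermite k (M.slope i τ ^ 2) u)
        (M.center θ i τ + M.slope i τ * p.1) (M.center θ i τ + M.slope i τ * p.2)
    MemLp (M.coordT γ n i τ) 2 (M.coordLaw θ i) ∧
    ∫ x, M.coordT γ n i τ x ∂(M.coordLaw θ i) = ∫ p, F p ∂(stdGauss.prod stdGauss) ∧
    ∀ c : ℝ, ∫ x, (M.coordT γ n i τ x - c) ^ 2 ∂(M.coordLaw θ i)
      ≤ ∫ p, (F p - c) ^ 2 ∂(stdGauss.prod stdGauss) := by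
  intro F
  have hScont := continuous_sum_scaledHermite (M.order γ n i - 1 + 2)
    (taylorCoeff (M.ratio i)) (M.slope i τ ^ 2)
  have hF1 : Integrable F (stdGauss.prod stdGauss) :=
    (integrable_thresholdT (Nat.cast_nonneg n) hScont).1
  have hF2 : ∀ c, Integrable (fun p => (F p - c) ^ 2) (stdGauss.prod stdGauss) := fun c =>
    (integral_thresholdT_sub_sq (Nat.cast_nonneg n) hScont c).1
  set f : ℝ × ℝ → ℝ := fun p => M.randomizedT γ n i τ (θ i + √(M.sigmaP i) * p.1) p.2 with hf
  have hfF : f = fun p : ℝ × ℝ => F ((p.1 + p.2) / √2, (p.1 - p.2) / √2) := by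
    ext p
    exact randomizedT_standardized hM γ n i τ θ p
  have hfm : Measurable f := (measurable_randomizedT hM γ n i τ).comp
    (f := fun p : ℝ × ℝ => (θ i + √(M.sigmaP i) * p.1, p.2)) (by fun_prop)
  have hf1 := integral_rotate_stdGauss hF1
  have hf2 := fun c => integral_rotate_stdGauss (hF2 c)
  have hfL : MemLp f 2 (stdGauss.prod stdGauss) := by
    rw [memLp_two_iff_integrable_sq hfm.aestronglyMeasurable, hfF]
    simpa using (hf2 0).1
  obtain ⟨hm, hmean, hsq⟩ := memLp_integral_right hfm hfL
  have hmp := measurePreserving_gaussianReal (θ i) (hM.sigmaP i).le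
  have hsm : StronglyMeasurable (M.coordT γ n i τ) :=
    StronglyMeasurable.integral_prod_right (f := fun x z => M.randomizedT γ n i τ x z)
      (measurable_randomizedT hM γ n i τ).stronglyMeasurable
  have hcomp : (fun x => ∫ z, f (x, z) ∂stdGauss)
      = M.coordT γ n i τ ∘ fun x => θ i + √(M.sigmaP i) * x := rfl
  refine ⟨?_, ?_, fun c => ?_⟩
  · rw [coordLaw, ← hmp.map_eq, memLp_map_measure_iff hsm.aestronglyMeasurable
      hmp.measurable.aemeasurable, ← hcomp]
    exact hm
  · rw [coordLaw, ← hmp.map_eq, integral_map hmp.measurable.aemeasurable hsm.aestronglyMeasurable]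
    refine Eq.trans hmean ?_
    rw [hfF]
    exact hf1.2
  · have hsm2 : StronglyMeasurable fun x => (M.coordT γ n i τ x - c) ^ 2 :=
      (hsm.sub stronglyMeasurable_const).pow 2
    rw [coordLaw, ← hmp.map_eq, integral_map hmp.measurable.aemeasurable hsm2.aestronglyMeasurable]
    refine (hsq c).trans (le_of_eq ?_)
    rw [hfF]
    exact (hf2 c).2

lemma ratio_nonneg (hM : M.Positive) (i : ℕ) : 0 ≤ M.ratio i :=
  (div_pos (hM.b i) (add_pos (hM.b i) (hM.h i))).le

lemma ratio_le_one (hM : M.Positive) (i : ℕ) : M.ratio i ≤ 1 := by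
  rw [ratio, div_le_one (add_pos (hM.b i) (hM.h i))]
  linarith [hM.h i]

/-- Both the numerator and the denominator of `d` are at their worst at `α = 0`, which makes the
bound uniform in `τ`. -/
lemma abs_slope_le (hM : M.Positive) (i : ℕ) (τ : ℝ≥0∞) :
    |M.slope i τ| ≤ √(2 * M.sigmaP i / M.sigmaF i) := by
  apply Real.abs_le_sqrt
  have hF := hM.sigmaF i
  have hP := hM.sigmaP i
  have h0 := alpha_nonneg hM i τ
  have h1 := alpha_le_one hM i τ
  rw [slope_sq hM, d, neg_sq, div_pow, Real.sq_sqrt (by positivity), ← mul_div_assoc]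
  apply div_le_div₀ (by positivity) _ hF
  · have : 0 ≤ M.sigmaP i * M.alpha i τ ^ 2 := by positivity
    linarith
  · refine mul_le_of_le_one_right (by positivity) (pow_le_one₀ (by linarith) (by linarith))

/-- Here the upper bound on `γ` enters: since `g ≤ √2 g`, the doubled variance costs at most a
factor `2` in the square. -/
lemma sq_add_sqrt_le {g r : ℝ} (hg : 0 ≤ g) (hr : 0 ≤ r)
    (h : g < 1 / √(4 * Real.exp 1) - √r) :
    (g + √(2 * r)) ^ 2 ≤ 1 / (2 * Real.exp 1) := by
  have hE := Real.exp_pos 1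
  have hs : √r ^ 2 = r := Real.sq_sqrt hr
  have h2 : √2 ^ 2 = 2 := Real.sq_sqrt zero_le_two
  have hle : 1 ≤ √2 := Real.one_le_sqrt.mpr one_le_two
  have h3 : g + √r ≤ 1 / √(4 * Real.exp 1) := by linarith
  have h4 : (g + √r) ^ 2 ≤ 1 / (4 * Real.exp 1) := by
    have := pow_le_pow_left₀ (by positivity) h3 2
    rwa [div_pow, one_pow, Real.sq_sqrt (by positivity)] at this
  have h5 : g + √(2 * r) ≤ √2 * (g + √r) := by
    rw [Real.sqrt_mul zero_le_two, mul_add]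
    have := mul_le_mul_of_nonneg_right hle hg
    linarith
  calc (g + √(2 * r)) ^ 2 ≤ (√2 * (g + √r)) ^ 2 := by gcongr
    _ = 2 * (g + √r) ^ 2 := by rw [mul_pow, h2]
    _ ≤ 2 * (1 / (4 * Real.exp 1)) := by gcongr
    _ = 1 / (2 * Real.exp 1) := by field_simp; ring

/-- Bias and variability of the coordinatewise estimate, uniformly in `τ`, `θ` and `i`. -/
lemma coordT_bounds (hM : M.Positive) {γ : ℕ → ℝ}
    (hγ : ∀ i, γ i < 1 / √(4 * Real.exp 1) - √(M.sigmaP i / M.sigmaF i))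
    {ε : ℝ} (hε : 0 < ε) (hγε : ∀ i, ε ≤ γ i) {n : ℕ} (hn : 1 ≤ Real.log n) (i : ℕ) (τ : ℝ≥0∞)
    (θ : ℕ → ℝ) :
    |∫ x, M.coordT γ n i τ x ∂(M.coordLaw θ i) - G (M.center θ i τ) (M.ratio i)|
      ≤ 20 * (1 + Real.log n) ^ 2 * Real.exp (-(ε ^ 2 / 4 * Real.log n)) ∧
    ∃ c, ∫ x, (M.coordT γ n i τ x - c) ^ 2 ∂(M.coordLaw θ i)
      ≤ 20 * (1 + Real.log n) ^ 2 * Real.exp (3 / 4 * Real.log n) := by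
  have hF := hM.sigmaF i
  have hP := hM.sigmaP i
  have hn0 : (0 : ℝ) < n := by
    rcases Nat.eq_zero_or_pos n with rfl | h
    · simp at hn; linarith
    · exact_mod_cast h
  have hgb := sq_add_sqrt_le (hε.le.trans (hγε i)) (by positivity) (hγ i)
  rw [← mul_div_assoc] at hgb
  -- `order` is one plus the ceiling, so `m` is the ceiling itself and the Taylor polynomial reaches
  -- degree `m + 1 = order`.
  have key := thresholdT_bounds (w := M.center θ i τ) (m := M.order γ n i - 1)
    (ratio_nonneg hM i) (ratio_le_one hM i) hε (hγε i)
    (Real.sqrt_pos.mpr (by positivity)) hgb (abs_slope_le hM i τ) hn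
    (by rw [order, Nat.add_sub_cancel_left])
  rw [Real.exp_log hn0] at key
  obtain ⟨-, hmean, hsq⟩ := coordT_moments hM γ n i τ θ
  refine ⟨?_, ?_⟩
  · rw [hmean]
    exact key.1
  · obtain ⟨c, hc⟩ := key.2
    exact ⟨c, (hsq c).trans hc⟩

/-- The mean absolute error of the risk estimate at a fixed `τ`. -/
lemma integral_abs_ARE_sub_loss_le (hM : M.Positive) {γ : ℕ → ℝ}
    (hγ : ∀ i, γ i < 1 / √(4 * Real.exp 1) - √(M.sigmaP i / M.sigmaF i))
    {ε : ℝ} (hε : 0 < ε) (hγε : ∀ i, ε ≤ γ i) {B V : ℝ} (hB : ∀ i, M.b i + M.h i ≤ B)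
    (hV : ∀ i, M.sigmaF i + M.sigmaP i ≤ V) {n : ℕ} (hn : 1 ≤ Real.log n) (τ : ℝ≥0∞)
    (θ : ℕ → ℝ) :
    Integrable (fun x => |M.ARE γ n x τ - M.loss n θ (M.predictor n τ x)|) (M.pastLaw θ n) ∧
    ∫ x, |M.ARE γ n x τ - M.loss n θ (M.predictor n τ x)| ∂(M.pastLaw θ n)
      ≤ √(42 * B ^ 2 * V * ((1 + Real.log n) ^ 2 * Real.exp (3 / 4 * Real.log n)) / n)
        + B * √V * (20 * (1 + Real.log n) ^ 2 * Real.exp (-(ε ^ 2 / 4 * Real.log n))) := by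
  have hn0 : 0 < n := by
    rcases Nat.eq_zero_or_pos n with rfl | h
    · simp at hn; linarith
    · exact h
  set κ : ℕ → ℝ := fun i => (M.b i + M.h i) * √(M.sigmaF i + M.sigmaP i * M.alpha i τ ^ 2) with hκ
  set k : ℕ → ℝ := fun i => √(M.sigmaF i + M.alpha i τ * M.sigmaP i) * stdQuantile (M.ratio i)
    with hk
  set D : Fin n → ℝ → ℝ := fun i x => κ i * M.coordT γ n i τ x
    - M.coordLoss i (θ i) (M.alpha i τ * x + k i) with hD
  have hbh : ∀ i, 0 < M.b i + M.h i := fun i => add_pos (hM.b i) (hM.h i)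
  have hB0 : 0 < B := (hbh 0).trans_le (hB 0)
  have hsV : ∀ i, M.sigmaF i + M.sigmaP i * M.alpha i τ ^ 2 ≤ V := fun i => by
    have := mul_le_of_le_one_right (hM.sigmaP i).le
      (pow_le_one₀ (alpha_nonneg hM i τ) (alpha_le_one hM i τ) : M.alpha i τ ^ 2 ≤ 1)
    linarith [hV i]
  have hV0 : 0 ≤ V := (add_pos (hM.sigmaF 0) (hM.sigmaP 0)).le.trans (hV 0)
  have hκ0 : ∀ i, 0 ≤ κ i := fun i => mul_nonneg (hbh i).le (Real.sqrt_nonneg _)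
  have hκB : ∀ i, κ i ≤ B * √V := fun i =>
    mul_le_mul (hB i) (Real.sqrt_le_sqrt (hsV i)) (Real.sqrt_nonneg _) hB0.le
  set Y := (1 + Real.log n) ^ 2 * Real.exp (3 / 4 * Real.log n) with hY
  have hY1 : 1 ≤ Y := by
    have h1 : 1 ≤ (1 + Real.log n) ^ 2 := one_le_pow₀ (by linarith)
    have h2 : 1 ≤ Real.exp (3 / 4 * Real.log n) := Real.one_le_exp (by linarith)
    calc (1 : ℝ) = 1 * 1 := by ring
      _ ≤ Y := mul_le_mul h1 h2 zero_le_one (by positivity)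
  have hTm := fun i : Fin n => coordT_moments hM γ n i τ θ
  have hLm := fun i : Fin n => coordLoss_predictor_moment hM θ i (alpha_nonneg hM i τ)
    (alpha_le_one hM i τ) (k i)
  have hTb := fun i : Fin n => coordT_bounds hM hγ hε hγε hn i τ θ
  have hDm : ∀ i : Fin n, MemLp (D i) 2 (M.coordLaw θ i) := fun i =>
    ((hTm i).1.const_mul (κ i)).sub (hLm i).1
  have hmean : ∀ i : Fin n, |∫ x, D i x ∂(M.coordLaw θ i)|
      ≤ B * √V * (20 * (1 + Real.log n) ^ 2 * Real.exp (-(ε ^ 2 / 4 * Real.log n))) := by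
    intro i
    rw [hD]
    rw [integral_sub (((hTm i).1.integrable one_le_two).const_mul _)
      ((hLm i).1.integrable one_le_two), integral_const_mul,
      integral_coordLoss_predictor hM θ i τ, ← mul_sub, abs_mul, abs_of_nonneg (hκ0 i)]
    exact mul_le_mul (hκB i) (hTb i).1 (abs_nonneg _) (by positivity)
  -- The constant `42 = 2 * 20 + 2` comes from `(a - b)² ≤ 2a² + 2b²`, with `20` from the estimate
  -- of `G` and `1` from the loss.
  have hvar : ∀ i : Fin n, Var[D i; M.coordLaw θ i] ≤ 42 * B ^ 2 * V * Y := by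
    intro i
    obtain ⟨c, hc⟩ := (hTb i).2
    set L0 := M.coordLoss i (θ i) (M.alpha i τ * θ i + k i) with hL0
    have hL1 : MemLp (fun x => M.coordT γ n i τ x - c) 2 (M.coordLaw θ i) :=
      (hTm i).1.sub (memLp_const c)
    have hL2 : MemLp (fun x => M.coordLoss i (θ i) (M.alpha i τ * x + k i) - L0) 2
      (M.coordLaw θ i) := (hLm i).1.sub (memLp_const L0)
    -- The variance is at most the second moment about any constant; this one centres the estimate
    -- and the loss separately.
    have hsub := variance_sub_const (hDm i).1 (κ i * c - L0)
    have hle := variance_le_expectation_sq ((hDm i).1.sub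
      (aestronglyMeasurable_const (b := κ i * c - L0)))
    have hle' : Var[D i; M.coordLaw θ i]
        ≤ ∫ x, (D i x - (κ i * c - L0)) ^ 2 ∂(M.coordLaw θ i) := by
      rw [← hsub]; exact hle
    have hκsq : κ i ^ 2 ≤ B ^ 2 * V := by
      have := pow_le_pow_left₀ (hκ0 i) (hκB i) 2
      rwa [mul_pow B, Real.sq_sqrt hV0] at this
    have hbsq : (M.b i + M.h i) ^ 2 * M.sigmaP i ≤ B ^ 2 * V := by
      have h1 := pow_le_pow_left₀ (hbh i).le (hB i) 2
      have h2 : M.sigmaP i ≤ V := by linarith [hV i, hM.sigmaF i]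
      exact mul_le_mul h1 h2 (hM.sigmaP i).le (sq_nonneg B)
    have hi1 := hL1.integrable_sq
    have hi2 := hL2.integrable_sq
    calc Var[D i; M.coordLaw θ i]
        ≤ ∫ x, (D i x - (κ i * c - L0)) ^ 2 ∂(M.coordLaw θ i) := hle'
      _ ≤ ∫ x, (2 * κ i ^ 2 * (M.coordT γ n i τ x - c) ^ 2
          + 2 * (M.coordLoss i (θ i) (M.alpha i τ * x + k i) - L0) ^ 2) ∂(M.coordLaw θ i) := by
          refine integral_mono ((hDm i).sub (memLp_const _)).integrable_sq
            ((hi1.const_mul _).add (hi2.const_mul _)) fun x => ?_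
          simp only [hD]
          linarith only [sq_nonneg (κ i * (M.coordT γ n i τ x - c)
            + (M.coordLoss i (θ i) (M.alpha i τ * x + k i) - L0))]
      _ = 2 * κ i ^ 2 * ∫ x, (M.coordT γ n i τ x - c) ^ 2 ∂(M.coordLaw θ i)
          + 2 * ∫ x, (M.coordLoss i (θ i) (M.alpha i τ * x + k i) - L0) ^ 2
            ∂(M.coordLaw θ i) := by
          rw [integral_add (hi1.const_mul _) (hi2.const_mul _), integral_const_mul,
            integral_const_mul]
      _ ≤ 2 * (B ^ 2 * V) * (20 * Y) + 2 * (B ^ 2 * V) := by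
          have h3 : ∫ x, (M.coordT γ n i τ x - c) ^ 2 ∂(M.coordLaw θ i) ≤ 20 * Y := by
            rw [hY, ← mul_assoc]; exact hc
          have h4 := (hLm i).2
          refine add_le_add (mul_le_mul (by linarith) h3
            (integral_nonneg fun _ => sq_nonneg _) (by positivity)) ?_
          linarith
      _ ≤ 42 * B ^ 2 * V * Y := by
          have : B ^ 2 * V * 1 ≤ B ^ 2 * V * Y := by gcongr
          linarith
  have h := integral_abs_mean_le hn0 (fun i : Fin n => M.coordLaw θ i) D hDm hmean hvar
  have hAL : ∀ x, M.ARE γ n x τ - M.loss n θ (M.predictor n τ x)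
      = 1 / (n : ℝ) * ∑ i, D i (x i) := by
    intro x
    rw [ARE, loss, ← mul_sub, ← Finset.sum_sub_distrib]
    rfl
  simp_rw [hAL]
  exact h

end Model

/-! ### The compactified scale `τ / (τ + 1)` -/

/-- The coordinate `τ / (τ + 1)` of `τ ∈ [0, ∞]` in `[0, 1]`. -/
def unitCoord (τ : ℝ≥0∞) : ℝ := if τ = ⊤ then 1 else τ.toReal / (τ.toReal + 1)

/-- The `τ` with `τ / (τ + 1) = t`. -/
def gridPoint (t : ℝ) : ℝ≥0∞ := ENNReal.ofReal (t / (1 - t))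

lemma unitCoord_nonneg (τ : ℝ≥0∞) : 0 ≤ unitCoord τ := by
  unfold unitCoord
  split_ifs
  · exact zero_le_one
  · have : 0 ≤ τ.toReal := ENNReal.toReal_nonneg
    positivity

lemma unitCoord_le_one (τ : ℝ≥0∞) : unitCoord τ ≤ 1 := by
  unfold unitCoord
  split_ifs
  · exact le_rfl
  · have : 0 ≤ τ.toReal := ENNReal.toReal_nonneg
    rw [div_le_one (by positivity)]
    linarith

lemma unitCoord_gridPoint {t : ℝ} (h0 : 0 ≤ t) (h1 : t < 1) : unitCoord (gridPoint t) = t := by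
  have h2 : 0 < 1 - t := by linarith
  rw [unitCoord, gridPoint, if_neg ENNReal.ofReal_ne_top, ENNReal.toReal_ofReal (by positivity)]
  field_simp
  ring

/-- Every `τ` is within `δ` of a point of the grid of mesh `δ`. -/
lemma exists_grid_index {δ : ℝ} (hδ : 0 < δ) (τ : ℝ≥0∞) :
    ∃ j : ℕ, j < ⌈1 / δ⌉₊ ∧ |unitCoord (gridPoint (j * δ)) - unitCoord τ| ≤ δ := by
  set s := unitCoord τ with hs
  have h0 : 0 ≤ s := unitCoord_nonneg τ
  have h1 : s ≤ 1 := unitCoord_le_one τ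
  have hpos : 0 < ⌈1 / δ⌉₊ := Nat.ceil_pos.mpr (by positivity)
  have hlt : ∀ j : ℕ, j < ⌈1 / δ⌉₊ → unitCoord (gridPoint (j * δ)) = j * δ := by
    intro j hj
    refine unitCoord_gridPoint (by positivity) ?_
    have := Nat.lt_ceil.mp hj
    rwa [lt_div_iff₀ hδ] at this
  -- For `s > 0` the index is `⌈s/δ⌉ - 1`, which stays in range even at `s = 1`, that is `τ = ∞`; `s
  -- = 0` is separate because its ceiling has no predecessor.
  rcases h0.eq_or_lt with h | h
  · refine ⟨0, hpos, ?_⟩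
    rw [hlt 0 hpos, ← h]
    simpa using hδ.le
  · have hc : 0 < ⌈s / δ⌉₊ := Nat.ceil_pos.mpr (by positivity)
    obtain ⟨j, hj⟩ := Nat.exists_eq_succ_of_ne_zero hc.ne'
    have hle : ⌈s / δ⌉₊ ≤ ⌈1 / δ⌉₊ := Nat.ceil_mono (by gcongr)
    have hjlt : j < ⌈1 / δ⌉₊ := by omega
    refine ⟨j, hjlt, ?_⟩
    rw [hlt j hjlt]
    have ha : s / δ ≤ j + 1 := by
      have := Nat.le_ceil (s / δ)
      rw [hj] at this
      exact_mod_cast this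
    have hb : (j : ℝ) < s / δ := Nat.lt_ceil.mp (by omega)
    rw [div_le_iff₀ hδ] at ha
    rw [lt_div_iff₀ hδ] at hb
    rw [abs_le]
    constructor <;> linarith

/-- The difference is `σ (s - t)` over the product of the denominators. Each denominator is a convex
combination of `1` and `σ`, hence at least `min 1 ε`. -/
lemma abs_ratio_sub_le {σ ε V s t : ℝ} (hε : 0 < ε) (hσ : ε ≤ σ) (hσV : σ ≤ V) (hs0 : 0 ≤ s)
    (hs1 : s ≤ 1) (ht0 : 0 ≤ t) (ht1 : t ≤ 1) :
    |s / (s + (1 - s) * σ) - t / (t + (1 - t) * σ)| ≤ V / min 1 ε ^ 2 * |s - t| := by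
  set m := min 1 ε with hm
  have hm0 : 0 < m := lt_min one_pos hε
  have hm1 : m ≤ 1 := min_le_left _ _
  have hmσ : m ≤ σ := (min_le_right _ _).trans hσ
  have hden : ∀ r : ℝ, 0 ≤ r → r ≤ 1 → m ≤ r + (1 - r) * σ := by
    intro r h0 h1
    have := mul_le_mul_of_nonneg_left hmσ (sub_nonneg.mpr h1)
    have := mul_le_mul_of_nonneg_left hm1 h0
    linarith
  have hs := hden s hs0 hs1
  have ht := hden t ht0 ht1
  have e : s / (s + (1 - s) * σ) - t / (t + (1 - t) * σ)
      = σ * (s - t) / ((s + (1 - s) * σ) * (t + (1 - t) * σ)) := by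
    rw [div_sub_div _ _ (hm0.trans_le hs).ne' (hm0.trans_le ht).ne']
    congr 1; ring
  have hσ0 : 0 < σ := hε.trans_le hσ
  rw [e, abs_div, abs_mul, abs_of_pos hσ0, abs_of_pos (mul_pos (hm0.trans_le hs)
    (hm0.trans_le ht)), div_mul_eq_mul_div]
  have hV0 : 0 ≤ V := hσ0.le.trans hσV
  refine div_le_div₀ (by positivity) (by gcongr) (by positivity) ?_
  rw [sq]
  exact mul_le_mul hs ht hm0.le (hm0.le.trans hs)

lemma abs_sqrt_sub_sqrt_le {a b ε : ℝ} (hε : 0 < ε) (ha : ε ≤ a) (hb : ε ≤ b) :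
    |√a - √b| ≤ |a - b| / √ε := by
  have hs : 0 < √ε := Real.sqrt_pos.mpr hε
  rw [le_div_iff₀ hs]
  have h1 : |a - b| = |√a - √b| * (√a + √b) := by
    rw [← abs_of_nonneg (add_nonneg (Real.sqrt_nonneg a) (Real.sqrt_nonneg b)), ← abs_mul]
    congr 1
    rw [← sub_eq_zero]
    have := Real.sq_sqrt (hε.le.trans ha)
    have := Real.sq_sqrt (hε.le.trans hb)
    linarith [abs_of_nonneg (add_nonneg (Real.sqrt_nonneg a) (Real.sqrt_nonneg b)),
      mul_self_nonneg (√a)]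
  rw [h1]
  gcongr
  have := Real.sqrt_le_sqrt ha
  linarith [Real.sqrt_nonneg b]

lemma exists_abs_stdQuantile_le {l u : ℝ} (hl : 0 < l) (hu : u < 1) :
    ∃ Q, 0 ≤ Q ∧ ∀ p, l ≤ p → p ≤ u → |stdQuantile p| ≤ Q := by
  obtain ⟨w0, hw0⟩ := (tendsto_stdCdf_atBot.eventually_lt_const hl).exists
  obtain ⟨w1, hw1⟩ := (tendsto_stdCdf_atTop.eventually_const_lt hu).exists
  refine ⟨max |w0| |w1|, by positivity, fun p hp0 hp1 => ?_⟩
  have hbdd : ∀ w ∈ {w : ℝ | p ≤ stdCdf w}, w0 ≤ w := by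
    intro w hw
    by_contra hcon
    have h1 : stdCdf w ≤ stdCdf w0 := monotone_cdf _ (not_le.mp hcon).le
    have h2 : p ≤ stdCdf w := hw
    linarith
  have hmem : w1 ∈ {w : ℝ | p ≤ stdCdf w} := hp1.trans hw1.le
  have h1 : w0 ≤ stdQuantile p := le_csInf ⟨w1, hmem⟩ hbdd
  have h2 : stdQuantile p ≤ w1 := csInf_le ⟨w0, hbdd⟩ hmem
  rw [abs_le]
  have := neg_abs_le w0
  have := le_abs_self w1
  have := le_max_left |w0| |w1|
  have := le_max_right |w0| |w1|
  constructor <;> linarith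

/-! ### Lipschitz dependence of the loss on the compactified scale. -/

namespace Model

variable {M : Model}

/-- In the compactified coordinate `τ = ∞` is no longer exceptional, and the shrinkage factors
become uniformly Lipschitz. -/
lemma alpha_eq (M : Model) (i : ℕ) (τ : ℝ≥0∞) :
    M.alpha i τ = unitCoord τ / (unitCoord τ + (1 - unitCoord τ) * M.sigmaP i) := by
  unfold alpha unitCoord
  split_ifs
  · simp
  · have h : 0 ≤ τ.toReal := ENNReal.toReal_nonneg
    have h1 : τ.toReal + 1 ≠ 0 := by positivity
    have e : τ.toReal / (τ.toReal + 1) + (1 - τ.toReal / (τ.toReal + 1)) * M.sigmaP i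
        = (τ.toReal + M.sigmaP i) / (τ.toReal + 1) := by
      field_simp; ring
    rw [e, div_div_div_cancel_right₀ h1]

/-- Two-sided bounds on the constants of the model. -/
structure Bounded (M : Model) (ε V B Q : ℝ) : Prop where
  pos : M.Positive
  eps_pos : 0 < ε
  sigmaP_ge : ∀ i, ε ≤ M.sigmaP i
  sigmaF_ge : ∀ i, ε ≤ M.sigmaF i
  sigma_le : ∀ i, M.sigmaF i + M.sigmaP i ≤ V
  weight_le : ∀ i, M.b i + M.h i ≤ B
  quantile_nonneg : 0 ≤ Q
  quantile_le : ∀ i, |stdQuantile (M.ratio i)| ≤ Q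

lemma exists_bounded (hM : M.Positive) (hA1 : M.BoundedWeights) (hA3 : M.SufficientHistory) :
    ∃ ε V B Q, M.Bounded ε V B Q := by
  obtain ⟨l, hl, hl'⟩ := hA1.ratio_lower
  obtain ⟨u, hu, hu'⟩ := hA1.ratio_upper
  obtain ⟨B, hB⟩ := hA1.sum_upper
  obtain ⟨r, hr, hr'⟩ := hA3.var_ratio
  obtain ⟨V, hV⟩ := hA3.future_upper
  obtain ⟨ε, hε, hε'⟩ := hA3.past_lower
  obtain ⟨Q, hQ, hQ'⟩ := exists_abs_stdQuantile_le hl hu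
  have hr1 : r ≤ 1 := hr.le.trans (by
    rw [div_le_one (by positivity)]
    have := Real.add_one_le_exp 1
    linarith)
  -- A variance ratio below `1` transfers the lower bound from `σ_p` to `σ_f` and the upper bound
  -- from `σ_f` to `σ_p`.
  have hPF : ∀ i, M.sigmaP i ≤ M.sigmaF i := fun i => by
    have := (hr' i).trans hr1
    rwa [div_le_one (hM.sigmaF i)] at this
  exact ⟨ε, 2 * V, B, Q, hM, hε, hε', fun i => (hε' i).trans (hPF i),
    fun i => by linarith [hPF i, hV i], hB, hQ, fun i => hQ' _ (hl' i) (hu' i)⟩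

variable {ε V B Q : ℝ}

/-- The loss of `q̂(τ)` is Lipschitz in `τ / (τ + 1)`. -/
lemma exists_abs_loss_sub_le (hM : M.Bounded ε V B Q) :
    ∃ C, 0 ≤ C ∧ ∀ (n : ℕ) (θ : ℕ → ℝ) (x : Fin n → ℝ) (τ τ' : ℝ≥0∞),
      |M.loss n θ (M.predictor n τ x) - M.loss n θ (M.predictor n τ' x)|
        ≤ C * |unitCoord τ - unitCoord τ'| * (1 / (n : ℝ) * ∑ i : Fin n, |x i| + 1) := by
  have hε := hM.eps_pos
  have hB0 : 0 ≤ B := (add_pos (hM.pos.b 0) (hM.pos.h 0)).le.trans (hM.weight_le 0)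
  have hV0 : 0 ≤ V := (add_pos (hM.pos.sigmaF 0) (hM.pos.sigmaP 0)).le.trans (hM.sigma_le 0)
  have hQ := hM.quantile_nonneg
  set A := V / min 1 ε ^ 2 with hA
  have hA0 : 0 ≤ A := by positivity
  set K := 1 + V / √ε * Q with hK
  have hK1 : 1 ≤ K := le_add_of_nonneg_right (by positivity)
  refine ⟨B * (A * K), by positivity, fun n θ x τ τ' => ?_⟩
  set Δ := |unitCoord τ - unitCoord τ'| with hΔ
  have hΔ0 : 0 ≤ Δ := abs_nonneg _
  have hα : ∀ i, |M.alpha i τ - M.alpha i τ'| ≤ A * Δ := fun i => by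
    rw [alpha_eq, alpha_eq]
    exact abs_ratio_sub_le hε (hM.sigmaP_ge i)
      (by linarith [hM.sigma_le i, hM.pos.sigmaF i]) (unitCoord_nonneg _) (unitCoord_le_one _)
      (unitCoord_nonneg _) (unitCoord_le_one _)
  have hge : ∀ i τ, ε ≤ M.sigmaF i + M.alpha i τ * M.sigmaP i := fun i τ => by
    have := mul_nonneg (alpha_nonneg hM.pos i τ) (hM.pos.sigmaP i).le
    linarith [hM.sigmaF_ge i]
  have hq : ∀ i : Fin n, |M.predictor n τ x i - M.predictor n τ' x i|
      ≤ A * K * Δ * (|x i| + 1) := by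
    intro i
    have h1 : |√(M.sigmaF i + M.alpha i τ * M.sigmaP i)
        - √(M.sigmaF i + M.alpha i τ' * M.sigmaP i)| ≤ A * Δ * V / √ε := by
      refine (abs_sqrt_sub_sqrt_le hε (hge i τ) (hge i τ')).trans ?_
      gcongr
      rw [add_sub_add_left_eq_sub, ← sub_mul, abs_mul, abs_of_pos (hM.pos.sigmaP i)]
      exact mul_le_mul (hα i) (by linarith [hM.sigma_le i, hM.pos.sigmaF i])
        (hM.pos.sigmaP i).le (by positivity)
    have e : M.predictor n τ x i - M.predictor n τ' x i
        = (M.alpha i τ - M.alpha i τ') * x i + (√(M.sigmaF i + M.alpha i τ * M.sigmaP i)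
        - √(M.sigmaF i + M.alpha i τ' * M.sigmaP i)) * stdQuantile (M.ratio i) := by
      simp only [predictor]; ring
    rw [e]
    refine (abs_add_le _ _).trans ?_
    rw [abs_mul, abs_mul]
    have h2 : |M.alpha i τ - M.alpha i τ'| * |x i| ≤ A * Δ * |x i| := by gcongr; exact hα i
    have h3 := mul_le_mul h1 (hM.quantile_le i) (abs_nonneg _) (by positivity)
    have h4 : A * Δ * |x i| * 1 ≤ A * Δ * |x i| * K := by gcongr
    have h5 : A * Δ * V / √ε * Q ≤ A * Δ * K := by
      have : A * Δ * V / √ε * Q = A * Δ * (V / √ε * Q) := by ring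
      rw [this, hK]
      gcongr
      linarith
    linarith
  rw [loss, loss, ← mul_sub, ← Finset.sum_sub_distrib, abs_mul,
    abs_of_nonneg (by positivity : (0 : ℝ) ≤ 1 / n)]
  have hsum : |∑ i : Fin n, (M.coordLoss i (θ i) (M.predictor n τ x i)
      - M.coordLoss i (θ i) (M.predictor n τ' x i))|
      ≤ ∑ i : Fin n, B * (A * K * Δ * (|x i| + 1)) := by
    refine (Finset.abs_sum_le_sum_abs _ _).trans (Finset.sum_le_sum fun i _ => ?_)
    refine (abs_coordLoss_sub_le hM.pos i _ _ _).trans ?_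
    exact mul_le_mul (hM.weight_le i) (hq i) (abs_nonneg _) hB0
  calc 1 / (n : ℝ) * |∑ i : Fin n, (M.coordLoss i (θ i) (M.predictor n τ x i)
      - M.coordLoss i (θ i) (M.predictor n τ' x i))|
      ≤ 1 / (n : ℝ) * ∑ i : Fin n, B * (A * K * Δ * (|x i| + 1)) := by gcongr
    _ = B * (A * K) * Δ * (1 / (n : ℝ) * ∑ i : Fin n, |x i| + 1 / (n : ℝ) * n) := by
        rw [← Finset.mul_sum, ← Finset.mul_sum, Finset.sum_add_distrib]
        simp only [Finset.sum_const, Finset.card_univ, Fintype.card_fin, nsmul_eq_mul, mul_one]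
        ring
    _ ≤ B * (A * K) * Δ * (1 / (n : ℝ) * ∑ i : Fin n, |x i| + 1) := by
        gcongr
        -- An inequality rather than an equality, because `n / n = 0` for `n = 0`.
        rw [one_div_mul_eq_div]
        exact div_self_le_one _

/-! ### Integrability and measurability of the losses -/

instance (θ : ℕ → ℝ) (n : ℕ) : IsProbabilityMeasure (M.pastLaw θ n) := by
  unfold pastLaw; infer_instance

lemma loss_nonneg (hM : M.Positive) (n : ℕ) (θ : ℕ → ℝ) (q : Fin n → ℝ) : 0 ≤ M.loss n θ q :=
  mul_nonneg (by positivity) (Finset.sum_nonneg fun i _ => coordLoss_nonneg hM _ _ _)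

lemma measurable_alpha (M : Model) (i : ℕ) : Measurable (M.alpha i) := by
  unfold alpha
  exact Measurable.ite (measurableSet_singleton ⊤) measurable_const
    (ENNReal.measurable_toReal.div (ENNReal.measurable_toReal.add_const _))

lemma measurable_loss_predictor (hM : M.Positive) (n : ℕ) (θ : ℕ → ℝ)
    {τ : (Fin n → ℝ) → ℝ≥0∞} (hτ : Measurable τ) :
    Measurable fun x => M.loss n θ (M.predictor n (τ x) x) := by
  unfold loss
  refine (Finset.measurable_sum _ fun i _ => ?_).const_mul _
  refine (continuous_coordLoss hM i (θ i)).measurable.comp ?_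
  have h := (measurable_alpha M i).comp hτ
  simp only [predictor]
  exact (h.mul (measurable_pi_apply i)).add
    ((Real.continuous_sqrt.measurable.comp ((h.mul_const _).const_add _)).mul_const _)

lemma integral_abs_coord (hM : M.Bounded ε V B Q) (θ : ℕ → ℝ) (n : ℕ) (i : Fin n) :
    Integrable (fun x : Fin n → ℝ => |x i|) (M.pastLaw θ n) ∧
    ∫ x, |x i| ∂(M.pastLaw θ n) ≤ |θ i| + √V := by
  have hL : MemLp (fun x : ℝ => |x - θ i|) 2 (M.coordLaw θ i) :=
    ((memLp_id_gaussianReal' 2 (by simp)).sub (memLp_const (θ i))).abs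
  have hi : Integrable (fun x : ℝ => |x|) (M.coordLaw θ i) := (integrable_id_gaussianReal _ _).abs
  refine ⟨integrable_comp_eval (μ := fun i : Fin n => M.coordLaw θ i) hi, ?_⟩
  have h1 : ∫ x, |x i| ∂(M.pastLaw θ n) = ∫ x, |x| ∂(M.coordLaw θ i) :=
    integral_comp_eval (μ := fun i : Fin n => M.coordLaw θ i) (f := fun x : ℝ => |x|) hi.1
  have h2 := sq_integral_le hL
  simp only [sq_abs] at h2
  rw [(integrable_id_sub_sq_coordLaw hM.pos θ i).2] at h2
  have h3 : ∫ x, |x - θ i| ∂(M.coordLaw θ i) ≤ √V :=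
    Real.le_sqrt_of_sq_le (h2.trans (by linarith [hM.sigma_le i, hM.pos.sigmaF i]))
  rw [h1]
  calc ∫ x, |x| ∂(M.coordLaw θ i) ≤ ∫ x, (|θ i| + |x - θ i|) ∂(M.coordLaw θ i) := by
        refine integral_mono hi ((integrable_const _).add (hL.integrable one_le_two)) fun x => ?_
        have := abs_add_le (θ i) (x - θ i)
        simpa using this
    _ = |θ i| + ∫ x, |x - θ i| ∂(M.coordLaw θ i) := by
        rw [integral_add (integrable_const _) (hL.integrable one_le_two)]
        simp
    _ ≤ |θ i| + √V := by linarith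

lemma integral_mean_abs (hM : M.Bounded ε V B Q) (θ : ℕ → ℝ) (n : ℕ) :
    Integrable (fun x : Fin n → ℝ => 1 / (n : ℝ) * ∑ i : Fin n, |x i| + 1) (M.pastLaw θ n) ∧
    ∫ x, (1 / (n : ℝ) * ∑ i : Fin n, |x i| + 1) ∂(M.pastLaw θ n)
      ≤ 1 / (n : ℝ) * ∑ i ∈ Finset.range n, |θ i| + √V + 1 := by
  have hi : Integrable (fun x : Fin n → ℝ => 1 / (n : ℝ) * ∑ i : Fin n, |x i|) (M.pastLaw θ n) :=
    (integrable_finsetSum _ fun i _ => (integral_abs_coord hM θ n i).1).const_mul _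
  refine ⟨hi.add (integrable_const 1), ?_⟩
  rw [integral_add hi (integrable_const 1), integral_const_mul,
    integral_finsetSum _ fun i _ => (integral_abs_coord hM θ n i).1]
  have h1 : ∑ i : Fin n, ∫ x, |x i| ∂(M.pastLaw θ n) ≤ ∑ i : Fin n, (|θ i| + √V) :=
    Finset.sum_le_sum fun i _ => (integral_abs_coord hM θ n i).2
  rw [Finset.sum_add_distrib, ← Finset.sum_range (fun i => |θ i|)] at h1
  have h2 : 1 / (n : ℝ) * ∑ i : Fin n, ∫ x, |x i| ∂(M.pastLaw θ n)
      ≤ 1 / (n : ℝ) * (∑ i ∈ Finset.range n, |θ i| + ∑ _i : Fin n, √V) := by gcongr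
  have h3 : 1 / (n : ℝ) * (∑ _i : Fin n, √V) ≤ √V := by
    simp only [Finset.sum_const, Finset.card_univ, Fintype.card_fin, nsmul_eq_mul]
    rw [← mul_assoc, one_div_mul_eq_div]
    exact mul_le_of_le_one_left (Real.sqrt_nonneg V) (div_self_le_one _)
  simp only [integral_const, probReal_univ, smul_eq_mul, one_mul]
  linarith

lemma integrable_loss_predictor_const (hM : M.Positive) (n : ℕ) (θ : ℕ → ℝ) (τ : ℝ≥0∞) :
    Integrable (fun x => M.loss n θ (M.predictor n τ x)) (M.pastLaw θ n) := by
  unfold loss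
  refine (integrable_finsetSum _ fun i _ => ?_).const_mul _
  exact integrable_comp_eval (μ := fun i : Fin n => M.coordLaw θ i)
    ((coordLoss_predictor_moment hM θ i (alpha_nonneg hM i τ) (alpha_le_one hM i τ) _).1.integrable
      one_le_two)

/-- Comparison with `τ = 0`, as the compactified coordinates differ by at most `1`. Measurability is
asked of the loss and not of `τ`, since the oracle may be a nonmeasurable selection. -/
lemma integrable_loss_predictor (hM : M.Bounded ε V B Q) (n : ℕ) (θ : ℕ → ℝ)
    {τ : (Fin n → ℝ) → ℝ≥0∞} (hm : Measurable fun x => M.loss n θ (M.predictor n (τ x) x)) :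
    Integrable (fun x => M.loss n θ (M.predictor n (τ x) x)) (M.pastLaw θ n) := by
  obtain ⟨C, hC, hLip⟩ := exists_abs_loss_sub_le hM
  refine ((integrable_loss_predictor_const hM.pos n θ 0).add
    ((integral_mean_abs hM θ n).1.const_mul C)).mono' hm.aestronglyMeasurable
    (ae_of_all _ fun x => ?_)
  rw [Real.norm_eq_abs, abs_of_nonneg (loss_nonneg hM.pos _ _ _)]
  have h1 := hLip n θ x (τ x) 0
  have h2 : |unitCoord (τ x) - unitCoord 0| ≤ 1 := by
    rw [abs_le]
    have := unitCoord_nonneg (τ x)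
    have := unitCoord_le_one (τ x)
    have := unitCoord_nonneg 0
    have := unitCoord_le_one 0
    constructor <;> linarith
  have h3 : C * |unitCoord (τ x) - unitCoord 0| * (1 / (n : ℝ) * ∑ i : Fin n, |x i| + 1)
      ≤ C * 1 * (1 / (n : ℝ) * ∑ i : Fin n, |x i| + 1) := by gcongr
  have h4 := (abs_le.mp h1).2
  simp only [Pi.add_apply]
  linarith

/-- The minimal loss is measurable, whatever the choice of the minimizer. -/
lemma measurable_min_loss (hM : M.Bounded ε V B Q) (n : ℕ) (θ : ℕ → ℝ)
    {τ : (Fin n → ℝ) → ℝ≥0∞}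
    (hmin : ∀ x, ∀ t, M.loss n θ (M.predictor n (τ x) x) ≤ M.loss n θ (M.predictor n t x)) :
    Measurable fun x => M.loss n θ (M.predictor n (τ x) x) := by
  obtain ⟨C, hC, hLip⟩ := exists_abs_loss_sub_le hM
  refine measurable_of_Iio fun c => ?_
  -- Being a minimum of a function continuous in `τ`, the loss is below `c` exactly when it is at
  -- one of countably many dense grid points. Indices beyond the range are harmless, because the
  -- minimum lies below the loss at every point.
  have heq : (fun x => M.loss n θ (M.predictor n (τ x) x)) ⁻¹' Set.Iio c
      = ⋃ k : ℕ, ⋃ j : ℕ,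
        {x | M.loss n θ (M.predictor n (gridPoint (j * (1 / ((k : ℝ) + 1)))) x) < c} := by
    ext x
    simp only [Set.mem_preimage, Set.mem_Iio, Set.mem_iUnion, Set.mem_ofPred_eq]
    constructor
    · intro hx
      set W := 1 / (n : ℝ) * ∑ i : Fin n, |x i| + 1 with hW
      have hW0 : 0 < W := by positivity
      set L := M.loss n θ (M.predictor n (τ x) x) with hL
      obtain ⟨k, hk⟩ := exists_nat_one_div_lt
        (show 0 < (c - L) / (C * W + 1) from div_pos (sub_pos.mpr hx) (by positivity))
      have hδ : 0 < 1 / ((k : ℝ) + 1) := by positivity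
      obtain ⟨j, -, hj⟩ := exists_grid_index hδ (τ x)
      refine ⟨k, j, ?_⟩
      have h1 := (abs_le.mp (hLip n θ x (gridPoint (j * (1 / ((k : ℝ) + 1)))) (τ x))).2
      have h2 : C * |unitCoord (gridPoint (j * (1 / ((k : ℝ) + 1)))) - unitCoord (τ x)| * W
          ≤ C * (1 / ((k : ℝ) + 1)) * W := by gcongr
      rw [lt_div_iff₀ (by positivity)] at hk
      linarith
    · rintro ⟨k, j, h⟩
      exact (hmin x _).trans_lt h
  rw [heq]
  refine MeasurableSet.iUnion fun k => MeasurableSet.iUnion fun j => ?_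
  exact measurableSet_lt (measurable_loss_predictor hM.pos n θ measurable_const) measurable_const

end Model

/-! ### Asymptotics -/

lemma tendsto_pow_mul_exp_log {c : ℝ} (hc : 0 < c) (k : ℕ) :
    Tendsto (fun n : ℕ => (1 + Real.log n) ^ k * Real.exp (-(c * Real.log n))) atTop (𝓝 0) := by
  have h1 : Tendsto (fun n : ℕ => c * (1 + Real.log n)) atTop atTop :=
    (tendsto_atTop_add_const_left _ _
      (Real.tendsto_log_atTop.comp tendsto_natCast_atTop_atTop)).const_mul_atTop hc
  have h2 := ((Real.tendsto_pow_mul_exp_neg_atTop_nhds_zero k).comp h1).const_mul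
    (Real.exp c / c ^ k)
  rw [mul_zero] at h2
  refine h2.congr fun n => ?_
  simp only [Function.comp_apply]
  rw [mul_pow, show -(c * (1 + Real.log n)) = -c + -(c * Real.log n) by ring, Real.exp_add,
    Real.exp_neg c]
  field_simp

section Grid

variable {C₁ C₂ C₃ C₄ : ℝ}

lemma tendsto_gridStep (hC₁ : 0 < C₁) (hC₂ : 0 < C₂) (hC₃ : 0 ≤ C₃) (hC₄ : 0 ≤ C₄) :
    Tendsto (gridStep C₁ C₂ C₃ C₄) atTop (𝓝 0) := by
  have ha : Tendsto (fun n : ℕ => Real.log (Real.log n)) atTop atTop :=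
    Real.tendsto_log_atTop.comp (Real.tendsto_log_atTop.comp tendsto_natCast_atTop_atTop)
  unfold gridStep
  refine tendsto_inv_atTop_zero.comp (Tendsto.const_mul_atTop (by positivity) ?_)
  refine tendsto_atTop_mono (fun n => ?_) ha
  have := stdPdf_nonneg 0
  have : 0 ≤ √(Real.log (Real.log n)) * C₄ := by positivity
  linarith

lemma gridStep_pos (hC₁ : 0 < C₁) (hC₂ : 0 < C₂) (hC₃ : 0 ≤ C₃) (hC₄ : 0 ≤ C₄) {n : ℕ}
    (hn : 1 ≤ Real.log n) : 0 < gridStep C₁ C₂ C₃ C₄ n := by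
  have h1 := stdPdf_zero_gt
  have h2 : 0 ≤ √(Real.log (Real.log n)) * C₄ := by positivity
  have h3 := Real.log_nonneg hn
  exact inv_pos.mpr (mul_pos (by positivity) (by linarith))

/-- The inverse mesh is of order `log log n`; the cruder bound by `log n` already suffices against
the power of `n` in the error. -/
lemma exists_ceil_gridStep_le (hC₁ : 0 < C₁) (hC₂ : 0 < C₂) (hC₃ : 0 ≤ C₃) (hC₄ : 0 ≤ C₄) :
    ∃ K, 0 ≤ K ∧ ∀ n : ℕ, 1 ≤ Real.log n →
      (⌈1 / gridStep C₁ C₂ C₃ C₄ n⌉₊ : ℝ) ≤ K * (1 + Real.log n) := by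
  refine ⟨2 * C₁ * C₂ * (1 + C₃ + C₄ + 1) + 1, by positivity, fun n hn => ?_⟩
  have hpos := gridStep_pos hC₁ hC₂ hC₃ hC₄ hn
  refine (Nat.ceil_lt_add_one (by positivity)).le.trans ?_
  have h1 := stdPdf_zero_le_half
  have h3 := Real.log_nonneg hn
  have h4 : Real.log (Real.log n) ≤ Real.log n := (Real.log_le_sub_one_of_pos (by linarith)).trans
    (by linarith)
  have h5 : √(Real.log (Real.log n)) ≤ 1 + Real.log n := by
    rw [Real.sqrt_le_left (by linarith)]
    nlinarith
  have h6 : √(Real.log (Real.log n)) * C₄ ≤ (1 + Real.log n) * C₄ := by gcongr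
  have h7 : 0 ≤ C₃ * Real.log n := by positivity
  rw [one_div, gridStep, inv_inv]
  have h8 : 2 * stdPdf 0 + C₃ + √(Real.log (Real.log n)) * C₄ + Real.log (Real.log n)
      ≤ (1 + C₃ + C₄ + 1) * (1 + Real.log n) := by linarith
  calc 2 * C₁ * C₂ * (2 * stdPdf 0 + C₃ + √(Real.log (Real.log n)) * C₄ + Real.log (Real.log n)) + 1
      ≤ 2 * C₁ * C₂ * ((1 + C₃ + C₄ + 1) * (1 + Real.log n)) + 1 * (1 + Real.log n) := by
        gcongr
        linarith
    _ = _ := by ring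

end Grid

/-! ### Finite-sample regret over the grid. -/

namespace Model

variable {M : Model} {ε V B Q : ℝ}

/-- Finite-sample comparison of the grid minimizer of the risk estimate with the oracle. -/
lemma integral_regret_le (hM : M.Bounded ε V B Q) {C : ℝ} (hC : 0 ≤ C) {n : ℕ} {θ : ℕ → ℝ}
    (hLip : ∀ (x : Fin n → ℝ) (τ τ' : ℝ≥0∞),
      |M.loss n θ (M.predictor n τ x) - M.loss n θ (M.predictor n τ' x)|
        ≤ C * |unitCoord τ - unitCoord τ'| * (1 / (n : ℝ) * ∑ i : Fin n, |x i| + 1))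
    {γ : ℕ → ℝ} {C₁ C₂ C₃ C₄ : ℝ} (hδ : 0 < gridStep C₁ C₂ C₃ C₄ n) {E : ℝ}
    (hE : ∀ τ, Integrable (fun x => |M.ARE γ n x τ - M.loss n θ (M.predictor n τ x)|)
        (M.pastLaw θ n) ∧
      ∫ x, |M.ARE γ n x τ - M.loss n θ (M.predictor n τ x)| ∂(M.pastLaw θ n) ≤ E)
    {τA τO : (Fin n → ℝ) → ℝ≥0∞} (hA : Measurable τA)
    (hAmem : ∀ x, τA x ∈ grid C₁ C₂ C₃ C₄ n)
    (hAmin : ∀ x, ∀ τ ∈ grid C₁ C₂ C₃ C₄ n, M.ARE γ n x (τA x) ≤ M.ARE γ n x τ)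
    (hOmin : ∀ x, ∀ t, M.loss n θ (M.predictor n (τO x) x) ≤ M.loss n θ (M.predictor n t x)) :
    0 ≤ M.risk n θ (fun x => M.predictor n (τA x) x)
        - ∫ x, M.loss n θ (M.predictor n (τO x) x) ∂(M.pastLaw θ n) ∧
    M.risk n θ (fun x => M.predictor n (τA x) x)
        - ∫ x, M.loss n θ (M.predictor n (τO x) x) ∂(M.pastLaw θ n)
      ≤ 2 * (⌈1 / gridStep C₁ C₂ C₃ C₄ n⌉₊ * E) + C * gridStep C₁ C₂ C₃ C₄ n
        * (1 / (n : ℝ) * ∑ i ∈ Finset.range n, |θ i| + √V + 1) := by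
  set δ := gridStep C₁ C₂ C₃ C₄ n with hδdef
  have hiA := integrable_loss_predictor hM n θ (measurable_loss_predictor hM.pos n θ hA)
  have hiO := integrable_loss_predictor hM n θ (measurable_min_loss hM n θ hOmin)
  rw [risk, ← integral_sub hiA hiO]
  refine ⟨integral_nonneg fun x => sub_nonneg.mpr (hOmin x _), ?_⟩
  set err : ℝ≥0∞ → (Fin n → ℝ) → ℝ := fun τ x =>
    |M.ARE γ n x τ - M.loss n θ (M.predictor n τ x)| with herr
  -- The sum over the grid replaces the maximum: `τA` depends on the data, so its error cannot be
  -- bounded by that of a fixed `τ`.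
  set S : (Fin n → ℝ) → ℝ := fun x =>
    ∑ j ∈ Finset.range ⌈1 / δ⌉₊, err (gridPoint (j * δ)) x with hS
  have hSi : Integrable S (M.pastLaw θ n) := integrable_finsetSum _ fun j _ => (hE _).1
  have hSE : ∫ x, S x ∂(M.pastLaw θ n) ≤ ⌈1 / δ⌉₊ * E := by
    rw [hS, integral_finsetSum _ fun j _ => (hE _).1]
    calc _ ≤ ∑ _j ∈ Finset.range ⌈1 / δ⌉₊, E := Finset.sum_le_sum fun j _ => (hE _).2
      _ = _ := by simp
  have herrS : ∀ x, ∀ j < ⌈1 / δ⌉₊, err (gridPoint (j * δ)) x ≤ S x := fun x j hj =>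
    Finset.single_le_sum (f := fun j : ℕ => err (gridPoint (j * δ)) x)
      (fun _ _ => abs_nonneg _) (Finset.mem_range.mpr hj)
  obtain ⟨hWi, hW⟩ := integral_mean_abs hM θ n
  have hpt : ∀ x, M.loss n θ (M.predictor n (τA x) x) - M.loss n θ (M.predictor n (τO x) x)
      ≤ 2 * S x + C * δ * (1 / (n : ℝ) * ∑ i : Fin n, |x i| + 1) := by
    intro x
    obtain ⟨j, hj, hjd⟩ := exists_grid_index hδ (τO x)
    obtain ⟨jA, hjA, hτA⟩ := hAmem x
    have h1 : err (τA x) x ≤ S x := by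
      rw [hτA]
      exact herrS x jA hjA
    have h2 := herrS x j hj
    have h3 := hAmin x (gridPoint (j * δ)) ⟨j, hj, rfl⟩
    have h4 := hLip x (gridPoint (j * δ)) (τO x)
    have h5 : C * |unitCoord (gridPoint (j * δ)) - unitCoord (τO x)|
        * (1 / (n : ℝ) * ∑ i : Fin n, |x i| + 1)
        ≤ C * δ * (1 / (n : ℝ) * ∑ i : Fin n, |x i| + 1) := by gcongr
    have h6 := (abs_le.mp h4).2
    -- The telescoping `L(τA) → ARE(τA) → ARE(τ') → L(τ') → L(τO)`: the outer passages to and from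
    -- `ARE` cost `S` each, the middle one is free by minimality, and the last is the Lipschitz
    -- bound.
    have h7 := neg_abs_le (M.ARE γ n x (τA x) - M.loss n θ (M.predictor n (τA x) x))
    have h8 := le_abs_self (M.ARE γ n x (gridPoint (j * δ))
      - M.loss n θ (M.predictor n (gridPoint (j * δ)) x))
    simp only [herr] at h1 h2
    linarith
  calc ∫ x, (M.loss n θ (M.predictor n (τA x) x) - M.loss n θ (M.predictor n (τO x) x))
        ∂(M.pastLaw θ n)
      ≤ ∫ x, (2 * S x + C * δ * (1 / (n : ℝ) * ∑ i : Fin n, |x i| + 1)) ∂(M.pastLaw θ n) :=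
        integral_mono (hiA.sub hiO) ((hSi.const_mul 2).add (hWi.const_mul _)) hpt
    _ = 2 * ∫ x, S x ∂(M.pastLaw θ n)
        + C * δ * ∫ x, (1 / (n : ℝ) * ∑ i : Fin n, |x i| + 1) ∂(M.pastLaw θ n) := by
        rw [integral_add (hSi.const_mul 2) (hWi.const_mul _), integral_const_mul,
          integral_const_mul]
    _ ≤ _ := by gcongr

end Model

/-- The limsup is taken in `EReal`, so its finiteness really is boundedness and not an effect of a
default real value. -/
lemma BoundedParameter.exists_eventually_le {θ : ℕ → ℝ} (h : BoundedParameter θ) :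
    ∃ A : ℝ, ∀ᶠ n : ℕ in atTop, 1 / (n : ℝ) * ∑ i ∈ Finset.range n, |θ i| ≤ A := by
  obtain ⟨A, hA, -⟩ := EReal.lt_iff_exists_real_btwn.mp h
  refine ⟨A, (eventually_lt_of_limsup_lt hA).mono fun n hn => ?_⟩
  exact_mod_cast hn.le

end CheckLoss

end

/-! ### Oracle optimality. -/

theorem mainTheorem5
    (M : CheckLoss.Model)
    (hb : ∀ i, 0 < M.b i) (hh : ∀ i, 0 < M.h i)
    (hsigmaF : ∀ i, 0 < M.sigmaF i)
    (hA1 : M.BoundedWeights) (hA3 : M.SufficientHistory)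
    (θ : ℕ → ℝ) (hA2 : CheckLoss.BoundedParameter θ)
    -- the tuning constants of the thresholds
    (γ : ℕ → ℝ)
    (hγ_upper : ∀ i, γ i < 1 / Real.sqrt (4 * Real.exp 1) - Real.sqrt (M.sigmaP i / M.sigmaF i))
    (hγ_lower : ∃ ε > 0, ∀ i, ε ≤ γ i)
    -- the constants of the grid
    (C₁ C₂ C₃ C₄ : ℝ) (hC₁ : 0 < C₁) (hC₂ : 0 < C₂) (hC₃ : 0 ≤ C₃) (hC₄ : 0 ≤ C₄)
    -- a measurable minimizer of the asymptotic risk estimate over the grid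
    (tauARE : (n : ℕ) → (Fin n → ℝ) → ℝ≥0∞)
    (htauARE_meas : ∀ n, Measurable (tauARE n))
    (htauARE_mem : ∀ n x, tauARE n x ∈ CheckLoss.grid C₁ C₂ C₃ C₄ n)
    (htauARE_min : ∀ n x, ∀ τ ∈ CheckLoss.grid C₁ C₂ C₃ C₄ n,
      M.ARE γ n x (tauARE n x) ≤ M.ARE γ n x τ)
    -- a minimizer of the true loss over `[0, ∞]`
    (tauOR : (n : ℕ) → (Fin n → ℝ) → ℝ≥0∞)
    (htauOR_min : ∀ n x, ∀ τ : ℝ≥0∞,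
      M.loss n θ (M.predictor n (tauOR n x) x) ≤ M.loss n θ (M.predictor n τ x)) :
    (∀ n, Integrable (fun x => M.loss n θ (M.predictor n (tauARE n x) x)) (M.pastLaw θ n)) ∧
    (∀ n, Integrable (fun x => M.loss n θ (M.predictor n (tauOR n x) x)) (M.pastLaw θ n)) ∧
    Tendsto
      (fun n : ℕ =>
        M.risk n θ (fun x => M.predictor n (tauARE n x) x)
          - ∫ x, M.loss n θ (M.predictor n (tauOR n x) x) ∂(M.pastLaw θ n))
      atTop (𝓝 0) := by
  have hpos : M.Positive := ⟨hb, hh, fun i => by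
    obtain ⟨e, he, h⟩ := hA3.past_lower
    exact he.trans_le (h i), hsigmaF⟩
  obtain ⟨ε, V, B, Q, hM⟩ := CheckLoss.Model.exists_bounded hpos hA1 hA3
  refine ⟨fun n => CheckLoss.Model.integrable_loss_predictor hM n θ
      (CheckLoss.Model.measurable_loss_predictor hpos n θ (htauARE_meas n)),
    fun n => CheckLoss.Model.integrable_loss_predictor hM n θ
      (CheckLoss.Model.measurable_min_loss hM n θ (htauOR_min n)), ?_⟩
  obtain ⟨g, hg, hγg⟩ := hγ_lower
  obtain ⟨A, hA⟩ := hA2.exists_eventually_le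
  obtain ⟨C, hC, hLip⟩ := CheckLoss.Model.exists_abs_loss_sub_le hM
  obtain ⟨K, hK, hKm⟩ := CheckLoss.exists_ceil_gridStep_le hC₁ hC₂ hC₃ hC₄
  have hlog : Tendsto (fun n : ℕ => Real.log n) atTop atTop :=
    Real.tendsto_log_atTop.comp tendsto_natCast_atTop_atTop
  -- The number of grid points adds one factor `1 + log n` to the error at a fixed `τ`, which
  -- explains the powers `2` and `3`; the decay like `n^(-1/8)` and `n^(-g²/4)` wins.
  have hbound : Tendsto (fun n : ℕ =>
      2 * (K * (√(42 * B ^ 2 * V) * ((1 + Real.log n) ^ 2 * Real.exp (-(1 / 8 * Real.log n)))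
        + 20 * (B * √V) * ((1 + Real.log n) ^ 3 * Real.exp (-(g ^ 2 / 4 * Real.log n)))))
      + C * CheckLoss.gridStep C₁ C₂ C₃ C₄ n * (A + √V + 1)) atTop (𝓝 0) := by
    have h1 := (CheckLoss.tendsto_pow_mul_exp_log (c := 1 / 8) (by norm_num) 2).const_mul
      (√(42 * B ^ 2 * V))
    have h2 := (CheckLoss.tendsto_pow_mul_exp_log (c := g ^ 2 / 4) (by positivity) 3).const_mul
      (20 * (B * √V))
    have h3 := ((CheckLoss.tendsto_gridStep hC₁ hC₂ hC₃ hC₄).const_mul C).mul_const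
      (A + √V + 1)
    simpa using (((h1.add h2).const_mul K).const_mul 2).add h3
  refine squeeze_zero' ?_ ?_ hbound
  all_goals
    filter_upwards [hlog.eventually_ge_atTop 1, hA] with n hn hAn
    have hδ := CheckLoss.gridStep_pos hC₁ hC₂ hC₃ hC₄ hn
    have key := CheckLoss.Model.integral_regret_le hM hC (hLip n θ) hδ
      (fun τ => CheckLoss.Model.integral_abs_ARE_sub_loss_le hpos hγ_upper hg hγg hM.weight_le
        hM.sigma_le hn τ θ) (htauARE_meas n) (htauARE_mem n) (htauARE_min n) (htauOR_min n)
  · exact key.1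
  · refine key.2.trans ?_
    have hn0 : (0 : ℝ) < n := by
      rcases Nat.eq_zero_or_pos n with rfl | h
      · simp at hn; linarith
      · exact_mod_cast h
    have hl : 0 ≤ 1 + Real.log n := by linarith
    have hB0 : 0 ≤ B := (add_pos (hb 0) (hh 0)).le.trans (hM.weight_le 0)
    -- The variance bound `n^(3/4)` divided by `n` is `n^(-1/4)`, and its root is `n^(-1/8)`.
    have hroot : √(42 * B ^ 2 * V * ((1 + Real.log n) ^ 2 * Real.exp (3 / 4 * Real.log n)) / n)
        = √(42 * B ^ 2 * V) * ((1 + Real.log n) * Real.exp (-(1 / 8 * Real.log n))) := by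
      rw [← Real.sqrt_sq (mul_nonneg hl (Real.exp_pos (-(1 / 8 * Real.log n))).le),
        ← Real.sqrt_mul' _ (sq_nonneg _)]
      congr 1
      rw [mul_div_assoc, mul_div_assoc, mul_pow, ← Real.exp_nat_mul]
      congr 2
      nth_rewrite 2 [← Real.exp_log hn0]
      rw [← Real.exp_sub]
      congr 1
      push_cast; ring
    rw [hroot]
    have hE0 : 0 ≤ √(42 * B ^ 2 * V) * ((1 + Real.log n) * Real.exp (-(1 / 8 * Real.log n)))
        + B * √V * (20 * (1 + Real.log n) ^ 2 * Real.exp (-(g ^ 2 / 4 * Real.log n))) := by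
      positivity
    refine add_le_add ?_ ?_
    · refine mul_le_mul_of_nonneg_left ?_ zero_le_two
      refine (mul_le_mul_of_nonneg_right (hKm n hn) hE0).trans (le_of_eq ?_)
      ring
    · exact mul_le_mul_of_nonneg_left (by linarith) (mul_nonneg hC hδ.le)
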